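/- **Setting.** Let $k_1,\dots,k_p$ be distinct points of the upper half-plane such that no cut $\Gamma_j=(k_j,k_j+i\infty)$ passes through another $k_i$, and let $H_1,\dots,H_p$ be $N\times N$ matrices of algebraic functions such that, for some $\epsilon>0$: $H_j$ is analytic in the half-strip $\Omega+k_j$, $\Omega=\{|\mathrm{Re}\,k|<\epsilon,\ \mathrm{Im}\,k>0\}$; $H_j(k)\to I$ as $\mathrm{Im}\,k\to\infty$ in $\Omega+k_j$; $\det H_j\neq0$ on $\Gamma_j$; $H_j(k)$ has distinct eigenvalues for almost every $k\in\Omega+k_j$; and all values at the same point $k$ of all analytic continuations of all the $H_j$ commute. For $b\in(0,i\infty)$ let $F_j(k_j+b)$ be the diagonal matrix of the eigenvalues of $H_j(k_j+b)$, ordered so that $\log F_j(k_j+b)$ is continuous in $b$, with the branch of the logarithm for which $\log F_j(k_j+b)\to0$ as $b\to i\infty$. For every $b\in(0,i\infty)$ let $U(b,k)$ be analytic with $\det U\ne0$ in the $k$-plane cut along $\Gamma_j(b)=(k_j+b,k_j+i\infty)$, $j=1,\dots,p$, with $U(b,k)\to I$ as $|k|\to\infty$, and with continuous non-singular values on the right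 ($k^+$) and left ($k^-$) shores satisfying $U(b,k^+)=U(b,k^-)H_j(k)$ for $k\in\Gamma_j(b)$. Whenever $H_j(k_j+b)$ has distinct eigenvalues, the leading term of $U(b,k)$ at $a=k_j+b$ is $K\,(k-a)^{\log F_j(a)/(2\pi i)}P(k)^{-1}$, i.e. $U(b,k)P(k)(k-a)^{-\log F_j(a)/(2\pi i)}\to K$ as $k\to a$, where $K$ is a non-singular matrix, $P$ is an analytic non-singular matrix of eigenvectors of $H_j$ near $a$ (with columns in the order of $F_j(a)$), and the power is cut along $\Gamma_j(b)$. Let $s_1,\dots,s_p$ be the continuous matrix functions of $b\in(0,i\infty)$ in the equation $$\text{(ODE1)}\qquad \partial_b U(b,k)=\Big(\sum_{j=1}^p\frac{s_j(b)}{k-(k_j+b)}\Big)U(b,k)$$ satisfied by $U$, where derivatives in $b$ are taken along the half-line. Let $\mathcal F(X,Y)$ denote a matrix with the eigenvalues of $X$ (with multiplicities) and the eigenvectors of $Y$, for $Y$ with $N$ distinct eigenvalues; it is determined up to the choice of a correspondence between the eigenvalues of $X$ and the eigenvectors of $Y$. **Theorem.** There exists a rational matrix $B(k)=I+\sum_{l=1}^d\frac{t_l}{k-\rho_l}$,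 with distinct $\rho_l$ lying on none of the $\Gamma_j$ and with distinct eigenvalues for almost every $k$, that commutes with all branches of all the $H_j$. For every such $B$ there exist matrices $r_l(b)$, $l=1,\dots,d$, and choices of $\mathcal F$ (which may vary with $j$ and $b$) such that, for all $b\in(0,i\infty)$, $$R(b,k):=U(b,k)B(k)U(b,k)^{-1}=I+\sum_{l=1}^d\frac{r_l(b)}{k-\rho_l},$$ and $s_j,r_l$ satisfy the system (ODE2) $$\frac{dr_l(b)}{db}=\sum_{j=1}^p\frac{[s_j(b),r_l(b)]}{\rho_l-(k_j+b)},\quad l=1,\dots,d,$$ $$s_j(b)=\mathcal F\Big(-\frac{1}{2\pi i}\log F_j(k_j+b),\,R(b,k_j+b)\Big),\quad j=1,\dots,p,$$ where $R(b,k_j+b)$ is the value of the right-hand side of the formula for $R$. The first equation holds for all $b\in(0,i\infty)$; the second holds for all $b\in(0,i\infty)$ for which $R(b,k_j+b)$ has distinct eigenvalues, that is, for all but finitely many $b$. -/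

import Mathlib

open Complex Filter Topology Set

/-- The values of the parameter `b`: the open half-line `(0, i∞)`. -/
def halfLine : Set ℂ := {b | b.re = 0 ∧ 0 < b.im}

/-- The vertical open half-line `(a, a + i∞)`. -/
def openCut (a : ℂ) : Set ℂ := {w | (w - a).re = 0 ∧ 0 < (w - a).im}

/-- The vertical closed half-line `[a, a + i∞)`. -/
def closedCut (a : ℂ) : Set ℂ := {w | (w - a).re = 0 ∧ 0 ≤ (w - a).im}

/-- The half-strip `Ω + a`, where `Ω = {|Re w| < ε, Im w > 0}`. -/
def halfStrip (ε : ℝ) (a : ℂ) : Set ℂ := {w | |(w - a).re| < ε ∧ 0 < (w - a).im}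

/-- The plane cut along the truncated contours `Γ_j(b) = (k_j + b, k_j + i∞)`. -/
def cutPlane {p : ℕ} (k : Fin p → ℂ) (b : ℂ) : Set ℂ := {w | ∀ j, w ∉ closedCut (k j + b)}

/-- The logarithm on the plane cut along the upward imaginary half-axis
(the argument lies in `(-3π/2, π/2]`). -/
noncomputable def upLog (z : ℂ) : ℂ := Complex.log (I * z) - Complex.log I

/-- The power `z ^ e` on the plane cut along the upward imaginary half-axis. -/
noncomputable def upPow (z e : ℂ) : ℂ := Complex.exp (e * upLog z)

/-- An `N × N` complex matrix has `N` distinct eigenvalues. -/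
def HasDistinctEigenvalues {N : ℕ} (M : Matrix (Fin N) (Fin N) ℂ) : Prop :=
  M.charpoly.roots.Nodup

/-- Entrywise analyticity (holomorphy) of a matrix function on a set (used for open sets). -/
def MatAnalyticOn {N : ℕ} (f : ℂ → Matrix (Fin N) (Fin N) ℂ) (D : Set ℂ) : Prop :=
  ∀ m n, DifferentiableOn ℂ (fun w => f w m n) D

/-- `IsBranch D H c r f`: the function element `f` on the disc `ball c r` is obtained from the
matrix function `H`, given on `D`, by analytic continuation along a finite chain of discs. -/
inductive IsBranch {N : ℕ} (D : Set ℂ) (H : ℂ → Matrix (Fin N) (Fin N) ℂ) :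
    ℂ → ℝ → (ℂ → Matrix (Fin N) (Fin N) ℂ) → Prop
  | base (c : ℂ) (r : ℝ) (hr : 0 < r) (hD : Metric.ball c r ⊆ D) : IsBranch D H c r H
  | step (c : ℂ) (r : ℝ) (f : ℂ → Matrix (Fin N) (Fin N) ℂ)
      (c₁ : ℂ) (r₁ : ℝ) (g : ℂ → Matrix (Fin N) (Fin N) ℂ)
      (hf : IsBranch D H c r f) (hr : 0 < r₁) (hg : MatAnalyticOn g (Metric.ball c₁ r₁))
      (hne : (Metric.ball c r ∩ Metric.ball c₁ r₁).Nonempty)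
      (heq : EqOn f g (Metric.ball c r ∩ Metric.ball c₁ r₁)) : IsBranch D H c₁ r₁ g

/-- The standing assumptions on the points `k_j` and the coefficients `H_j` of the
Riemann-Hilbert problem. -/
structure IsCoefficientFamily {p N : ℕ} (ε : ℝ) (k : Fin p → ℂ)
    (H : Fin p → ℂ → Matrix (Fin N) (Fin N) ℂ) : Prop where
  eps_pos : 0 < ε
  /-- the points `k_j` lie in the upper half-plane -/
  im_pos : ∀ j, 0 < (k j).im
  /-- the points are distinct, and no cut passes through another of them -/
  not_mem_cut : ∀ i j, i ≠ j → k i ∉ closedCut (k j)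
  /-- `H_j` is regular in `Ω + k_j` -/
  analytic : ∀ j, MatAnalyticOn (H j) (halfStrip ε (k j))
  /-- `det H_j` has no zeros on the cut -/
  det_ne_zero : ∀ j, ∀ w ∈ openCut (k j), (H j w).det ≠ 0
  /-- the entries of `H_j` are algebraic functions -/
  algebraic : ∀ j m n, ∃ Q : Polynomial (Polynomial ℂ), Q ≠ 0 ∧
    ∀ w ∈ halfStrip ε (k j), Q.evalEval w (H j w m n) = 0
  /-- `H_j → I` as `Im w → ∞` -/
  tendsto_one : ∀ j, Tendsto (H j) (comap Complex.im atTop ⊓ 𝓟 (halfStrip ε (k j))) (𝓝 1)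
  /-- the eigenvalues of `H_j` are distinct almost everywhere -/
  distinct : ∀ j, ∀ᵐ w, w ∈ halfStrip ε (k j) → HasDistinctEigenvalues (H j w)
  /-- all branches of all the `H_j` over the same point commute -/
  branch_commute : ∀ i j c r f c₁ r₁ g, IsBranch (halfStrip ε (k i)) (H i) c r f →
    IsBranch (halfStrip ε (k j)) (H j) c₁ r₁ g →
    ∀ w ∈ Metric.ball c r ∩ Metric.ball c₁ r₁, Commute (f w) (g w)

/-- `logF j b` is the diagonal of `log F_j(k_j + b)`, where `F_j(k_j + b)` is a diagonal matrix
composed of the eigenvalues of `H_j(k_j + b)`; the logarithm is close to zero for large `Im b`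
and is chosen by continuity for the other `b`. -/
structure IsLogEigenvalues {p N : ℕ} (k : Fin p → ℂ)
    (H : Fin p → ℂ → Matrix (Fin N) (Fin N) ℂ) (logF : Fin p → ℂ → Fin N → ℂ) : Prop where
  continuousOn : ∀ j, ContinuousOn (logF j) halfLine
  tendsto_zero : ∀ j, Tendsto (logF j) (comap Complex.im atTop ⊓ 𝓟 halfLine) (𝓝 0)
  charpoly_eq : ∀ j, ∀ b ∈ halfLine, (H j (k j + b)).charpoly =
    ∏ m, (Polynomial.X - Polynomial.C (Complex.exp (logF j b m)))

/-- Near `a = k_j + b` the leading term of `V` is `K (w - a) ^ (E / (2πi)) P⁻¹`, where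
`E = diag(e)`, the matrix `K` is non-singular, and `P` is an analytic non-singular matrix of
eigenvectors of `h` whose eigenvalues at `a` are `exp(e)`. -/
def HasEndpointBehavior {N : ℕ} (h : ℂ → Matrix (Fin N) (Fin N) ℂ) (e : Fin N → ℂ) (a : ℂ)
    (D : Set ℂ) (V : ℂ → Matrix (Fin N) (Fin N) ℂ) : Prop :=
  ∃ (P : ℂ → Matrix (Fin N) (Fin N) ℂ) (f : ℂ → Fin N → ℂ) (K : Matrix (Fin N) (Fin N) ℂ),
    (∀ m n, AnalyticAt ℂ (fun w => P w m n) a) ∧ (P a).det ≠ 0 ∧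
    (∀ᶠ w in 𝓝 a, h w * P w = P w * Matrix.diagonal (f w)) ∧
    (∀ m, f a m = Complex.exp (e m)) ∧
    K.det ≠ 0 ∧
    Tendsto (fun w => V w * P w *
      Matrix.diagonal (fun m => upPow (w - a) (-(e m / (2 * Real.pi * I))))) (𝓝[D] a) (𝓝 K)

/-- `U(b, ·)`, `b ∈ (0, i∞)`, is a family of solutions of the Riemann-Hilbert problems
`U(b, w⁺) = U(b, w⁻) H_j(w)` on `Γ_j(b)`; `w⁺` and `w⁻` denote the right and the left shore. -/
structure IsRHFamily {p N : ℕ} (k : Fin p → ℂ)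
    (H : Fin p → ℂ → Matrix (Fin N) (Fin N) ℂ) (logF : Fin p → ℂ → Fin N → ℂ)
    (U : ℂ → ℂ → Matrix (Fin N) (Fin N) ℂ) : Prop where
  analytic : ∀ b ∈ halfLine, MatAnalyticOn (U b) (cutPlane k b)
  det_ne_zero : ∀ b ∈ halfLine, ∀ w ∈ cutPlane k b, (U b w).det ≠ 0
  /-- continuous non-singular values on both shores, related by `H_j` -/
  jump : ∀ b ∈ halfLine, ∀ j, ∀ w ∈ openCut (k j + b),
    ∃ V : Matrix (Fin N) (Fin N) ℂ, V.det ≠ 0 ∧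
      Tendsto (U b) (𝓝[{z | z.re < w.re}] w) (𝓝 V) ∧
      Tendsto (U b) (𝓝[{z | w.re < z.re}] w) (𝓝 (V * H j w))
  /-- `U(b, w) → I` as `|w| → ∞` -/
  tendsto_one : ∀ b ∈ halfLine,
    Tendsto (U b) (Bornology.cobounded ℂ ⊓ 𝓟 (cutPlane k b)) (𝓝 1)
  /-- behaviour at the ends of the cuts -/
  endpoint : ∀ b ∈ halfLine, ∀ j, HasDistinctEigenvalues (H j (k j + b)) →
    HasEndpointBehavior (H j) (logF j b) (k j + b) (cutPlane k b) (U b)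

/-- ODE1: `∂U/∂b (b, w) = (∑ j, s_j(b) / (w - (k_j + b))) U(b, w)`, the derivative being taken
along the half-line. -/
def ODE1 {p N : ℕ} (k : Fin p → ℂ) (s : Fin p → ℂ → Matrix (Fin N) (Fin N) ℂ)
    (U : ℂ → ℂ → Matrix (Fin N) (Fin N) ℂ) : Prop :=
  ∀ b ∈ halfLine, ∀ w ∈ cutPlane k b, ∀ m n,
    HasDerivWithinAt (fun x => U x w m n)
      (((∑ j, (w - (k j + b))⁻¹ • s j b) * U b w) m n) halfLine b

/-- The matrix `I + ∑ l, t_l / (w - ρ_l)`. -/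
noncomputable def simpleFractions {N d : ℕ} (ρ : Fin d → ℂ)
    (t : Fin d → Matrix (Fin N) (Fin N) ℂ) (w : ℂ) : Matrix (Fin N) (Fin N) ℂ :=
  1 + ∑ l, (w - ρ l)⁻¹ • t l

/-- `B(w) = I + ∑ l, t_l / (w - ρ_l)` is a rational matrix with simple poles, tending to `I` at
infinity, with no poles on the cuts, with distinct eigenvalues almost everywhere, which commutes
with all the `H_j` on all their sheets. -/
structure IsCommutingRational {p N d : ℕ} (ε : ℝ) (k : Fin p → ℂ)
    (H : Fin p → ℂ → Matrix (Fin N) (Fin N) ℂ) (ρ : Fin d → ℂ)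
    (t : Fin d → Matrix (Fin N) (Fin N) ℂ) : Prop where
  poles_injective : Function.Injective ρ
  poles_not_mem_cut : ∀ l j, ρ l ∉ openCut (k j)
  distinct : ∀ᵐ w, HasDistinctEigenvalues (simpleFractions ρ t w)
  commute : ∀ j c r f, IsBranch (halfStrip ε (k j)) (H j) c r f →
    ∀ w ∈ Metric.ball c r, (∀ l, w ≠ ρ l) → Commute (simpleFractions ρ t w) (f w)

/-- `𝓕` is a choice of the map `(X, Y) ↦ 𝓕(X, Y)` producing, for every `X` and every `Y` with
distinct eigenvalues, a matrix with the eigenvalues of `X` (counted with multiplicity) and the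
eigenvectors of `Y`. -/
def IsEigenDataMap {N : ℕ} (𝓕 : Matrix (Fin N) (Fin N) ℂ → Matrix (Fin N) (Fin N) ℂ →
    Matrix (Fin N) (Fin N) ℂ) : Prop :=
  ∀ X Y, HasDistinctEigenvalues Y → (𝓕 X Y).charpoly = X.charpoly ∧
    ∀ (v : Fin N → ℂ) (y : ℂ), Y.mulVec v = y • v → ∃ x : ℂ, (𝓕 X Y).mulVec v = x • v

/-- The diagonal matrix `-(1 / (2πi)) log F_j(k_j + b)`. -/
noncomputable def tildeF {N : ℕ} (e : Fin N → ℂ) : Matrix (Fin N) (Fin N) ℂ :=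
  Matrix.diagonal (fun m => -(1 / (2 * Real.pi * I)) * e m)

/-- The differential part of ODE2: `dr_l/db = ∑ j, [s_j, r_l] / (ρ_l - (k_j + b))`, the derivative
being taken along the half-line. -/
def ODE2Differential {p N d : ℕ} (k : Fin p → ℂ) (ρ : Fin d → ℂ)
    (s : Fin p → ℂ → Matrix (Fin N) (Fin N) ℂ) (r : Fin d → ℂ → Matrix (Fin N) (Fin N) ℂ) :
    Prop :=
  ∀ l, ∀ b ∈ halfLine, ∀ m n,
    HasDerivWithinAt (fun x => r l x m n)
      ((∑ j, (ρ l - (k j + b))⁻¹ • (s j b * r l b - r l b * s j b)) m n) halfLine b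

/-- The algebraic part of ODE2: `s_j(b) = 𝓕(-log F_j(k_j + b) / (2πi), R(b, k_j + b))` with
`R(b, w) = I + ∑ l, r_l(b) / (w - ρ_l)`, at all `b` where the second argument has distinct
eigenvalues (so that `𝓕` is defined); these are all `b` but finitely many. The choice of `𝓕`
(i.e. of the permutation matching eigenvalues and eigenvectors) is made for each `j` and `b`. -/
def ODE2Algebraic {p N d : ℕ} (k : Fin p → ℂ) (logF : Fin p → ℂ → Fin N → ℂ) (ρ : Fin d → ℂ)
    (s : Fin p → ℂ → Matrix (Fin N) (Fin N) ℂ) (r : Fin d → ℂ → Matrix (Fin N) (Fin N) ℂ)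
    (𝓕 : Fin p → ℂ → Matrix (Fin N) (Fin N) ℂ → Matrix (Fin N) (Fin N) ℂ →
      Matrix (Fin N) (Fin N) ℂ) : Prop :=
  ∀ j,
    {b ∈ halfLine | ¬ HasDistinctEigenvalues
      (simpleFractions ρ (fun l => r l b) (k j + b))}.Finite ∧
    ∀ b ∈ halfLine, HasDistinctEigenvalues (simpleFractions ρ (fun l => r l b) (k j + b)) →
      s j b = 𝓕 j b (tildeF (logF j b)) (simpleFractions ρ (fun l => r l b) (k j + b))

/-!
# Riemann-Hilbert problems with commuting algebraic coefficients

The rational matrix `B`. For one of the coefficients, `H = H_j`, let `V(w)` be the set of values at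
`w` of all branches of `H`; off finitely many points it is given locally by finitely many
holomorphic matrix functions. Fix a generic `w₁` and a polynomial `φ` in the entries of a matrix
which separates `H(w₁)` from the other elements of `V(w₁)`. The symmetric function
`∑ φ(M) M`, `M ∈ V(w)`, is single-valued and, multiplied by suitable polynomials, entire of
polynomial growth: it is a polynomial matrix (`exists_polynomial_matrix`). It commutes with all
branches of all the `H_j`, and has distinct eigenvalues at `w₁`, hence almost everywhere.
Divided by a polynomial of large degree with simple real roots, and with `I` added, it has the
required form by Lagrange interpolation (`IsCoefficientFamily.exists_commutingRational`).

The formula for `U B U⁻¹`. Since `B` commutes with `H_j`, the matrix `U B U⁻¹` has no jump on the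
cuts. At the ends of the cuts `B` is diagonal in the basis of eigenvectors of `H_j`, so that the
singular power cancels, and `U B U⁻¹` is bounded. Subtracting the principal parts at `ρ_l`, with
`r_l(b) = U(b, ρ_l) t_l U(b, ρ_l)⁻¹`, gives an entire function vanishing at infinity
(`IsRHFamily.conj_eq_of_distinct`). The behaviour at the ends is known only for those `b` for which
the `H_j(k_j + b)` have distinct eigenvalues; the other `b` are isolated, and continuity in `b`
applies (`IsRHFamily.conj_eq`).

The system. The equation for `r_l` is ODE1 at `w = ρ_l`. Differentiating `R = U B U⁻¹` at other
`w` gives `∂R/∂b = [∑ s_j / (w - k_j - b), R]`, whose left-hand side has no pole at `k_j + b`;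
hence `s_j(b)` commutes with `R(b, k_j + b)` (`ODE1.commute_residue`) and has the same
eigenvectors. To find its eigenvalues at a generic `b₀`, follow `U(b, w) P(w)` at `w = k_j + b₀ + x`,
`x > 0`, for `b = b₀ + iτ`, `0 ≤ τ ≤ δ`. The `i`-th column is an eigenvector of `R(b, w)`, and hence
proportional to a column of an adjugate matrix that is continuous up to `x = τ = 0`; this
turns ODE1 into a scalar equation `∂y/∂τ = i α y`, where `α ≈ σ / (x - iτ)` and `σ` is the `i`-th
eigenvalue of `s_j(b₀)`. Therefore `log y(δ, x) - log y(0, x) = σ log x + o(log x)` as `x → 0`. The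
left-hand side is `(e + o(1)) log x` with `e = -log F / (2πi)`, because `y(0, x) ~ x ^ (-e)` by the
endpoint behaviour while `y(δ, x)` has a non-zero limit; so `σ = e` (`residue_eq_exponent`,
`ODE1.residue_eq_conj_diagonal`). The remaining `b` are covered by continuity of the
characteristic polynomials (`ODE1.charpoly_residue`).
-/

/-! ### The discriminant of a matrix -/

/-- The discriminant of the characteristic polynomial of `M`, as the resultant of the
characteristic polynomial and its derivative. The degrees are fixed, so that it is compatible with
ring homomorphisms. -/
noncomputable def matDisc {N : ℕ} {R : Type*} [CommRing R] (M : Matrix (Fin N) (Fin N) R) : R :=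
  Polynomial.resultant M.charpoly (Polynomial.derivative M.charpoly) N (N - 1)

theorem matDisc_map {N : ℕ} {R S : Type*} [CommRing R] [CommRing S] (φ : R →+* S)
    (M : Matrix (Fin N) (Fin N) R) : matDisc (M.map φ) = φ (matDisc M) := by
  rw [matDisc, matDisc, Matrix.charpoly_map, Polynomial.derivative_map,
    Polynomial.resultant_map_map]

theorem hasDistinctEigenvalues_iff_matDisc_ne_zero {N : ℕ} (M : Matrix (Fin N) (Fin N) ℂ) :
    HasDistinctEigenvalues M ↔ matDisc M ≠ 0 := by
  have h1 : M.charpoly.natDegree = N := by simp [Matrix.charpoly_natDegree_eq_dim]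
  have h2 : (Polynomial.derivative M.charpoly).natDegree = N - 1 := by
    rw [Polynomial.natDegree_derivative, h1]
  have h := Polynomial.isUnit_resultant_iff_isCoprime (f := M.charpoly)
    (g := Polynomial.derivative M.charpoly) M.charpoly_monic
  rw [h1, h2] at h
  rw [HasDistinctEigenvalues, Polynomial.nodup_roots_iff_of_splits M.charpoly_monic.ne_zero
    (IsAlgClosed.splits _), Polynomial.separable_def, ← h, isUnit_iff_ne_zero, matDisc]

/-- The discriminant as a polynomial in the entries. -/
theorem matDisc_eq_eval {N : ℕ} {R : Type*} [CommRing R] (M : Matrix (Fin N) (Fin N) R) :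
    matDisc M = MvPolynomial.aeval (fun ij : Fin N × Fin N => M ij.1 ij.2)
      (matDisc (Matrix.of fun i j => (MvPolynomial.X (i, j) : MvPolynomial (Fin N × Fin N) ℤ))) := by
  have := matDisc_map (MvPolynomial.aeval (R := ℤ) (fun ij : Fin N × Fin N => M ij.1 ij.2)).toRingHom
    (Matrix.of fun i j => (MvPolynomial.X (i, j) : MvPolynomial (Fin N × Fin N) ℤ))
  rw [AlgHom.toRingHom_eq_coe, RingHom.coe_coe] at this
  rw [← this]
  congr 1
  ext i j
  simp

theorem continuous_matDisc {N : ℕ} :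
    Continuous (fun M : Matrix (Fin N) (Fin N) ℂ => matDisc M) := by
  rw [show (fun M : Matrix (Fin N) (Fin N) ℂ => matDisc M) = _ from
    funext fun M => matDisc_eq_eval M]
  simp_rw [MvPolynomial.aeval_def, MvPolynomial.eval₂_eq]
  fun_prop

theorem AnalyticAt.matDisc {N : ℕ} {f : ℂ → Matrix (Fin N) (Fin N) ℂ} {z : ℂ}
    (hf : ∀ i j, AnalyticAt ℂ (fun w => f w i j) z) : AnalyticAt ℂ (fun w => matDisc (f w)) z := by
  rw [show (fun w => _root_.matDisc (f w)) = _ from funext fun w => matDisc_eq_eval (f w)]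
  simp_rw [MvPolynomial.aeval_def, MvPolynomial.eval₂_eq]
  refine Finset.analyticAt_fun_sum _ fun n _ => ?_
  refine analyticAt_const.mul (Finset.analyticAt_fun_prod _ fun i _ => ?_)
  exact (hf _ _).pow _

/-! ### Entire functions -/

/-- A continuous function that is holomorphic off finitely many vertical lines is entire. -/
theorem differentiable_of_continuous_of_vertical_lines {f : ℂ → ℂ} (hf : Continuous f)
    {X : Set ℝ} (hX : X.Finite) (hd : ∀ z : ℂ, z.re ∉ X → DifferentiableAt ℂ f z) :
    Differentiable ℂ f := by
  intro z₀
  obtain ⟨r, hr, hball⟩ : ∃ r > 0, ∀ z ∈ Metric.ball z₀ r, z.re ≠ z₀.re → z.re ∉ X := by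
    have h1 : (X \ {z₀.re})ᶜ ∈ 𝓝 z₀.re :=
      (hX.subset sdiff_subset).isClosed.isOpen_compl.mem_nhds (by simp)
    have h2 := continuous_re.continuousAt (x := z₀) h1
    obtain ⟨r, hr, h3⟩ := Metric.mem_nhds_iff.1 h2
    exact ⟨r, hr, fun z hz hne hzX => h3 hz ⟨hzX, hne⟩⟩
  have key : DifferentiableOn ℂ f (Metric.ball z₀ r) := by
    rw [← Complex.isConservativeOn_and_continuousOn_iff_isDifferentiableOn Metric.isOpen_ball]
    refine ⟨fun z w hzw => ?_, hf.continuousOn⟩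
    -- integrals over rectangles whose interior misses the line vanish
    have sub : ∀ a b : ℝ, (z₀.re ∉ Ioo (min a b) (max a b)) → a ∈ uIcc z.re w.re →
        b ∈ uIcc z.re w.re →
        (∫ x : ℝ in a..b, f (x + z.im * I)) - (∫ x : ℝ in a..b, f (x + w.im * I)) +
      I • (∫ y : ℝ in z.im..w.im, f (b + y * I)) -
      I • (∫ y : ℝ in z.im..w.im, f (a + y * I)) = 0 := by
      intro a b hab ha hb
      have := Complex.integral_boundary_rect_eq_zero_of_continuousOn_of_differentiableOn f
        ⟨a, z.im⟩ ⟨b, w.im⟩ hf.continuousOn (fun x hx => (hd x ?_).differentiableWithinAt)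
      · simpa using this
      · simp only [mem_reProdIm] at hx
        refine hball x (hzw ?_) (fun h => hab (h ▸ hx.1))
        rw [Rectangle, mem_reProdIm]
        exact ⟨uIcc_subset_uIcc ha hb (Ioo_subset_Icc_self hx.1), Ioo_subset_Icc_self hx.2⟩
    have main : (∫ x : ℝ in z.re..w.re, f (x + z.im * I)) -
        (∫ x : ℝ in z.re..w.re, f (x + w.im * I)) +
        I • (∫ y : ℝ in z.im..w.im, f (w.re + y * I)) -
        I • (∫ y : ℝ in z.im..w.im, f (z.re + y * I)) = 0 := by
      by_cases h : z₀.re ∈ Ioo (min z.re w.re) (max z.re w.re)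
      · have hm : z₀.re ∈ uIcc z.re w.re := Ioo_subset_Icc_self h
        have e1 := sub z.re z₀.re (by
          rintro ⟨h1, h2⟩
          rcases le_total z.re z₀.re with h' | h' <;> simp [h'] at h1 h2) left_mem_uIcc hm
        have e2 := sub z₀.re w.re (by
          rintro ⟨h1, h2⟩
          rcases le_total z₀.re w.re with h' | h' <;> simp [h'] at h1 h2) hm right_mem_uIcc
        have ii : ∀ (c : ℝ) (a b : ℝ), IntervalIntegrable (fun x : ℝ => f (x + c * I))
            MeasureTheory.volume a b :=
          fun c a b => (by fun_prop : Continuous fun x : ℝ => f (x + c * I)).intervalIntegrable a b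
        have e3 := intervalIntegral.integral_add_adjacent_intervals
          (ii z.im z.re z₀.re) (ii z.im z₀.re w.re)
        have e4 := intervalIntegral.integral_add_adjacent_intervals
          (ii w.im z.re z₀.re) (ii w.im z₀.re w.re)
        rw [← e3, ← e4, ← add_zero (0 : ℂ)]
        nth_rw 1 [← e1]
        nth_rw 1 [← e2]
        simp only [smul_eq_mul]
        ring
      · exact sub _ _ h left_mem_uIcc right_mem_uIcc
    rw [← Complex.wedgeIntegral_add_wedgeIntegral_eq] at main
    exact eq_neg_of_add_eq_zero_left main
  exact key.differentiableAt (Metric.ball_mem_nhds z₀ hr)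

/-- An entire function of polynomial growth is a polynomial. -/
theorem exists_polynomial_of_growth (n : ℕ) : ∀ {f : ℂ → ℂ} (_ : Differentiable ℂ f) {C : ℝ}
    (_ : ∀ z, ‖f z‖ ≤ C * (1 + ‖z‖) ^ n), ∃ P : Polynomial ℂ, ∀ z, f z = P.eval z := by
  induction n with
  | zero =>
    intro f hf C hC
    have hb : Bornology.IsBounded (range f) := by
      rw [isBounded_iff_forall_norm_le]
      refine ⟨C, ?_⟩
      rintro _ ⟨z, rfl⟩
      simpa using hC z
    obtain ⟨c, hc⟩ := hf.exists_const_forall_eq_of_bounded hb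
    exact ⟨Polynomial.C c, fun z => by simp [hc]⟩
  | succ n ih =>
    intro f hf C hC
    have hC0 : 0 ≤ C := by
      have := (norm_nonneg _).trans (hC 0)
      simpa using this
    set g := dslope f 0 with hg
    have hgd : Differentiable ℂ g := by
      rw [← differentiableOn_univ] at hf ⊢
      exact (Complex.differentiableOn_dslope univ_mem).2 hf
    obtain ⟨D, hD⟩ := (isCompact_closedBall (0 : ℂ) 1).exists_bound_of_continuousOn
      hgd.continuous.continuousOn
    obtain ⟨P, hP⟩ := ih hgd (C := max D (4 * C)) (fun z => by
      have h1 : 1 ≤ (1 + ‖z‖) ^ n := one_le_pow₀ (by linarith [norm_nonneg z])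
      by_cases hz : ‖z‖ ≤ 1
      · have := hD z (by simpa using hz)
        calc ‖g z‖ ≤ D := this
          _ ≤ max D (4 * C) * 1 := by simp
          _ ≤ _ := mul_le_mul_of_nonneg_left h1 (le_max_of_le_right (by linarith))
      · push Not at hz
        have hz0 : z ≠ 0 := by rintro rfl; norm_num at hz
        have e : g z = (f z - f 0) / z := by
          rw [hg, dslope_of_ne _ hz0, slope_def_field, sub_zero]
        have h0 : ‖f 0‖ ≤ C := by simpa using hC 0
        have hfz := hC z
        rw [e, norm_div, div_le_iff₀ (by linarith)]
        calc ‖f z - f 0‖ ≤ ‖f z‖ + ‖f 0‖ := norm_sub_le _ _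
          _ ≤ C * (1 + ‖z‖) ^ (n + 1) + C := add_le_add hfz h0
          _ ≤ 4 * C * (1 + ‖z‖) ^ n * ‖z‖ := by
            rw [pow_succ]
            have h3 : C * 1 ≤ C * (1 + ‖z‖) ^ n := mul_le_mul_of_nonneg_left h1 hC0
            have h4 : 0 ≤ C * (1 + ‖z‖) ^ n := by positivity
            nlinarith
          _ ≤ _ := by gcongr; exact le_max_right _ _)
    refine ⟨Polynomial.X * P + Polynomial.C (f 0), fun z => ?_⟩
    have := sub_smul_dslope f 0 z
    rw [sub_zero, smul_eq_mul, ← hg, hP] at this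
    simp [this]

/-- An entire function vanishing at the points of a finite set `F` and negligible with respect to
`∏ c ∈ F, (z - c)` at infinity is zero. -/
theorem entire_eq_zero_of_vanish (F : Finset ℂ) : ∀ {f : ℂ → ℂ} (_ : Differentiable ℂ f)
    (_ : ∀ c ∈ F, f c = 0)
    (_ : Tendsto (fun z => f z / ∏ c ∈ F, (z - c)) (Bornology.cobounded ℂ) (𝓝 0)), f = 0 := by
  induction F using Finset.induction_on with
  | empty =>
    intro f hf _ h
    simp only [Finset.prod_empty, div_one] at h
    funext z
    exact hf.apply_eq_of_tendsto_cocompact z (by rwa [← Metric.cobounded_eq_cocompact])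
  | insert a F ha ih =>
    intro f hf hF h
    have hfa : f a = 0 := hF a (Finset.mem_insert_self _ _)
    have hgd : Differentiable ℂ (dslope f a) := by
      rw [← differentiableOn_univ] at hf ⊢
      exact (Complex.differentiableOn_dslope univ_mem).2 hf
    have e : ∀ z ≠ a, dslope f a z = f z / (z - a) := fun z hz => by
      rw [dslope_of_ne _ hz, slope_def_field, hfa, sub_zero]
    have hz : dslope f a = 0 := by
      refine ih hgd (fun c hc => ?_) (h.congr' ?_)
      · rw [e c (by rintro rfl; exact ha hc), hF c (Finset.mem_insert_of_mem hc), zero_div]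
      · have : ∀ᶠ z in Bornology.cobounded ℂ, z ≠ a :=
          Bornology.isBounded_def.1 (Bornology.isBounded_singleton (x := a))
        filter_upwards [this] with z hz
        rw [Finset.prod_insert ha, e z hz, div_div]
    funext z
    have := sub_smul_dslope f a z
    rw [hz, hfa] at this
    simpa using this.symm

/-! ### Matrices with distinct eigenvalues -/

theorem charpoly_conj_diagonal {N : ℕ} {P : Matrix (Fin N) (Fin N) ℂ} (hP : P.det ≠ 0)
    (d : Fin N → ℂ) : (P * Matrix.diagonal d * P⁻¹).charpoly =
      ∏ i, (Polynomial.X - Polynomial.C (d i)) := by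
  have hu : IsUnit P := (Matrix.isUnit_iff_isUnit_det P).2 hP.isUnit
  have := Matrix.charpoly_units_conj hu.unit (Matrix.diagonal d)
  rw [← Matrix.charpoly_diagonal, ← this]
  simp

theorem roots_prod_X_sub_C_family {N : ℕ} (d : Fin N → ℂ) :
    (∏ i, (Polynomial.X - Polynomial.C (d i))).roots = Finset.univ.val.map d := by
  rw [← Polynomial.roots_multiset_prod_X_sub_C (Finset.univ.val.map d)]
  rw [Multiset.map_map]
  rfl

theorem nodup_roots_prod_iff {N : ℕ} (d : Fin N → ℂ) :
    (∏ i, (Polynomial.X - Polynomial.C (d i))).roots.Nodup ↔ Function.Injective d := by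
  rw [roots_prod_X_sub_C_family]
  constructor
  · intro h i j hij
    exact Multiset.inj_on_of_nodup_map h i (Finset.mem_univ_val i) j (Finset.mem_univ_val j) hij
  · exact fun h => Multiset.Nodup.map h Finset.univ.nodup

theorem HasDistinctEigenvalues.exists_diagonalization {N : ℕ} {M : Matrix (Fin N) (Fin N) ℂ}
    (hM : HasDistinctEigenvalues M) : ∃ (P : Matrix (Fin N) (Fin N) ℂ) (d : Fin N → ℂ),
      P.det ≠ 0 ∧ Function.Injective d ∧ M = P * Matrix.diagonal d * P⁻¹ := by
  have hcard : M.charpoly.roots.card = N := by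
    rw [Polynomial.splits_iff_card_roots.1 (IsAlgClosed.splits M.charpoly),
      Matrix.charpoly_natDegree_eq_dim, Fintype.card_fin]
  set l := M.charpoly.roots.toList with hl
  have hlen : l.length = N := by rw [hl, Multiset.length_toList, hcard]
  have hnd : l.Nodup := by
    rw [← Multiset.coe_nodup, hl, Multiset.coe_toList]; exact hM
  set d : Fin N → ℂ := fun i => l.get (i.cast hlen.symm) with hd
  have hdinj : Function.Injective d := fun i j hij => by
    have := (List.nodup_iff_injective_get.1 hnd) hij
    simpa [Fin.ext_iff] using this
  have hroot : ∀ i, ∃ v : Fin N → ℂ, v ≠ 0 ∧ M.mulVec v = d i • v := by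
    intro i
    have hmem : d i ∈ M.charpoly.roots := by
      rw [← Multiset.mem_toList]
      exact List.get_mem _ _
    have hr : M.charpoly.IsRoot (d i) := Polynomial.isRoot_of_mem_roots hmem
    have hdet : (Matrix.scalar (Fin N) (d i) - M).det = 0 := by
      rw [← Matrix.eval_charpoly]; exact hr
    obtain ⟨v, hv, h⟩ := Matrix.exists_mulVec_eq_zero_iff.2 hdet
    refine ⟨v, hv, ?_⟩
    rw [Matrix.sub_mulVec, sub_eq_zero] at h
    rw [← h]
    simp [Matrix.scalar_apply, ← Matrix.smul_one_eq_diagonal, Matrix.smul_mulVec]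
  choose v hv0 hv using hroot
  have hlin : LinearIndependent ℂ v :=
    Module.End.eigenvectors_linearIndependent' (Matrix.toLin' M) d hdinj v fun i => by
      rw [Module.End.hasEigenvector_iff]
      exact ⟨by rw [Module.End.mem_eigenspace_iff, Matrix.toLin'_apply, hv], hv0 i⟩
  set P : Matrix (Fin N) (Fin N) ℂ := Matrix.of fun i j => v j i with hPdef
  have hPu : IsUnit P := Matrix.linearIndependent_cols_iff_isUnit.1 hlin
  have hPdet : P.det ≠ 0 := ((Matrix.isUnit_iff_isUnit_det P).1 hPu).ne_zero
  refine ⟨P, d, hPdet, hdinj, ?_⟩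
  have hMP : M * P = P * Matrix.diagonal d := by
    ext i j
    rw [Matrix.mul_diagonal]
    have := congrFun (hv j) i
    rw [Pi.smul_apply, smul_eq_mul] at this
    rw [mul_comm]
    exact this
  rw [← hMP, Matrix.mul_assoc, Matrix.mul_nonsing_inv _ hPdet.isUnit, Matrix.mul_one]

theorem hasDistinctEigenvalues_conj_diagonal {N : ℕ} {P : Matrix (Fin N) (Fin N) ℂ}
    (hP : P.det ≠ 0) {d : Fin N → ℂ} :
    HasDistinctEigenvalues (P * Matrix.diagonal d * P⁻¹) ↔ Function.Injective d := by
  rw [HasDistinctEigenvalues, charpoly_conj_diagonal hP, nodup_roots_prod_iff]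

theorem hasDistinctEigenvalues_diagonal {N : ℕ} {d : Fin N → ℂ} :
    HasDistinctEigenvalues (Matrix.diagonal d) ↔ Function.Injective d := by
  rw [HasDistinctEigenvalues, Matrix.charpoly_diagonal, nodup_roots_prod_iff]

theorem HasDistinctEigenvalues.one_add_smul {N : ℕ} {M : Matrix (Fin N) (Fin N) ℂ}
    (hM : HasDistinctEigenvalues M) {c : ℂ} (hc : c ≠ 0) (a : ℂ) :
    HasDistinctEigenvalues (a • (1 : Matrix (Fin N) (Fin N) ℂ) + c • M) := by
  obtain ⟨P, d, hP, hd, rfl⟩ := hM.exists_diagonalization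
  have : a • (1 : Matrix (Fin N) (Fin N) ℂ) + c • (P * Matrix.diagonal d * P⁻¹) =
      P * Matrix.diagonal (fun i => a + c * d i) * P⁻¹ := by
    have e : Matrix.diagonal (fun i => a + c * d i) =
        a • (1 : Matrix (Fin N) (Fin N) ℂ) + c • Matrix.diagonal d := by
      ext i j
      by_cases h : i = j <;> simp [h]
    rw [e, Matrix.mul_add, Matrix.add_mul, Matrix.mul_smul, Matrix.mul_smul, Matrix.smul_mul,
      Matrix.smul_mul, Matrix.mul_one, Matrix.mul_nonsing_inv _ hP.isUnit]
  rw [this, hasDistinctEigenvalues_conj_diagonal hP]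
  intro i j hij
  exact hd (mul_left_cancel₀ hc (add_left_cancel hij))

/-- A matrix commuting with a diagonal matrix with distinct entries is diagonal. -/
theorem eq_diagonal_of_commute {N : ℕ} {d : Fin N → ℂ} (hd : Function.Injective d)
    {M : Matrix (Fin N) (Fin N) ℂ} (h : M * Matrix.diagonal d = Matrix.diagonal d * M) :
    M = Matrix.diagonal fun i => M i i := by
  ext i j
  by_cases hij : i = j
  · subst hij; simp
  · rw [Matrix.diagonal_apply_ne _ hij]
    have := congrFun (congrFun h i) j
    rw [Matrix.mul_diagonal, Matrix.diagonal_mul] at this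
    have h2 : M i j * (d j - d i) = 0 := by linear_combination this
    exact (mul_eq_zero.1 h2).resolve_right (sub_ne_zero.2 fun e => hij (hd e).symm)

/-! ### Algebraic functions -/

/-- Clearing denominators. -/
theorem exists_map_eq_C_mul (p : Polynomial (FractionRing (Polynomial ℂ))) :
    ∃ (d : Polynomial ℂ) (P : Polynomial (Polynomial ℂ)), d ≠ 0 ∧
      P.map (algebraMap _ _) = Polynomial.C (algebraMap _ _ d) * p := by
  obtain ⟨d, hd, h⟩ := IsLocalization.integerNormalization_spec (nonZeroDivisors (Polynomial ℂ)) p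
  refine ⟨d, _, nonZeroDivisors.ne_zero hd, h.trans ?_⟩
  ext n
  simp [Algebra.smul_def]

/-- The squarefree part `q` of a bivariate polynomial `Q`: it has the same zeros, and off the
zeros of some `D` its leading coefficient does not vanish and its zeros are simple. -/
theorem exists_squarefree_part {Q : Polynomial (Polynomial ℂ)} (hQ : Q ≠ 0) :
    ∃ (q : Polynomial (Polynomial ℂ)) (D : Polynomial ℂ), D ≠ 0 ∧ ∀ w, D.eval w ≠ 0 →
      q.leadingCoeff.eval w ≠ 0 ∧ (∀ y, Q.evalEval w y = 0 → q.evalEval w y = 0) ∧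
      ∀ y, q.evalEval w y = 0 → (Polynomial.derivative q).evalEval w y ≠ 0 := by
  classical
  set K := FractionRing (Polynomial ℂ)
  have : CharZero K := algebraRat.charZero K
  set ι : Polynomial ℂ →+* K := algebraMap (Polynomial ℂ) K with hι
  have hinj : Function.Injective ι := IsFractionRing.injective (Polynomial ℂ) K
  have hinj' := Polynomial.map_injective ι hinj
  have hQ' : Q.map ι ≠ 0 := (Polynomial.map_ne_zero_iff hinj).2 hQ
  set p := UniqueFactorizationMonoid.radical (Q.map ι) with hp
  obtain ⟨d, q, hd, hq⟩ := exists_map_eq_C_mul p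
  change q.map ι = Polynomial.C (ι d) * p at hq
  have hιd : ι d ≠ 0 := fun h => hd (hinj (by simpa using h))
  have hu : IsUnit (Polynomial.C (ι d)) := Polynomial.isUnit_C.2 hιd.isUnit
  have hass : Associated p (q.map ι) := by
    rw [hq]; exact (associated_unit_mul_left p _ hu).symm
  have hsep : (q.map ι).Separable := by
    rw [PerfectField.separable_iff_squarefree]
    exact (hass.squarefree_iff).1 UniqueFactorizationMonoid.squarefree_radical
  obtain ⟨n, hn⟩ := UniqueFactorizationMonoid.exists_dvd_radical_self_pow hQ'
  obtain ⟨A, hA⟩ : Q.map ι ∣ (q.map ι) ^ n := hn.trans (pow_dvd_pow_of_dvd hass.dvd n)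
  obtain ⟨e, A', he, hA'⟩ := exists_map_eq_C_mul A
  change A'.map ι = Polynomial.C (ι e) * A at hA'
  have h1 : Polynomial.C e * q ^ n = Q * A' := hinj' (by
    simp only [Polynomial.map_mul, Polynomial.map_pow, Polynomial.map_C, hA', hA]
    ring)
  obtain ⟨u, v, huv⟩ := hsep
  obtain ⟨e₁, u', he₁, hu'⟩ := exists_map_eq_C_mul u
  obtain ⟨e₂, v', he₂, hv'⟩ := exists_map_eq_C_mul v
  change u'.map ι = Polynomial.C (ι e₁) * u at hu'
  change v'.map ι = Polynomial.C (ι e₂) * v at hv'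
  have h2 : Polynomial.C e₂ * u' * q + Polynomial.C e₁ * v' * Polynomial.derivative q
      = Polynomial.C (e₁ * e₂) := hinj' (by
    simp only [Polynomial.map_mul, Polynomial.map_add, Polynomial.map_C, hu', hv',
      ← Polynomial.derivative_map]
    rw [Polynomial.derivative_map] at huv ⊢
    simp only [map_mul]
    linear_combination (Polynomial.C (ι e₁) * Polynomial.C (ι e₂)) * huv)
  have hq0 : q ≠ 0 := by
    rintro rfl
    rw [Polynomial.map_zero] at hass
    exact UniqueFactorizationMonoid.radical_ne_zero (hass.eq_zero_iff.2 rfl)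
  refine ⟨q, e * (e₁ * e₂) * q.leadingCoeff,
    mul_ne_zero (mul_ne_zero he (mul_ne_zero he₁ he₂)) (Polynomial.leadingCoeff_ne_zero.2 hq0),
    fun w hw => ?_⟩
  simp only [Polynomial.eval_mul, mul_ne_zero_iff] at hw
  refine ⟨hw.2, fun y hy => ?_, fun y hy hy' => ?_⟩
  · have := congrArg (Polynomial.evalEval w y) h1
    simp only [Polynomial.evalEval_mul, Polynomial.evalEval_pow, Polynomial.evalEval_C, hy,
      zero_mul] at this
    exact eq_zero_of_pow_eq_zero ((mul_eq_zero.1 this).resolve_left hw.1.1)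
  · have := congrArg (Polynomial.evalEval w y) h2
    simp only [Polynomial.evalEval_mul, Polynomial.evalEval_add, Polynomial.evalEval_C, hy, hy',
      mul_zero, add_zero, Polynomial.eval_mul] at this
    exact mul_ne_zero hw.1.2.1 hw.1.2.2 this.symm

theorem contDiff_evalEval (q : Polynomial (Polynomial ℂ)) :
    ContDiff ℂ ⊤ fun u : ℂ × ℂ => q.evalEval u.1 u.2 := by
  have hFsum : (fun u : ℂ × ℂ => q.evalEval u.1 u.2) =
      fun u => ∑ i ∈ Finset.range (q.natDegree + 1), Polynomial.aeval u.1 (q.coeff i) * u.2 ^ i := by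
    funext u
    rw [← Polynomial.map_evalRingHom_eval, Polynomial.eval_eq_sum_range' (n := q.natDegree + 1)
      (Nat.lt_succ_of_le Polynomial.natDegree_map_le)]
    simp [Polynomial.aeval_def]
  rw [hFsum]
  refine ContDiff.sum fun i _ => ContDiff.mul ?_ (contDiff_snd.pow i)
  exact (Polynomial.contDiff_aeval _ _).comp contDiff_fst

/-- Near a point where the zeros of `q(w, ·)` are simple, they are given by finitely many
holomorphic functions with distinct values. -/
theorem exists_local_roots {q : Polynomial (Polynomial ℂ)} {w₀ : ℂ}
    (hlead : q.leadingCoeff.eval w₀ ≠ 0)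
    (hsimple : ∀ y, q.evalEval w₀ y = 0 → (Polynomial.derivative q).evalEval w₀ y ≠ 0) :
    ∃ (κ : Type) (_ : Fintype κ) (y : κ → ℂ → ℂ) (r : ℝ), 0 < r ∧
      Fintype.card κ = q.natDegree ∧
      (∀ i, DifferentiableOn ℂ (y i) (Metric.ball w₀ r)) ∧
      (∀ w ∈ Metric.ball w₀ r, Function.Injective fun i => y i w) ∧
      ∀ w ∈ Metric.ball w₀ r, ∀ c, q.evalEval w c = 0 ↔ ∃ i, y i w = c := by
  classical
  have hmap : ∀ w y, q.evalEval w y = (q.map (Polynomial.evalRingHom w)).eval y := fun w y =>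
    (Polynomial.map_evalRingHom_eval w y q).symm
  have hdeg : ∀ w, q.leadingCoeff.eval w ≠ 0 →
      (q.map (Polynomial.evalRingHom w)).natDegree = q.natDegree := fun w hw =>
    Polynomial.natDegree_map_of_leadingCoeff_ne_zero _ (by simpa using hw)
  have hne : ∀ w, q.leadingCoeff.eval w ≠ 0 → q.map (Polynomial.evalRingHom w) ≠ 0 :=
    fun w hw h => by
      have := congrArg (fun p => Polynomial.coeff p q.natDegree) h
      exact hw (by simpa using this)
  have hroots : ∀ w, q.leadingCoeff.eval w ≠ 0 → ∀ y,
      y ∈ (q.map (Polynomial.evalRingHom w)).roots.toFinset ↔ q.evalEval w y = 0 :=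
    fun w hw y => by
      rw [Multiset.mem_toFinset, Polynomial.mem_roots (hne w hw), hmap]; rfl
  -- all the roots at the base point are simple, so their number is the degree
  set S₀ := (q.map (Polynomial.evalRingHom w₀)).roots.toFinset with hS₀
  have hcard : S₀.card = q.natDegree := by
    rw [hS₀, Multiset.toFinset_card_of_nodup, ← hdeg w₀ hlead]
    · exact (Polynomial.splits_iff_card_roots.1 (IsAlgClosed.splits _))
    · rw [Multiset.nodup_iff_count_le_one]
      intro y
      rw [Polynomial.count_roots]
      by_contra! hlt
      obtain ⟨h1, h2⟩ := (Polynomial.one_lt_rootMultiplicity_iff_isRoot (hne w₀ hlead)).1 hlt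
      refine hsimple y ((hmap _ _).trans h1) ?_
      rw [← Polynomial.map_evalRingHom_eval, ← Polynomial.derivative_map]
      exact h2
  have hfin : Finite {y : ℂ // q.evalEval w₀ y = 0} :=
    Finite.of_injective (fun i : {y : ℂ // q.evalEval w₀ y = 0} =>
      (⟨i.1, (hroots w₀ hlead _).2 i.2⟩ : S₀)) (fun i j h => by
        simpa [Subtype.ext_iff] using h)
  have := Fintype.ofFinite {y : ℂ // q.evalEval w₀ y = 0}
  have hcard' : Fintype.card {y : ℂ // q.evalEval w₀ y = 0} = q.natDegree := by
    rw [← hcard]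
    exact Fintype.card_of_subtype _ (hroots w₀ hlead)
  -- the implicit functions
  set F : ℂ × ℂ → ℂ := fun u => q.evalEval u.1 u.2 with hF
  have hFC : ContDiff ℂ ⊤ F := contDiff_evalEval q
  have hd : ∀ w y, HasDerivAt (fun y => F (w, y)) ((Polynomial.derivative q).evalEval w y) y := by
    intro w y
    have := (q.map (Polynomial.evalRingHom w)).hasDerivAt y
    rw [Polynomial.derivative_map, Polynomial.map_evalRingHom_eval] at this
    simpa only [hF, hmap] using this
  have key : ∀ i : {y : ℂ // q.evalEval w₀ y = 0}, ∃ ψ : ℂ → ℂ, ψ w₀ = i.1 ∧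
      (∀ᶠ w in 𝓝 w₀, q.evalEval w (ψ w) = 0) ∧ AnalyticAt ℂ ψ w₀ := by
    intro i
    have cdf : ContDiffAt ℂ ⊤ F (w₀, i.1) := hFC.contDiffAt
    have if₂ : (fderiv ℂ F (w₀, i.1) ∘L .inr ℂ ℂ ℂ).IsInvertible := by
      have h1 : HasFDerivAt (fun y => F (w₀, y)) (fderiv ℂ F (w₀, i.1) ∘L .inr ℂ ℂ ℂ) i.1 :=
        (cdf.differentiableAt (by simp)).hasFDerivAt.comp i.1 (hasFDerivAt_prodMk_right w₀ i.1)
      rw [h1.unique (hd w₀ i.1).hasFDerivAt]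
      exact ⟨ContinuousLinearEquiv.unitsEquivAut ℂ (Units.mk0 _ (hsimple _ i.2)), by
        ext; simp⟩
    refine ⟨cdf.implicitFunction (by simp) if₂, cdf.implicitFunction_apply_self _ if₂, ?_, ?_⟩
    · have := cdf.eventually_apply_implicitFunction (by simp) if₂
      simpa only [hF, i.2] using this
    · exact (cdf.contDiffAt_implicitFunction (by simp) if₂).analyticAt
  choose y hy0 hyr hya using key
  have ev : ∀ᶠ w in 𝓝 w₀, q.leadingCoeff.eval w ≠ 0 ∧ (∀ i, q.evalEval w (y i w) = 0) ∧
      (∀ i, AnalyticAt ℂ (y i) w) ∧ ∀ i j, i ≠ j → y i w ≠ y j w := by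
    refine (Polynomial.continuous _).continuousAt.eventually_ne hlead |>.and
      ((eventually_all.2 hyr).and ((eventually_all.2 fun i => (hya i).eventually_analyticAt).and
      (eventually_all.2 fun i => eventually_all.2 fun j => ?_)))
    by_cases hij : i = j
    · simp [hij]
    · have : ∀ᶠ w in 𝓝 w₀, y i w - y j w ≠ 0 :=
        ((hya i).continuousAt.sub (hya j).continuousAt).eventually_ne (by
          rw [Pi.sub_apply, hy0, hy0, sub_ne_zero]; exact fun h => hij (Subtype.ext h))
      filter_upwards [this] with w hw _ using sub_ne_zero.1 hw
  obtain ⟨r, hr, hball⟩ := Metric.eventually_nhds_iff_ball.1 ev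
  refine ⟨_, this, y, r, hr, hcard',
    fun i w hw => ((hball w hw).2.2.1 i).differentiableAt.differentiableWithinAt,
    fun w hw i j hij => ?_, fun w hw c => ⟨fun hc => ?_, ?_⟩⟩
  · by_contra hne
    exact (hball w hw).2.2.2 i j hne hij
  · obtain ⟨hl, hz, -, hdis⟩ := hball w hw
    have hinj : Function.Injective fun i => y i w := fun i j hij => by
      by_contra hne
      exact hdis i j hne hij
    have himg : Finset.univ.image (fun i => y i w) =
        (q.map (Polynomial.evalRingHom w)).roots.toFinset := by
      refine Finset.eq_of_subset_of_card_le ?_ ?_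
      · intro z hz'
        obtain ⟨i, -, rfl⟩ := Finset.mem_image.1 hz'
        exact (hroots w hl _).2 (hz i)
      · rw [Finset.card_image_of_injective _ hinj, Finset.card_univ, hcard', ← hdeg w hl]
        exact (Multiset.toFinset_card_le _).trans (Polynomial.card_roots' _)
    have := (hroots w hl c).2 hc
    rw [← himg] at this
    obtain ⟨i, -, hi⟩ := Finset.mem_image.1 this
    exact ⟨i, hi⟩
  · rintro ⟨i, rfl⟩
    exact (hball w hw).2.1 i

/-! ### Branches of an algebraic matrix function -/

theorem IsBranch.matAnalyticOn {N : ℕ} {D : Set ℂ} {H : ℂ → Matrix (Fin N) (Fin N) ℂ}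
    (hH : MatAnalyticOn H D) {c : ℂ} {r : ℝ} {f : ℂ → Matrix (Fin N) (Fin N) ℂ}
    (hf : IsBranch D H c r f) : MatAnalyticOn f (Metric.ball c r) := by
  cases hf with
  | base _ _ hr hD => exact fun m n => (hH m n).mono hD
  | step c r f c₁ r₁ g hf hr hg hne heq => exact hg

/-- The values at `w` of all branches of `H`. -/
def branchValues {N : ℕ} (D : Set ℂ) (H : ℂ → Matrix (Fin N) (Fin N) ℂ) (w : ℂ) :
    Set (Matrix (Fin N) (Fin N) ℂ) :=
  {M | ∃ c r f, IsBranch D H c r f ∧ w ∈ Metric.ball c r ∧ f w = M}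

/-- An algebraic equation is preserved by analytic continuation. -/
theorem IsBranch.evalEval_eq_zero {N : ℕ} {D : Set ℂ} {H : ℂ → Matrix (Fin N) (Fin N) ℂ}
    {Q : Polynomial (Polynomial ℂ)}
    (hQ : ∀ w ∈ D, ∀ m n, Q.evalEval w (H w m n) = 0) {c : ℂ} {r : ℝ}
    {f : ℂ → Matrix (Fin N) (Fin N) ℂ} (hf : IsBranch D H c r f) :
    ∀ w ∈ Metric.ball c r, ∀ m n, Q.evalEval w (f w m n) = 0 := by
  induction hf with
  | base c r hr hD => exact fun w hw => hQ w (hD hw)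
  | step c r f c₁ r₁ g hf hr hg hne heq ih =>
    intro w hw m n
    have han : AnalyticOnNhd ℂ (fun w => Q.evalEval w (g w m n)) (Metric.ball c₁ r₁) := by
      refine DifferentiableOn.analyticOnNhd ?_ Metric.isOpen_ball
      exact ((contDiff_evalEval Q).differentiable (by simp)).comp_differentiableOn
        (differentiableOn_id.prodMk (hg m n))
    obtain ⟨z, hz⟩ := hne
    refine han.eqOn_zero_of_preconnected_of_eventuallyEq_zero
      (convex_ball _ _).isPreconnected hz.2 ?_ hw
    filter_upwards [(Metric.isOpen_ball.inter Metric.isOpen_ball).mem_nhds hz] with x hx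
    rw [← heq hx]
    exact ih x hx.1 m n

/-- Near a point where the zeros of `q(w, ·)` are simple, the values of the branches are given by
finitely many holomorphic matrix functions with distinct values. -/
theorem exists_local_branches {N : ℕ} {D : Set ℂ} {H : ℂ → Matrix (Fin N) (Fin N) ℂ}
    (hH : MatAnalyticOn H D) {q : Polynomial (Polynomial ℂ)} {w₀ : ℂ}
    (hlead : q.leadingCoeff.eval w₀ ≠ 0)
    (hsimple : ∀ y, q.evalEval w₀ y = 0 → (Polynomial.derivative q).evalEval w₀ y ≠ 0)
    (hval : ∀ᶠ w in 𝓝 w₀, ∀ M ∈ branchValues D H w, ∀ m n, q.evalEval w (M m n) = 0) :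
    ∃ (ι : Type) (_ : Fintype ι) (g : ι → ℂ → Matrix (Fin N) (Fin N) ℂ) (r : ℝ), 0 < r ∧
      Fintype.card ι ≤ (q.natDegree ^ N) ^ N ∧ (∀ i, MatAnalyticOn (g i) (Metric.ball w₀ r)) ∧
      ∀ w ∈ Metric.ball w₀ r, Function.Injective (fun i => g i w) ∧
        branchValues D H w = range fun i => g i w := by
  classical
  obtain ⟨κ, _, y, r₁, hr₁, hcard, hya, hyinj, hy⟩ := exists_local_roots hlead hsimple
  obtain ⟨r₂, hr₂, hval⟩ := Metric.eventually_nhds_iff_ball.1 hval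
  set r := min r₁ r₂ with hr
  have hb1 : Metric.ball w₀ r ⊆ Metric.ball w₀ r₁ := Metric.ball_subset_ball (min_le_left _ _)
  have hb2 : Metric.ball w₀ r ⊆ Metric.ball w₀ r₂ := Metric.ball_subset_ball (min_le_right _ _)
  set g : (Fin N → Fin N → κ) → ℂ → Matrix (Fin N) (Fin N) ℂ :=
    fun σ w => Matrix.of fun m n => y (σ m n) w with hg
  have hga : ∀ σ, MatAnalyticOn (g σ) (Metric.ball w₀ r) := fun σ m n =>
    (hya (σ m n)).mono hb1
  refine ⟨{σ : Fin N → Fin N → κ // IsBranch D H w₀ r (g σ)}, inferInstance, fun σ => g σ.1, r,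
    lt_min hr₁ hr₂, ?_, fun σ => hga σ.1, fun w hw => ⟨fun σ τ h => ?_, ?_⟩⟩
  · refine (Fintype.card_subtype_le _).trans (le_of_eq ?_)
    rw [← hcard]
    simp
  · refine Subtype.ext (funext fun m => funext fun n => hyinj w (hb1 hw) ?_)
    exact congrFun (congrFun h m) n
  · ext M
    constructor
    · rintro ⟨c, ρ, f, hf, hwc, rfl⟩
      have hroot : ∀ z ∈ Metric.ball w₀ r, z ∈ Metric.ball c ρ → ∀ m n, ∃ i, y i z = f z m n :=
        fun z hz hzc m n => (hy z (hb1 hz) _).1 (hval z (hb2 hz) _ ⟨c, ρ, f, hf, hzc, rfl⟩ m n)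
      choose σ hσ using hroot w hw hwc
      have hopen : IsOpen (Metric.ball c ρ ∩ Metric.ball w₀ r) :=
        Metric.isOpen_ball.inter Metric.isOpen_ball
      have hmem : Metric.ball c ρ ∩ Metric.ball w₀ r ∈ 𝓝 w := hopen.mem_nhds ⟨hwc, hw⟩
      have hfa := hf.matAnalyticOn hH
      have heq : EqOn f (g σ) (Metric.ball c ρ ∩ Metric.ball w₀ r) := by
        intro z hz
        ext m n
        have h1 : AnalyticOnNhd ℂ (fun z => f z m n) (Metric.ball c ρ ∩ Metric.ball w₀ r) :=
          ((hfa m n).mono inter_subset_left).analyticOnNhd hopen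
        have h2 : AnalyticOnNhd ℂ (fun z => g σ z m n) (Metric.ball c ρ ∩ Metric.ball w₀ r) :=
          ((hga σ m n).mono inter_subset_right).analyticOnNhd hopen
        refine h1.eqOn_of_preconnected_of_eventuallyEq h2
          ((convex_ball _ _).inter (convex_ball _ _)).isPreconnected ⟨hwc, hw⟩ ?_ hz
        -- near `w` the entry of `f` stays away from the other roots
        have hne : ∀ᶠ z in 𝓝 w, ∀ i, i ≠ σ m n → f z m n - y i z ≠ 0 := by
          refine eventually_all.2 fun i => ?_
          by_cases hi : i = σ m n
          · simp [hi]
          · have hc1 : ContinuousAt (fun z => f z m n) w := (h1 w ⟨hwc, hw⟩).continuousAt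
            have hc2 : ContinuousAt (y i) w :=
              ((hya i).differentiableAt (Metric.isOpen_ball.mem_nhds (hb1 hw))).continuousAt
            have := (hc1.sub hc2).eventually_ne (sub_ne_zero.2 (by
              change f w m n ≠ _
              rw [← hσ m n]
              exact fun h => hi (hyinj w (hb1 hw) h).symm))
            filter_upwards [this] with z hz _ using hz
        filter_upwards [hne, hmem] with z hz hzm
        obtain ⟨i, hi⟩ := hroot z hzm.2 hzm.1 m n
        by_cases his : i = σ m n
        · rw [← hi, his]; rfl
        · exact absurd (sub_eq_zero.2 hi.symm) (hz i his)
      refine ⟨⟨σ, IsBranch.step c ρ f w₀ r (g σ) hf (lt_min hr₁ hr₂) (hga σ) ⟨w, hwc, hw⟩ heq⟩, ?_⟩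
      exact (heq ⟨hwc, hw⟩).symm
    · rintro ⟨σ, rfl⟩
      exact ⟨w₀, r, g σ.1, σ.2, hw, rfl⟩

/-! ### The rational matrix commuting with all branches -/

/-- `b` is bounded by a power of `1 + ‖w‖`. -/
def PolyGrowth (b : ℂ → ℝ) : Prop :=
  ∃ (C : ℝ) (n : ℕ), 0 ≤ C ∧ ∀ w, b w ≤ C * (1 + ‖w‖) ^ n

theorem PolyGrowth.const (c : ℝ) : PolyGrowth fun _ => c :=
  ⟨max c 0, 0, le_max_right _ _, fun w => by simp⟩

theorem PolyGrowth.add {f g : ℂ → ℝ} (hf : PolyGrowth f) (hg : PolyGrowth g) :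
    PolyGrowth fun w => f w + g w := by
  obtain ⟨C, n, hC, hf⟩ := hf
  obtain ⟨D, m, hD, hg⟩ := hg
  refine ⟨C + D, max n m, by positivity, fun w => ?_⟩
  have h1 : 1 ≤ 1 + ‖w‖ := by linarith [norm_nonneg w]
  calc f w + g w ≤ C * (1 + ‖w‖) ^ n + D * (1 + ‖w‖) ^ m := add_le_add (hf w) (hg w)
    _ ≤ C * (1 + ‖w‖) ^ max n m + D * (1 + ‖w‖) ^ max n m := by
      gcongr
      · exact le_max_left _ _
      · exact le_max_right _ _
    _ = _ := by ring

theorem PolyGrowth.mul {f g : ℂ → ℝ} (hf : PolyGrowth f) (hg : PolyGrowth g)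
    (hg0 : ∀ w, 0 ≤ g w) : PolyGrowth fun w => f w * g w := by
  obtain ⟨C, n, hC, hf⟩ := hf
  obtain ⟨D, m, hD, hg⟩ := hg
  refine ⟨C * D, n + m, by positivity, fun w => ?_⟩
  calc f w * g w ≤ (C * (1 + ‖w‖) ^ n) * (D * (1 + ‖w‖) ^ m) :=
        mul_le_mul (hf w) (hg w) (hg0 w) (by positivity)
    _ = _ := by rw [pow_add]; ring

theorem PolyGrowth.sum {ι : Type*} (s : Finset ι) {f : ι → ℂ → ℝ} (hf : ∀ i, PolyGrowth (f i)) :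
    PolyGrowth fun w => ∑ i ∈ s, f i w := by
  classical
  induction s using Finset.induction_on with
  | empty => simpa using PolyGrowth.const 0
  | insert a s ha ih => simpa [Finset.sum_insert ha] using (hf a).add ih

theorem PolyGrowth.prod {ι : Type*} (s : Finset ι) {f : ι → ℂ → ℝ} (hf : ∀ i, PolyGrowth (f i))
    (h0 : ∀ i w, 0 ≤ f i w) : PolyGrowth fun w => ∏ i ∈ s, f i w := by
  classical
  induction s using Finset.induction_on with
  | empty => simpa using PolyGrowth.const 1
  | insert a s ha ih =>
    simpa [Finset.prod_insert ha] using
      (hf a).mul ih fun w => Finset.prod_nonneg fun i _ => h0 i w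

theorem PolyGrowth.norm_eval (P : Polynomial ℂ) : PolyGrowth fun w => ‖P.eval w‖ := by
  have h : PolyGrowth fun w => ∑ i ∈ Finset.range (P.natDegree + 1), ‖P.coeff i‖ * ‖w‖ ^ i := by
    refine PolyGrowth.sum _ fun i => (PolyGrowth.const _).mul ⟨1, i, zero_le_one, fun w => ?_⟩
      fun w => by positivity
    rw [one_mul]
    exact pow_le_pow_left₀ (norm_nonneg w) (by linarith) i
  obtain ⟨C, n, hC, h⟩ := h
  refine ⟨C, n, hC, fun w => le_trans ?_ (h w)⟩
  beta_reduce
  rw [Polynomial.eval_eq_sum_range]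
  exact (norm_sum_le _ _).trans (le_of_eq (by simp))

/-- Zeros of `q(w, ·)`, multiplied by the leading coefficient of `q`, have polynomial growth. -/
theorem exists_root_bound (q : Polynomial (Polynomial ℂ)) :
    ∃ b : ℂ → ℝ, PolyGrowth b ∧ (∀ w, 0 ≤ b w) ∧ (∀ w, ‖q.leadingCoeff.eval w‖ ≤ b w) ∧
      ∀ w y, q.leadingCoeff.eval w ≠ 0 → q.evalEval w y = 0 →
        ‖q.leadingCoeff.eval w * y‖ ≤ b w := by
  refine ⟨fun w => ∑ i ∈ Finset.range (q.natDegree + 1), ‖(q.coeff i).eval w‖,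
    PolyGrowth.sum _ fun i => PolyGrowth.norm_eval _, fun w => by positivity, fun w => ?_,
    fun w y hw hy => ?_⟩
  · exact Finset.single_le_sum (f := fun i => ‖(q.coeff i).eval w‖) (fun i _ => norm_nonneg _)
      (Finset.mem_range.2 (Nat.lt_succ_self q.natDegree))
  · set p := q.map (Polynomial.evalRingHom w) with hp
    have hlc : p.leadingCoeff = q.leadingCoeff.eval w := by
      rw [hp, Polynomial.leadingCoeff_map_of_leadingCoeff_ne_zero _ (by simpa using hw)]
      rfl
    have hdeg : p.natDegree = q.natDegree :=
      Polynomial.natDegree_map_of_leadingCoeff_ne_zero _ (by simpa using hw)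
    have hp0 : p ≠ 0 := by
      rw [← Polynomial.leadingCoeff_ne_zero, hlc]; exact hw
    have hroot : p.IsRoot y := by
      rw [Polynomial.IsRoot.def, hp, Polynomial.map_evalRingHom_eval]; exact hy
    have h1 : ‖y‖ ≤ (p.cauchyBound : ℝ) := (hroot.norm_lt_cauchyBound hp0).le
    rw [Polynomial.cauchyBound, NNReal.coe_add, NNReal.coe_div, coe_nnnorm, hlc, hdeg] at h1
    have hpos : 0 < ‖q.leadingCoeff.eval w‖ := norm_pos_iff.2 hw
    have hsup : (((Finset.range q.natDegree).sup fun i => ‖p.coeff i‖₊ : NNReal) : ℝ) ≤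
        ∑ i ∈ Finset.range q.natDegree, ‖(q.coeff i).eval w‖ := by
      have : (Finset.range q.natDegree).sup (fun i => ‖p.coeff i‖₊) ≤
          ∑ i ∈ Finset.range q.natDegree, ‖p.coeff i‖₊ :=
        Finset.sup_le fun i hi => Finset.single_le_sum (f := fun i => ‖p.coeff i‖₊)
          (fun i _ => zero_le) hi
      refine (NNReal.coe_le_coe.2 this).trans (le_of_eq ?_)
      simp [hp]
    beta_reduce
    rw [norm_mul, Finset.sum_range_succ]
    have h2 := mul_le_mul_of_nonneg_left h1 hpos.le
    rw [mul_add, mul_div_cancel₀ _ hpos.ne', NNReal.coe_one, mul_one] at h2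
    exact h2.trans (add_le_add hsup le_rfl)

/-- A polynomial that annihilates all the entries of an algebraic matrix function. -/
theorem exists_common_equation {N : ℕ} {D : Set ℂ} {H : ℂ → Matrix (Fin N) (Fin N) ℂ}
    (h : ∀ m n, ∃ Q : Polynomial (Polynomial ℂ), Q ≠ 0 ∧ ∀ w ∈ D, Q.evalEval w (H w m n) = 0) :
    ∃ Q : Polynomial (Polynomial ℂ), Q ≠ 0 ∧ ∀ w ∈ D, ∀ m n, Q.evalEval w (H w m n) = 0 := by
  choose Q hQ0 hQ using h
  refine ⟨∏ m, ∏ n, Q m n, Finset.prod_ne_zero_iff.2 fun m _ => Finset.prod_ne_zero_iff.2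
    fun n _ => hQ0 m n, fun w hw m n => ?_⟩
  have : Q m n ∣ ∏ m, ∏ n, Q m n :=
    (Finset.dvd_prod_of_mem (Q m) (Finset.mem_univ n)).trans
      (Finset.dvd_prod_of_mem (fun m => ∏ n, Q m n) (Finset.mem_univ m))
  obtain ⟨R, hR⟩ := this
  rw [hR, Polynomial.evalEval_mul, hQ m n w hw, zero_mul]

theorem polynomial_finite_zeros {D : Polynomial ℂ} (hD : D ≠ 0) : {w | D.eval w = 0}.Finite :=
  Polynomial.finite_setOfPred_isRoot hD

theorem finite_ae_notMem {S : Set ℂ} (hS : S.Finite) : ∀ᵐ w : ℂ, w ∉ S :=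
  MeasureTheory.measure_eq_zero_iff_ae_notMem.1 (hS.measure_zero _)

/-- Symmetrization over the branches: an algebraic matrix function `H` with commuting branches and
generically distinct eigenvalues gives rise to a polynomial matrix with generically distinct
eigenvalues, whose values are combinations of the values of the branches. -/
theorem exists_polynomial_matrix {N : ℕ} {D : Set ℂ} (hDo : IsOpen D) (hDne : D.Nonempty)
    {H : ℂ → Matrix (Fin N) (Fin N) ℂ} (hH : MatAnalyticOn H D)
    (halg : ∀ m n, ∃ Q : Polynomial (Polynomial ℂ), Q ≠ 0 ∧
      ∀ w ∈ D, Q.evalEval w (H w m n) = 0)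
    (hdist : ∀ᵐ w, w ∈ D → HasDistinctEigenvalues (H w)) :
    ∃ A : Matrix (Fin N) (Fin N) (Polynomial ℂ),
      (∃ w, HasDistinctEigenvalues (A.map (Polynomial.eval w))) ∧
      ∀ w X, (∀ M ∈ branchValues D H w, Commute M X) → Commute (A.map (Polynomial.eval w)) X := by
  classical
  obtain ⟨Q, hQ0, hQ⟩ := exists_common_equation halg
  obtain ⟨q, E, hE0, hE⟩ := exists_squarefree_part hQ0
  have hval : ∀ w, E.eval w ≠ 0 → ∀ M ∈ branchValues D H w, ∀ m n, q.evalEval w (M m n) = 0 := by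
    rintro w hw _ ⟨c, r, f, hf, hwc, rfl⟩ m n
    exact (hE w hw).2.1 _ (hf.evalEval_eq_zero hQ w hwc m n)
  have hlocal : ∀ w₀, E.eval w₀ ≠ 0 → _ := fun w₀ hw₀ =>
    exists_local_branches hH (hE w₀ hw₀).1 (hE w₀ hw₀).2.2 (by
      filter_upwards [E.continuous.continuousAt.eventually_ne hw₀] with w hw using hval w hw)
  -- the point at which the symmetrization is normalized
  obtain ⟨w₁, hw₁D, hw₁E, hw₁⟩ : ∃ w₁ ∈ D, E.eval w₁ ≠ 0 ∧ HasDistinctEigenvalues (H w₁) := by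
    have h1 : ∀ᵐ w : ℂ, E.eval w ≠ 0 ∧ (w ∈ D → HasDistinctEigenvalues (H w)) :=
      (finite_ae_notMem (polynomial_finite_zeros hE0)).and hdist
    obtain ⟨w, hwD, hw⟩ : ∃ w ∈ D, E.eval w ≠ 0 ∧ (w ∈ D → HasDistinctEigenvalues (H w)) := by
      by_contra! hcon
      have hz : MeasureTheory.volume D = 0 := by
        refine MeasureTheory.measure_mono_null ?_ h1
        intro w hw hw'
        exact (hcon w hw hw'.1).2 (hw'.2 hw)
      exact (hDo.measure_pos _ hDne).ne' hz
    exact ⟨w, hwD, hw.1, hw.2 hwD⟩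
  have hH₁ : H w₁ ∈ branchValues D H w₁ := by
    obtain ⟨r, hr, hball⟩ := Metric.isOpen_iff.1 hDo w₁ hw₁D
    exact ⟨w₁, r, H, IsBranch.base w₁ r hr hball, Metric.mem_ball_self hr, rfl⟩
  have hfin₁ : (branchValues D H w₁).Finite := by
    obtain ⟨ι, _, g, r, hr, -, -, hg⟩ := hlocal w₁ hw₁E
    rw [(hg w₁ (Metric.mem_ball_self hr)).2]
    exact finite_range _
  -- a polynomial in the entries which separates `H w₁` from the values of the other branches
  set J : Finset (Matrix (Fin N) (Fin N) ℂ) := hfin₁.toFinset.erase (H w₁) with hJ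
  have hsep : ∀ M : J, ∃ mn : Fin N × Fin N, H w₁ mn.1 mn.2 ≠ M.1 mn.1 mn.2 := by
    intro M
    have hne : M.1 ≠ H w₁ := (Finset.mem_erase.1 M.2).1
    by_contra! hcon
    exact hne (by ext m n; exact (hcon (m, n)).symm)
  choose e he using hsep
  set φ : Matrix (Fin N) (Fin N) ℂ → ℂ :=
    fun X => ∏ M : J, (X (e M).1 (e M).2 - M.1 (e M).1 (e M).2) with hφ
  have hφ1 : φ (H w₁) ≠ 0 := Finset.prod_ne_zero_iff.2 fun M _ => sub_ne_zero.2 (he M)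
  have hφ0 : ∀ M ∈ branchValues D H w₁, M ≠ H w₁ → φ M = 0 := by
    intro M hM hne
    exact Finset.prod_eq_zero (Finset.mem_univ
      (⟨M, Finset.mem_erase.2 ⟨hne, hfin₁.mem_toFinset.2 hM⟩⟩ : J)) (sub_self _)
  set T : ℂ → Matrix (Fin N) (Fin N) ℂ := fun w => ∑ᶠ M ∈ branchValues D H w, φ M • M with hT
  set lc := q.leadingCoeff with hlc
  set K := Fintype.card J with hK
  -- the power of the leading coefficient turns every entry of a branch into a function of polynomial
  -- growth: there are `K` entries in `φ M` and one in `M`; the factor `E` makes the exceptional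
  -- points removable
  set A : ℂ → Matrix (Fin N) (Fin N) ℂ :=
    fun w => (E.eval w * lc.eval w ^ (K + 1)) • T w with hA
  have hTcomm : ∀ w X, (∀ M ∈ branchValues D H w, Commute M X) → Commute (T w) X := by
    intro w X hX
    rw [hT]
    refine finsum_induction (fun M => Commute M X) (Commute.zero_left X)
      (fun _ _ h1 h2 => h1.add_left h2) fun M => ?_
    refine finsum_induction (fun M => Commute M X) (Commute.zero_left X)
      (fun _ _ h1 h2 => h1.add_left h2) fun hM => (hX M hM).smul_left _
  obtain ⟨b, hb, hb0, hlb, hyb⟩ := exists_root_bound q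
  set B : ℂ → ℝ := fun w => ((q.natDegree ^ N) ^ N : ℕ) *
    ((∏ M : J, (b w * (1 + ‖M.1 (e M).1 (e M).2‖))) * b w) with hB
  have hBg : PolyGrowth B := by
    refine (PolyGrowth.const _).mul ((PolyGrowth.prod _ (fun M =>
      hb.mul (PolyGrowth.const _) fun w => by positivity) fun M w => ?_).mul hb hb0) fun w => ?_
    · exact mul_nonneg (hb0 w) (by positivity)
    · exact mul_nonneg (Finset.prod_nonneg fun M _ => mul_nonneg (hb0 w) (by positivity)) (hb0 w)
  have hAB : ∀ w m n, ‖A w m n‖ ≤ ‖E.eval w‖ * B w := by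
    intro w m n
    by_cases hw : E.eval w = 0
    · simp [hA, hw]
    obtain ⟨ι, _, g, r, hr, hcard, -, hg⟩ := hlocal w hw
    obtain ⟨hinj, hV⟩ := hg w (Metric.mem_ball_self hr)
    have hTw : T w = ∑ i, φ (g i w) • g i w := by
      rw [hT]
      simp only
      rw [hV, finsum_mem_range hinj, finsum_eq_sum_of_fintype]
    have hAw : A w m n = E.eval w * ∑ i, (∏ M : J, (lc.eval w * g i w (e M).1 (e M).2 -
        lc.eval w * M.1 (e M).1 (e M).2)) * (lc.eval w * g i w m n) := by
      simp only [hA, hTw, Matrix.smul_apply, Matrix.sum_apply, smul_eq_mul, hφ, mul_assoc]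
      congr 1
      rw [Finset.mul_sum]
      refine Finset.sum_congr rfl fun i _ => ?_
      simp only [← mul_sub]
      rw [Finset.prod_mul_distrib, Finset.prod_const, Finset.card_univ, ← hK, pow_succ]
      ring
    have hent : ∀ i m n, ‖lc.eval w * g i w m n‖ ≤ b w := fun i m n =>
      hyb w _ (hE w hw).1 (hval w hw _ (by rw [hV]; exact mem_range_self i) m n)
    rw [hAw, norm_mul]
    refine mul_le_mul_of_nonneg_left ((norm_sum_le _ _).trans ?_) (norm_nonneg _)
    have hterm : ∀ i ∈ (Finset.univ : Finset ι), ‖(∏ M : J, (lc.eval w * g i w (e M).1 (e M).2 -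
        lc.eval w * M.1 (e M).1 (e M).2)) * (lc.eval w * g i w m n)‖ ≤
        (∏ M : J, (b w * (1 + ‖M.1 (e M).1 (e M).2‖))) * b w := by
      intro i _
      rw [norm_mul, norm_prod]
      refine mul_le_mul (Finset.prod_le_prod (fun _ _ => norm_nonneg _) fun M _ => ?_) (hent i m n)
        (norm_nonneg _) (Finset.prod_nonneg fun M _ => mul_nonneg (hb0 w) (by positivity))
      refine (norm_sub_le _ _).trans ?_
      rw [mul_add, mul_one]
      refine add_le_add (hent i _ _) ?_
      rw [norm_mul]
      exact mul_le_mul_of_nonneg_right (hlb w) (norm_nonneg _)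
    refine (Finset.sum_le_card_nsmul _ _ _ hterm).trans ?_
    rw [nsmul_eq_mul, Finset.card_univ]
    refine mul_le_mul_of_nonneg_right (by exact_mod_cast hcard) (mul_nonneg
      (Finset.prod_nonneg fun M _ => mul_nonneg (hb0 w) (by positivity)) (hb0 w))
  have hAd : ∀ m n w, E.eval w ≠ 0 → DifferentiableAt ℂ (fun w => A w m n) w := by
    intro m n w₀ hw₀
    obtain ⟨ι, _, g, r, hr, hcard, hga, hg⟩ := hlocal w₀ hw₀
    have hball : Metric.ball w₀ r ∈ 𝓝 w₀ := Metric.ball_mem_nhds w₀ hr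
    have heq : (fun w => A w m n) =ᶠ[𝓝 w₀] fun w => E.eval w * lc.eval w ^ (K + 1) *
        ∑ i, (∏ M : J, (g i w (e M).1 (e M).2 - M.1 (e M).1 (e M).2)) * g i w m n := by
      filter_upwards [hball] with w hw
      obtain ⟨hinj, hV⟩ := hg w hw
      have hTw : T w = ∑ i, φ (g i w) • g i w := by
        rw [hT]
        simp only
        rw [hV, finsum_mem_range hinj, finsum_eq_sum_of_fintype]
      simp only [hA, hTw, Matrix.smul_apply, Matrix.sum_apply, smul_eq_mul, hφ]
    rw [heq.differentiableAt_iff]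
    have hgd : ∀ i m n, DifferentiableAt ℂ (fun w => g i w m n) w₀ := fun i m n =>
      (hga i m n).differentiableAt hball
    refine (E.differentiable.differentiableAt.mul
      (lc.differentiable.differentiableAt.pow _)).mul (DifferentiableAt.fun_sum fun i _ => ?_)
    exact (DifferentiableAt.fun_finsetProd fun M _ => (hgd i _ _).sub_const _).mul (hgd i m n)
  have hAc : ∀ m n, Continuous fun w => A w m n := by
    intro m n
    rw [continuous_iff_continuousAt]
    intro w₀
    by_cases hw₀ : E.eval w₀ = 0
    · obtain ⟨C, k, hC, hBk⟩ := hBg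
      have h0 : A w₀ m n = 0 := by simp [hA, hw₀]
      rw [ContinuousAt, h0]
      refine squeeze_zero_norm (a := fun w => ‖E.eval w‖ * (C * (1 + ‖w‖) ^ k))
        (fun w => (hAB w m n).trans (mul_le_mul_of_nonneg_left (hBk w) (norm_nonneg _))) ?_
      have : Continuous fun w : ℂ => ‖E.eval w‖ * (C * (1 + ‖w‖) ^ k) := by
        have := E.continuous
        fun_prop
      have h := this.tendsto w₀
      simpa [hw₀] using h
    · exact (hAd m n w₀ hw₀).continuousAt
  have hAent : ∀ m n, Differentiable ℂ fun w => A w m n := fun m n =>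
    differentiable_of_continuous_of_vertical_lines (hAc m n)
      ((polynomial_finite_zeros hE0).image re) fun z hz => hAd m n z fun h => hz ⟨z, h, rfl⟩
  have hpoly : ∀ m n, ∃ P : Polynomial ℂ, ∀ w, A w m n = P.eval w := by
    intro m n
    obtain ⟨C, k, hC, h⟩ := ((PolyGrowth.norm_eval E).mul hBg fun w => mul_nonneg (by positivity)
      (mul_nonneg (Finset.prod_nonneg fun M _ => mul_nonneg (hb0 w) (by positivity)) (hb0 w)))
    exact exists_polynomial_of_growth k (hAent m n) fun w => (hAB w m n).trans (h w)
  choose P hP using hpoly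
  have hPA : ∀ w, (Matrix.of P).map (Polynomial.eval w) = A w := fun w => by
    ext m n
    simp [hP]
  refine ⟨Matrix.of P, ⟨w₁, ?_⟩, fun w X hX => ?_⟩
  · rw [hPA]
    have hT₁ : T w₁ = φ (H w₁) • H w₁ := by
      rw [hT]
      simp only
      rw [← finsum_mem_singleton (f := fun M => φ M • M) (a := H w₁)]
      refine finsum_mem_inter_support_eq' _ _ _ fun M hM => ⟨fun h => ?_, ?_⟩
      · by_contra hne
        exact hM (by change φ M • M = 0; rw [hφ0 M h hne, zero_smul])
      · rintro rfl
        exact hH₁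
    have hc : E.eval w₁ * lc.eval w₁ ^ (K + 1) * φ (H w₁) ≠ 0 :=
      mul_ne_zero (mul_ne_zero hw₁E (pow_ne_zero _ (hE w₁ hw₁E).1)) hφ1
    have := hw₁.one_add_smul hc 0
    rw [zero_smul, zero_add] at this
    simpa only [hA, hT₁, smul_smul] using this
  · rw [hPA]
    exact (hTcomm w X hX).smul_left _

theorem isOpen_halfStrip (ε : ℝ) (a : ℂ) : IsOpen (halfStrip ε a) := by
  have h1 : IsOpen {w : ℂ | |(w - a).re| < ε} := isOpen_lt (by fun_prop) continuous_const
  have h2 : IsOpen {w : ℂ | 0 < (w - a).im} := isOpen_lt continuous_const (by fun_prop)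
  exact h1.inter h2

theorem halfStrip_nonempty {ε : ℝ} (hε : 0 < ε) (a : ℂ) : (halfStrip ε a).Nonempty :=
  ⟨a + I, by simpa [halfStrip] using hε⟩

theorem im_pos_of_mem_openCut {a w : ℂ} (ha : 0 < a.im) (h : w ∈ openCut a) : 0 < w.im := by
  have := h.2
  rw [sub_im] at this
  linarith

/-- Without any `H_j` there is nothing to commute with. -/
theorem exists_commutingRational_of_isEmpty {p N : ℕ} (ε : ℝ) {k : Fin p → ℂ}
    {H : Fin p → ℂ → Matrix (Fin N) (Fin N) ℂ} (hp : IsEmpty (Fin p)) :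
    ∃ (d : ℕ) (ρ : Fin d → ℂ) (t : Fin d → Matrix (Fin N) (Fin N) ℂ),
      IsCommutingRational ε k H ρ t := by
  refine ⟨1, fun _ => 0, fun _ => Matrix.diagonal fun i => (i : ℂ),
    Function.injective_of_subsingleton _, fun _ j => hp.elim j, ?_, fun j => hp.elim j⟩
  filter_upwards [finite_ae_notMem (finite_singleton (0 : ℂ))] with w hw
  have hd : HasDistinctEigenvalues (Matrix.diagonal fun i : Fin N => ((i : ℕ) : ℂ)) :=
    hasDistinctEigenvalues_diagonal.2 fun i j h => Fin.ext (Nat.cast_injective h)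
  have := hd.one_add_smul (inv_ne_zero hw) 1
  simpa [simpleFractions] using this

theorem IsCoefficientFamily.exists_commutingRational {p N : ℕ} {ε : ℝ} {k : Fin p → ℂ}
    {H : Fin p → ℂ → Matrix (Fin N) (Fin N) ℂ} (hH : IsCoefficientFamily ε k H) :
    ∃ (d : ℕ) (ρ : Fin d → ℂ) (t : Fin d → Matrix (Fin N) (Fin N) ℂ),
      IsCommutingRational ε k H ρ t := by
  classical
  rcases isEmpty_or_nonempty (Fin p) with hp | ⟨⟨j₀⟩⟩
  · exact exists_commutingRational_of_isEmpty ε hp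
  obtain ⟨A, ⟨w₁, hw₁⟩, hA⟩ := exists_polynomial_matrix (isOpen_halfStrip ε (k j₀))
    (halfStrip_nonempty hH.eps_pos _) (hH.analytic j₀) (hH.algebraic j₀) (hH.distinct j₀)
  -- as many nodes as needed to interpolate the entries
  obtain ⟨d, hd⟩ : ∃ d : ℕ, ∀ m n, (A m n).degree < d := by
    refine ⟨(Finset.univ.sup fun m => Finset.univ.sup fun n => (A m n).natDegree) + 1,
      fun m n => ?_⟩
    refine lt_of_le_of_lt Polynomial.degree_le_natDegree (Nat.cast_lt.2 (Nat.lt_succ_of_le ?_))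
    exact (Finset.le_sup (f := fun n => (A m n).natDegree) (Finset.mem_univ n)).trans
      (Finset.le_sup (f := fun m => Finset.univ.sup fun n => (A m n).natDegree)
        (Finset.mem_univ m))
  set ρ : Fin d → ℂ := fun l => ((l : ℕ) : ℂ) with hρ
  have hρinj : Function.Injective ρ := fun i j h => Fin.ext (Nat.cast_injective h)
  set t : Fin d → Matrix (Fin N) (Fin N) ℂ :=
    fun l => Lagrange.nodalWeight Finset.univ ρ l • A.map (Polynomial.eval (ρ l)) with ht
  have hB : ∀ w, (∀ l, w ≠ ρ l) → (Lagrange.nodal Finset.univ ρ).eval w ≠ 0 ∧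
      simpleFractions ρ t w =
        1 + ((Lagrange.nodal Finset.univ ρ).eval w)⁻¹ • A.map (Polynomial.eval w) := by
    intro w hw
    have h0 : (Lagrange.nodal Finset.univ ρ).eval w ≠ 0 :=
      Lagrange.eval_nodal_not_at_node fun i _ => hw i
    refine ⟨h0, ?_⟩
    rw [simpleFractions]
    congr 1
    ext m n
    have h1 := Lagrange.eq_interpolate (s := Finset.univ) (v := ρ) (f := A m n) hρinj.injOn
      (by simpa using hd m n)
    have h2 := Lagrange.eval_interpolate_not_at_node (s := Finset.univ) (v := ρ)
      (fun i => (A m n).eval (ρ i)) fun i _ => hw i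
    rw [← h1] at h2
    rw [Matrix.smul_apply, Matrix.map_apply, h2, smul_eq_mul, inv_mul_cancel_left₀ h0,
      Matrix.sum_apply]
    refine Finset.sum_congr rfl fun l _ => ?_
    simp only [ht, Matrix.smul_apply, smul_eq_mul, Matrix.map_apply]
    ring
  have hdisc : matDisc A ≠ 0 := by
    intro h
    have := (hasDistinctEigenvalues_iff_matDisc_ne_zero _).1 hw₁
    rw [show A.map (Polynomial.eval w₁) = A.map (Polynomial.evalRingHom w₁) from rfl,
      matDisc_map, h, map_zero] at this
    exact this rfl
  refine ⟨d, ρ, t, hρinj, fun l j hl => ?_, ?_, fun j c r f hf w hw hwρ => ?_⟩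
  · have := im_pos_of_mem_openCut (hH.im_pos j) hl
    simp [hρ] at this
  · filter_upwards [finite_ae_notMem (polynomial_finite_zeros hdisc),
      finite_ae_notMem (finite_range ρ)] with w hw hwρ
    obtain ⟨h0, hBw⟩ := hB w fun l h => hwρ ⟨l, h.symm⟩
    have h1 : HasDistinctEigenvalues (A.map (Polynomial.eval w)) := by
      rw [hasDistinctEigenvalues_iff_matDisc_ne_zero,
        show A.map (Polynomial.eval w) = A.map (Polynomial.evalRingHom w) from rfl, matDisc_map]
      exact hw
    have := h1.one_add_smul (inv_ne_zero h0) 1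
    rwa [one_smul, ← hBw] at this
  · rw [(hB w hwρ).2]
    refine (Commute.one_left _).add_left (Commute.smul_left (hA w _ ?_) _)
    rintro _ ⟨c', r', f', hf', hw', rfl⟩
    exact hH.branch_commute j₀ j c' r' f' c r f hf' hf w ⟨hw', hw⟩

/-! ### Calculus of matrix functions -/

theorem tendsto_matrix_iff {N : ℕ} {α : Type*} {l : Filter α}
    {f : α → Matrix (Fin N) (Fin N) ℂ} {M : Matrix (Fin N) (Fin N) ℂ} :
    Tendsto f l (𝓝 M) ↔ ∀ m n, Tendsto (fun x => f x m n) l (𝓝 (M m n)) := by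
  refine Iff.trans (tendsto_pi_nhds (f := fun x m => f x m)) ?_
  exact forall_congr' fun m => tendsto_pi_nhds

theorem tendsto_matrix_inv {N : ℕ} {α : Type*} {l : Filter α}
    {f : α → Matrix (Fin N) (Fin N) ℂ} {M : Matrix (Fin N) (Fin N) ℂ}
    (hf : Tendsto f l (𝓝 M)) (hM : M.det ≠ 0) : Tendsto (fun x => (f x)⁻¹) l (𝓝 M⁻¹) := by
  simp_rw [Matrix.inv_def, Ring.inverse_eq_inv']
  have h1 : Tendsto (fun x => (f x).det) l (𝓝 M.det) :=
    ((continuous_id.matrix_det).tendsto M).comp hf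
  have h2 : Tendsto (fun x => (f x).adjugate) l (𝓝 M.adjugate) :=
    ((continuous_id.matrix_adjugate).tendsto M).comp hf
  exact (h1.inv₀ hM).smul h2

theorem hasDerivWithinAt_matrix_mul {N : ℕ} {f g : ℂ → Matrix (Fin N) (Fin N) ℂ}
    {f' g' : Matrix (Fin N) (Fin N) ℂ} {s : Set ℂ} {x : ℂ}
    (hf : ∀ m n, HasDerivWithinAt (fun y => f y m n) (f' m n) s x)
    (hg : ∀ m n, HasDerivWithinAt (fun y => g y m n) (g' m n) s x) (m n : Fin N) :
    HasDerivWithinAt (fun y => (f y * g y) m n) ((f' * g x + f x * g') m n) s x := by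
  simp only [Matrix.mul_apply, Matrix.add_apply, ← Finset.sum_add_distrib]
  exact HasDerivWithinAt.fun_sum fun i _ => (hf m i).mul (hg i n)

theorem differentiableWithinAt_matrix_det {N : ℕ} {f : ℂ → Matrix (Fin N) (Fin N) ℂ}
    {s : Set ℂ} {x : ℂ} (hf : ∀ m n, DifferentiableWithinAt ℂ (fun y => f y m n) s x) :
    DifferentiableWithinAt ℂ (fun y => (f y).det) s x := by
  simp only [Matrix.det_apply]
  exact DifferentiableWithinAt.fun_sum fun σ _ =>
    (DifferentiableWithinAt.fun_finsetProd fun i _ => hf _ _).const_smul _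

theorem differentiableWithinAt_matrix_inv {N : ℕ} {f : ℂ → Matrix (Fin N) (Fin N) ℂ}
    {s : Set ℂ} {x : ℂ} (hf : ∀ m n, DifferentiableWithinAt ℂ (fun y => f y m n) s x)
    (hx : (f x).det ≠ 0) (m n : Fin N) :
    DifferentiableWithinAt ℂ (fun y => (f y)⁻¹ m n) s x := by
  simp only [Matrix.inv_def, Ring.inverse_eq_inv', Matrix.smul_apply, smul_eq_mul,
    Matrix.adjugate_apply]
  refine ((differentiableWithinAt_matrix_det hf).inv hx).mul
    (differentiableWithinAt_matrix_det fun i j => ?_)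
  by_cases h : i = n
  · subst h
    simpa only [Matrix.updateRow_self] using differentiableWithinAt_const _
  · simpa [Matrix.updateRow_ne h] using hf i j

/-- The derivative of `f t f⁻¹` for constant `t` and `f' = a f` is `[a, f t f⁻¹]`. -/
theorem hasDerivWithinAt_matrix_conj {N : ℕ} {f : ℂ → Matrix (Fin N) (Fin N) ℂ}
    {a : Matrix (Fin N) (Fin N) ℂ} {s : Set ℂ} {x : ℂ} (hs : UniqueDiffWithinAt ℂ s x)
    (hxs : x ∈ s)
    (hf : ∀ m n, HasDerivWithinAt (fun y => f y m n) ((a * f x) m n) s x)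
    (hdet : ∀ y ∈ s, (f y).det ≠ 0) (t : Matrix (Fin N) (Fin N) ℂ) (m n : Fin N) :
    HasDerivWithinAt (fun y => (f y * t * (f y)⁻¹) m n)
      ((a * (f x * t * (f x)⁻¹) - (f x * t * (f x)⁻¹) * a) m n) s x := by
  have hx := hdet x hxs
  have hinv := differentiableWithinAt_matrix_inv (fun m n => (hf m n).differentiableWithinAt) hx
  set g' : Matrix (Fin N) (Fin N) ℂ :=
    Matrix.of fun m n => derivWithin (fun y => (f y)⁻¹ m n) s x with hg'
  have hg : ∀ m n, HasDerivWithinAt (fun y => (f y)⁻¹ m n) (g' m n) s x :=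
    fun m n => (hinv m n).hasDerivWithinAt
  -- differentiate `f * f⁻¹ = 1`
  have h0 : a * f x * (f x)⁻¹ + f x * g' = 0 := by
    ext m n
    refine hs.eq_deriv s (hasDerivWithinAt_matrix_mul hf hg m n) ?_
    refine (hasDerivWithinAt_const x s ((1 : Matrix (Fin N) (Fin N) ℂ) m n)).congr
      (fun y hy => ?_) ?_
    · rw [Matrix.mul_nonsing_inv _ (hdet y hy).isUnit]
    · rw [Matrix.mul_nonsing_inv _ hx.isUnit]
  have hg'eq : g' = -((f x)⁻¹ * a) := by
    rw [Matrix.mul_nonsing_inv_cancel_right _ _ hx.isUnit] at h0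
    have := congrArg (fun M => (f x)⁻¹ * M) h0
    simp only [Matrix.mul_add, Matrix.nonsing_inv_mul_cancel_left _ _ hx.isUnit,
      Matrix.mul_zero] at this
    exact eq_neg_of_add_eq_zero_right this
  have hft : ∀ m n, HasDerivWithinAt (fun y => (f y * t) m n) ((a * f x * t) m n) s x := by
    intro m n
    have := hasDerivWithinAt_matrix_mul hf
      (g := fun _ => t) (g' := 0) (fun m n => hasDerivWithinAt_const x s (t m n)) m n
    simpa using this
  have := hasDerivWithinAt_matrix_mul hft hg m n
  rw [hg'eq] at this
  have e : a * (f x * t * (f x)⁻¹) - f x * t * (f x)⁻¹ * a =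
      a * f x * t * (f x)⁻¹ + f x * t * -((f x)⁻¹ * a) := by
    simp only [Matrix.mul_neg, Matrix.mul_assoc, sub_eq_add_neg]
  rw [e]
  exact this

/-! ### The cut plane -/

theorem dense_re_notMem {X : Set ℝ} (hX : X.Finite) : Dense {w : ℂ | w.re ∉ X} :=
  (hX.countable.dense_compl ℝ).preimage Complex.isOpenMap_re

theorem mem_cutPlane_of_re {p : ℕ} {k : Fin p → ℂ} {b w : ℂ} (hb : b ∈ halfLine)
    (hw : w.re ∉ range fun j => (k j).re) : w ∈ cutPlane k b := by
  intro j hj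
  refine hw ⟨j, ?_⟩
  have h1 := hj.1
  have h2 := hb.1
  rw [sub_re, add_re, h2] at h1
  simp only
  linarith

theorem isClosed_closedCut (a : ℂ) : IsClosed (closedCut a) := by
  have h1 : IsClosed {w : ℂ | (w - a).re = 0} := isClosed_eq (by fun_prop) continuous_const
  have h2 : IsClosed {w : ℂ | 0 ≤ (w - a).im} := isClosed_le continuous_const (by fun_prop)
  exact h1.inter h2

theorem isOpen_cutPlane {p : ℕ} (k : Fin p → ℂ) (b : ℂ) : IsOpen (cutPlane k b) := by
  have : cutPlane k b = ⋂ j, (closedCut (k j + b))ᶜ := by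
    ext w; simp [cutPlane]
  rw [this]
  exact isOpen_iInter_of_finite fun j => (isClosed_closedCut _).isOpen_compl

theorem closedCut_add_subset {a b : ℂ} (hb : b ∈ halfLine) : closedCut (a + b) ⊆ openCut a := by
  rintro w ⟨h1, h2⟩
  obtain ⟨h3, h4⟩ := hb
  simp only [sub_re, add_re, sub_im, add_im] at h1 h2
  refine ⟨?_, ?_⟩
  · rw [sub_re]; linarith
  · rw [sub_im]; linarith

theorem add_mem_openCut {a b : ℂ} (hb : b ∈ halfLine) : a + b ∈ openCut a := by
  obtain ⟨h3, h4⟩ := hb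
  exact ⟨by simpa using h3, by simpa using h4⟩

theorem mem_cutPlane_of_notMem_openCut {p : ℕ} {k : Fin p → ℂ} {b w : ℂ} (hb : b ∈ halfLine)
    (hw : ∀ j, w ∉ openCut (k j)) : w ∈ cutPlane k b :=
  fun j hj => hw j (closedCut_add_subset hb hj)

/-- A function holomorphic on a set `A` containing all but finitely many vertical lines, with
continuous boundary values off a finite set `F`, with at most mild singularities at the points of
`F` and vanishing at infinity, is zero. -/
theorem eq_zero_of_boundary_values {A : Set ℂ} (hA : IsOpen A) {X : Set ℝ} (hX : X.Finite)
    (hXA : {w : ℂ | w.re ∉ X} ⊆ A) {F : Finset ℂ} (hFA : ∀ c ∈ F, c ∉ A) {E : ℂ → ℂ}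
    (hd : ∀ w ∈ A, DifferentiableAt ℂ E w)
    (hlim : ∀ w, w ∉ A → w ∉ F → ∃ y, Tendsto E (𝓝[A] w) (𝓝 y))
    (hF : ∀ c ∈ F, Tendsto (fun w => (w - c) * E w) (𝓝[A] c) (𝓝 0))
    (hinf : Tendsto E (Bornology.cobounded ℂ ⊓ 𝓟 A) (𝓝 0)) : ∀ w ∈ A, E w = 0 := by
  classical
  have hdense : Dense A := (dense_re_notMem hX).mono hXA
  set π : ℂ → ℂ := fun w => ∏ c ∈ F, (w - c) with hπ
  have hπd : Differentiable ℂ π := by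
    rw [hπ]; fun_prop
  set M : ℂ → ℂ := fun w => π w * E w with hM
  have hMlim0 : ∀ c ∈ F, Tendsto M (𝓝[A] c) (𝓝 0) := by
    intro c hc
    have h1 : M = fun w => (∏ c' ∈ F.erase c, (w - c')) * ((w - c) * E w) := by
      funext w
      rw [hM]
      simp only [hπ]
      rw [← Finset.mul_prod_erase F _ hc]
      ring
    rw [h1]
    have h2 : Tendsto (fun w => ∏ c' ∈ F.erase c, (w - c')) (𝓝[A] c)
        (𝓝 (∏ c' ∈ F.erase c, (c - c'))) :=
      ((by fun_prop : Continuous fun w : ℂ => ∏ c' ∈ F.erase c, (w - c')).tendsto c).mono_left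
        nhdsWithin_le_nhds
    simpa using h2.mul (hF c hc)
  have hMlim : ∀ w, ∃ y, Tendsto M (𝓝[A] w) (𝓝 y) := by
    intro w
    by_cases hw : w ∈ A
    · exact ⟨M w, ((hπd w).mul (hd w hw)).continuousAt.tendsto.mono_left nhdsWithin_le_nhds⟩
    by_cases hwF : w ∈ F
    · exact ⟨0, hMlim0 w hwF⟩
    · obtain ⟨y, hy⟩ := hlim w hw hwF
      exact ⟨_, (hπd.continuous.continuousAt.tendsto.mono_left nhdsWithin_le_nhds).mul hy⟩
  set f := extendFrom A M with hf
  have hfc : Continuous f := continuous_extendFrom hdense hMlim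
  have hfA : ∀ w ∈ A, f w = M w := fun w hw =>
    extendFrom_eq (subset_closure hw)
      (((hπd w).mul (hd w hw)).continuousAt.tendsto.mono_left nhdsWithin_le_nhds)
  have hfd : Differentiable ℂ f := by
    refine differentiable_of_continuous_of_vertical_lines hfc hX fun z hz => ?_
    have : f =ᶠ[𝓝 z] M := by
      filter_upwards [hA.mem_nhds (hXA hz)] with w hw using hfA w hw
    rw [this.differentiableAt_iff]
    exact (hπd z).mul (hd z (hXA hz))
  have hzero : f = 0 := by
    refine entire_eq_zero_of_vanish F hfd (fun c hc => extendFrom_eq (hdense c) (hMlim0 c hc)) ?_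
    rw [Metric.tendsto_nhds]
    intro ε hε
    have h1 := (Metric.tendsto_nhds.1 hinf) (ε / 2) (half_pos hε)
    rw [eventually_inf_principal, Filter.HasBasis.eventually_iff
      (Metric.hasBasis_cobounded_compl_closedBall (0 : ℂ))] at h1
    obtain ⟨r, -, hr⟩ := h1
    have hopen : IsOpen (Metric.closedBall (0 : ℂ) r)ᶜ := Metric.isClosed_closedBall.isOpen_compl
    have hsub : (Metric.closedBall (0 : ℂ) r)ᶜ ⊆ {z | ‖f z‖ ≤ ε / 2 * ‖π z‖} := by
      have hcl : IsClosed {z | ‖f z‖ ≤ ε / 2 * ‖π z‖} :=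
        isClosed_le hfc.norm (continuous_const.mul hπd.continuous.norm)
      refine (hdense.open_subset_closure_inter hopen).trans (hcl.closure_subset_iff.2 ?_)
      rintro z ⟨hz, hzA⟩
      have := hr hz hzA
      rw [dist_zero_right] at this
      rw [mem_ofPred_eq, hfA z hzA, hM, norm_mul, mul_comm]
      gcongr
    have h2 : (Metric.closedBall (0 : ℂ) r)ᶜ ∈ Bornology.cobounded ℂ :=
      Bornology.isBounded_def.1 Metric.isBounded_closedBall
    filter_upwards [h2] with z hz
    have := hsub hz
    rw [mem_ofPred_eq] at this
    rw [dist_zero_right, norm_div]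
    refine lt_of_le_of_lt (div_le_of_le_mul₀ (norm_nonneg _) (half_pos hε).le this) (half_lt_self hε)
  intro w hw
  have h := hfA w hw
  rw [hzero, hM] at h
  refine (mul_eq_zero.1 h.symm).resolve_left ?_
  rw [hπ]
  exact Finset.prod_ne_zero_iff.2 fun c hc => sub_ne_zero.2 fun e => hFA c hc (e ▸ hw)

/-! ### The conjugated rational matrix -/

theorem differentiableAt_simpleFractions {N d : ℕ} {ρ : Fin d → ℂ}
    (t : Fin d → Matrix (Fin N) (Fin N) ℂ) {w : ℂ} (hw : ∀ l, w ≠ ρ l) (m n : Fin N) :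
    DifferentiableAt ℂ (fun w => simpleFractions ρ t w m n) w := by
  simp only [simpleFractions, Matrix.add_apply, Matrix.sum_apply, Matrix.smul_apply, smul_eq_mul]
  refine (differentiableAt_const _).add (DifferentiableAt.fun_sum fun l _ => ?_)
  have h : DifferentiableAt ℂ (fun w => w - ρ l) w := by fun_prop
  exact (h.inv (sub_ne_zero.2 (hw l))).mul_const _

theorem continuousAt_simpleFractions {N d : ℕ} {ρ : Fin d → ℂ}
    (t : Fin d → Matrix (Fin N) (Fin N) ℂ) {w : ℂ} (hw : ∀ l, w ≠ ρ l) :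
    ContinuousAt (simpleFractions ρ t) w :=
  tendsto_matrix_iff.2 fun m n => (differentiableAt_simpleFractions t hw m n).continuousAt

theorem tendsto_sub_smul_simpleFractions {N d : ℕ} {ρ : Fin d → ℂ} (hρ : Function.Injective ρ)
    (t : Fin d → Matrix (Fin N) (Fin N) ℂ) (l : Fin d) :
    Tendsto (fun w => (w - ρ l) • simpleFractions ρ t w) (𝓝[≠] (ρ l)) (𝓝 (t l)) := by
  classical
  have h1 : Tendsto (fun w => (w - ρ l) • ((1 : Matrix (Fin N) (Fin N) ℂ) +
      ∑ l' ∈ Finset.univ.erase l, (w - ρ l')⁻¹ • t l') + t l) (𝓝 (ρ l))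
      (𝓝 ((ρ l - ρ l) • ((1 : Matrix (Fin N) (Fin N) ℂ) +
        ∑ l' ∈ Finset.univ.erase l, (ρ l - ρ l')⁻¹ • t l') + t l)) := by
    have hs : Tendsto (fun w => w - ρ l) (𝓝 (ρ l)) (𝓝 (ρ l - ρ l)) :=
      (continuous_sub_right _).tendsto _
    refine (hs.smul (tendsto_const_nhds.add (tendsto_finsetSum _ fun l' hl' => ?_))).add_const _
    have hne : ρ l - ρ l' ≠ 0 := sub_ne_zero.2 fun h => (Finset.mem_erase.1 hl').1 (hρ h).symm
    exact (((continuous_sub_right (ρ l')).tendsto (ρ l)).inv₀ hne).smul_const _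
  rw [sub_self, zero_smul, zero_add] at h1
  refine (h1.mono_left nhdsWithin_le_nhds).congr' ?_
  filter_upwards [self_mem_nhdsWithin] with w hw
  have hw0 : w - ρ l ≠ 0 := sub_ne_zero.2 hw
  rw [simpleFractions, ← Finset.add_sum_erase Finset.univ _ (Finset.mem_univ l), add_left_comm,
    smul_add (w - ρ l) ((w - ρ l)⁻¹ • t l), smul_smul, mul_inv_cancel₀ hw0, one_smul, add_comm]

theorem tendsto_simpleFractions_cobounded {N d : ℕ} (ρ : Fin d → ℂ)
    (t : Fin d → Matrix (Fin N) (Fin N) ℂ) :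
    Tendsto (simpleFractions ρ t) (Bornology.cobounded ℂ) (𝓝 1) := by
  have h1 : Tendsto (fun w => (1 : Matrix (Fin N) (Fin N) ℂ) + ∑ l, (w - ρ l)⁻¹ • t l)
      (Bornology.cobounded ℂ) (𝓝 (1 + ∑ l, (0 : ℂ) • t l)) := by
    refine tendsto_const_nhds.add (tendsto_finsetSum _ fun l _ => ?_)
    refine Tendsto.smul_const ?_ _
    exact tendsto_inv₀_cobounded.comp (tendsto_sub_const_cobounded (ρ l))
  simp only [zero_smul, Finset.sum_const_zero, add_zero] at h1
  exact h1

theorem openCut_subset_halfStrip {ε : ℝ} (hε : 0 < ε) (a : ℂ) : openCut a ⊆ halfStrip ε a :=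
  fun w hw => ⟨by rw [hw.1, abs_zero]; exact hε, hw.2⟩

section Family

variable {p N d : ℕ} {ε : ℝ} {k : Fin p → ℂ} {H : Fin p → ℂ → Matrix (Fin N) (Fin N) ℂ}
  {logF : Fin p → ℂ → Fin N → ℂ} {U : ℂ → ℂ → Matrix (Fin N) (Fin N) ℂ}
  {ρ : Fin d → ℂ} {t : Fin d → Matrix (Fin N) (Fin N) ℂ}

theorem IsCommutingRational.commute_base (hB : IsCommutingRational ε k H ρ t) (j : Fin p) {w : ℂ}
    (hw : w ∈ halfStrip ε (k j)) (hwρ : ∀ l, w ≠ ρ l) :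
    Commute (simpleFractions ρ t w) (H j w) := by
  obtain ⟨r, hr, hball⟩ := Metric.isOpen_iff.1 (isOpen_halfStrip ε (k j)) w hw
  exact hB.commute j w r (H j) (IsBranch.base w r hr hball) w (Metric.mem_ball_self hr) hwρ

theorem IsCommutingRational.pole_mem_cutPlane (hB : IsCommutingRational ε k H ρ t) {b : ℂ}
    (hb : b ∈ halfLine) (l : Fin d) : ρ l ∈ cutPlane k b :=
  mem_cutPlane_of_notMem_openCut hb (hB.poles_not_mem_cut l)

theorem IsCommutingRational.ne_pole (hB : IsCommutingRational ε k H ρ t) {j : Fin p} {w : ℂ}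
    (hw : w ∈ openCut (k j)) (l : Fin d) : w ≠ ρ l :=
  fun h => hB.poles_not_mem_cut l j (h ▸ hw)

theorem IsRHFamily.differentiableAt (hU : IsRHFamily k H logF U) {b w : ℂ} (hb : b ∈ halfLine)
    (hw : w ∈ cutPlane k b) (m n : Fin N) : DifferentiableAt ℂ (fun w => U b w m n) w :=
  (hU.analytic b hb m n).differentiableAt ((isOpen_cutPlane k b).mem_nhds hw)

theorem IsRHFamily.continuousAt (hU : IsRHFamily k H logF U) {b w : ℂ} (hb : b ∈ halfLine)
    (hw : w ∈ cutPlane k b) : ContinuousAt (U b) w :=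
  tendsto_matrix_iff.2 fun m n => (hU.differentiableAt hb hw m n).continuousAt

/-- The coefficient `r_l(b) = U(b, ρ_l) t_l U(b, ρ_l)⁻¹` of the conjugated rational matrix. -/
noncomputable def conjResidue (U : ℂ → ℂ → Matrix (Fin N) (Fin N) ℂ) (ρ : Fin d → ℂ)
    (t : Fin d → Matrix (Fin N) (Fin N) ℂ) (l : Fin d) (b : ℂ) : Matrix (Fin N) (Fin N) ℂ :=
  U b (ρ l) * t l * (U b (ρ l))⁻¹

theorem IsCoefficientFamily.re_injective (hH : IsCoefficientFamily ε k H) :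
    Function.Injective fun j => (k j).re := by
  intro i j hij
  by_contra hne
  simp only at hij
  rcases le_total (k i).im (k j).im with h | h
  · exact hH.not_mem_cut j i (Ne.symm hne) ⟨by rw [sub_re]; linarith, by rw [sub_im]; linarith⟩
  · exact hH.not_mem_cut i j hne ⟨by rw [sub_re]; linarith, by rw [sub_im]; linarith⟩

/-- The conjugated matrix extends continuously across the cuts, as `B` commutes with `H_j`. -/
theorem IsRHFamily.tendsto_conj_openCut (hU : IsRHFamily k H logF U)
    (hH : IsCoefficientFamily ε k H) (hB : IsCommutingRational ε k H ρ t) {b : ℂ}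
    (hb : b ∈ halfLine) {j : Fin p} {w : ℂ} (hw : w ∈ openCut (k j + b)) :
    ∃ Y, Tendsto (fun z => U b z * simpleFractions ρ t z * (U b z)⁻¹) (𝓝[cutPlane k b] w)
      (𝓝 Y) := by
  have hw' : w ∈ openCut (k j) := closedCut_add_subset hb ⟨hw.1, hw.2.le⟩
  have hwρ := hB.ne_pole hw'
  obtain ⟨V, hV, hleft, hright⟩ := hU.jump b hb j w hw
  have hHdet := hH.det_ne_zero j w hw'
  have hVH : (V * H j w).det ≠ 0 := by
    rw [Matrix.det_mul]; exact mul_ne_zero hV hHdet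
  have hcomm := hB.commute_base j (openCut_subset_halfStrip hH.eps_pos _ hw') hwρ
  have hBc : ∀ s, Tendsto (simpleFractions ρ t) (𝓝[s] w) (𝓝 (simpleFractions ρ t w)) := fun s =>
    (continuousAt_simpleFractions t hwρ).tendsto.mono_left nhdsWithin_le_nhds
  have e : V * H j w * simpleFractions ρ t w * (V * H j w)⁻¹ =
      V * simpleFractions ρ t w * V⁻¹ := by
    rw [Matrix.mul_inv_rev, Matrix.mul_assoc V, ← hcomm.eq]
    simp only [Matrix.mul_assoc]
    rw [Matrix.mul_nonsing_inv_cancel_left _ _ hHdet.isUnit]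
  have h1 := (hleft.mul (hBc _)).mul (tendsto_matrix_inv hleft hV)
  have h2 := (hright.mul (hBc _)).mul (tendsto_matrix_inv hright hVH)
  rw [e] at h2
  refine ⟨_, (h1.sup h2).mono_left ?_⟩
  rw [← nhdsWithin_union]
  -- near `w`, points of the cut plane are not on the vertical line through `w`
  have hnear : {z : ℂ | 0 < (z - (k j + b)).im} ∈ 𝓝 w :=
    (isOpen_lt continuous_const (by fun_prop)).mem_nhds hw.2
  rw [← nhdsWithin_inter_of_mem' (mem_nhdsWithin_of_mem_nhds hnear)]
  refine nhdsWithin_mono _ ?_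
  rintro z ⟨hz, hzim⟩
  rcases lt_trichotomy z.re w.re with h | h | h
  · exact Or.inl h
  · refine absurd ⟨?_, le_of_lt hzim⟩ (hz j)
    have := hw.1
    rw [sub_re] at this ⊢
    rw [h]; exact this
  · exact Or.inr h

theorem upPow_ne_zero (z e : ℂ) : upPow z e ≠ 0 := Complex.exp_ne_zero _

/-- At an end of a cut where the eigenvalues of `H_j` are distinct, the eigenvectors of `H_j`
diagonalize `B`, so that the singular factor of `U` cancels in the conjugated matrix. -/
theorem IsRHFamily.exists_endpoint_frame (hU : IsRHFamily k H logF U)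
    (hH : IsCoefficientFamily ε k H) (hB : IsCommutingRational ε k H ρ t)
    (hF : IsLogEigenvalues k H logF) {b : ℂ}
    (hb : b ∈ halfLine) {j : Fin p} (hdist : HasDistinctEigenvalues (H j (k j + b))) :
    ∃ (P : ℂ → Matrix (Fin N) (Fin N) ℂ) (β : ℂ → Fin N → ℂ) (K : Matrix (Fin N) (Fin N) ℂ),
      (∀ᶠ w in 𝓝 (k j + b), ContinuousAt P w) ∧ (P (k j + b)).det ≠ 0 ∧ K.det ≠ 0 ∧
      (∀ᶠ w in 𝓝 (k j + b), ContinuousAt β w) ∧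
      (∀ᶠ w in 𝓝 (k j + b),
        simpleFractions ρ t w * P w = P w * Matrix.diagonal (β w)) ∧
      Tendsto (fun w => U b w * P w * Matrix.diagonal (fun m =>
        upPow (w - (k j + b)) (-(logF j b m / (2 * Real.pi * I))))) (𝓝[cutPlane k b] (k j + b))
        (𝓝 K) ∧
      Tendsto (fun z => U b z * simpleFractions ρ t z * (U b z)⁻¹) (𝓝[cutPlane k b] (k j + b))
        (𝓝 (K * Matrix.diagonal (β (k j + b)) * K⁻¹)) := by
  obtain ⟨P, f, K, hPa, hPdet, hHP, hfa, hK, hlim⟩ := hU.endpoint b hb j hdist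
  set a := k j + b with ha
  have haC : a ∈ openCut (k j) := add_mem_openCut hb
  have haS := openCut_subset_halfStrip hH.eps_pos _ haC
  have hSn : halfStrip ε (k j) ∈ 𝓝 a := (isOpen_halfStrip _ _).mem_nhds haS
  have haρ := hB.ne_pole haC
  have hρn : ∀ᶠ w in 𝓝 a, ∀ l, w ≠ ρ l :=
    eventually_all.2 fun l => isOpen_ne.mem_nhds (haρ l)
  have hPc : ∀ᶠ w in 𝓝 a, ContinuousAt P w := by
    have : ∀ᶠ w in 𝓝 a, ∀ m n, AnalyticAt ℂ (fun w => P w m n) w :=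
      eventually_all.2 fun m => eventually_all.2 fun n => (hPa m n).eventually_analyticAt
    filter_upwards [this] with w hw
    exact tendsto_matrix_iff.2 fun m n => (hw m n).continuousAt
  have hPc0 : ContinuousAt P a := hPc.self_of_nhds
  have hPdetn : ∀ᶠ w in 𝓝 a, (P w).det ≠ 0 :=
    (((continuous_id.matrix_det).continuousAt (x := P a)).comp hPc0).eventually_ne hPdet
  have hHc : ContinuousAt (H j) a :=
    tendsto_matrix_iff.2 fun m n => ((hH.analytic j m n).differentiableAt hSn).continuousAt
  -- the eigenvalues in the frame `P` stay distinct near `a`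
  have hfP : ∀ᶠ w in 𝓝 a, ∀ m, f w m = ((P w)⁻¹ * H j w * P w) m m := by
    filter_upwards [hHP, hPdetn] with w hw hdet m
    rw [Matrix.mul_assoc, hw, Matrix.nonsing_inv_mul_cancel_left _ _ hdet.isUnit,
      Matrix.diagonal_apply_eq]
  have hfc : ∀ m, ContinuousAt (fun w => f w m) a := by
    intro m
    have h1 : Tendsto (fun w => (P w)⁻¹ * H j w * P w) (𝓝 a) (𝓝 ((P a)⁻¹ * H j a * P a)) :=
      ((tendsto_matrix_inv hPc0 hPdet).mul hHc).mul hPc0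
    have h2 : ContinuousAt (fun w => ((P w)⁻¹ * H j w * P w) m m) a := tendsto_matrix_iff.1 h1 m m
    refine h2.congr ?_
    filter_upwards [hfP] with w hw using (hw m).symm
  have hinj : Function.Injective (f a) := by
    have h1 := hF.charpoly_eq j b hb
    rw [HasDistinctEigenvalues, ha, h1, nodup_roots_prod_iff] at hdist
    intro m n hmn
    rw [hfa, hfa] at hmn
    exact hdist hmn
  have hfinj : ∀ᶠ w in 𝓝 a, Function.Injective (f w) := by
    have : ∀ᶠ w in 𝓝 a, ∀ m n, m ≠ n → f w m - f w n ≠ 0 := by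
      refine eventually_all.2 fun m => eventually_all.2 fun n => ?_
      by_cases h : m = n
      · simp [h]
      · have := ((hfc m).sub (hfc n)).eventually_ne (sub_ne_zero.2 fun e => h (hinj e))
        filter_upwards [this] with w hw _ using hw
    filter_upwards [this] with w hw m n hmn
    by_contra hne
    exact hw m n hne (sub_eq_zero.2 hmn)
  set β : ℂ → Fin N → ℂ := fun w m => ((P w)⁻¹ * simpleFractions ρ t w * P w) m m with hβ
  have hβc : ∀ᶠ w in 𝓝 a, ContinuousAt β w := by
    filter_upwards [hPc, hPdetn, hρn] with w hPw hdet hwρ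
    have h1 := ((tendsto_matrix_inv hPw hdet).mul (continuousAt_simpleFractions t hwρ)).mul hPw
    exact tendsto_pi_nhds.2 fun m => tendsto_matrix_iff.1 h1 m m
  have hBP : ∀ᶠ w in 𝓝 a, simpleFractions ρ t w * P w = P w * Matrix.diagonal (β w) := by
    filter_upwards [hHP, hPdetn, hfinj, hρn, hSn] with w hw hdet hinjw hwρ hwS
    have hcomm := (hB.commute_base j hwS hwρ).eq
    have hu : IsUnit (P w).det := hdet.isUnit
    have h1 : (P w)⁻¹ * simpleFractions ρ t w * P w * Matrix.diagonal (f w) =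
        Matrix.diagonal (f w) * ((P w)⁻¹ * simpleFractions ρ t w * P w) := by
      have e : Matrix.diagonal (f w) * (P w)⁻¹ = (P w)⁻¹ * H j w := by
        have : (P w)⁻¹ * (H j w * P w) * (P w)⁻¹ =
            (P w)⁻¹ * (P w * Matrix.diagonal (f w)) * (P w)⁻¹ := by rw [hw]
        rw [Matrix.nonsing_inv_mul_cancel_left _ _ hu] at this
        rw [← this, Matrix.mul_assoc, Matrix.mul_nonsing_inv_cancel_right _ _ hu]
      calc (P w)⁻¹ * simpleFractions ρ t w * P w * Matrix.diagonal (f w)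
          = (P w)⁻¹ * simpleFractions ρ t w * (P w * Matrix.diagonal (f w)) := Matrix.mul_assoc _ _ _
        _ = (P w)⁻¹ * (simpleFractions ρ t w * H j w) * P w := by
          rw [← hw]; simp only [Matrix.mul_assoc]
        _ = Matrix.diagonal (f w) * (P w)⁻¹ * simpleFractions ρ t w * P w := by
          rw [hcomm, e]; simp only [Matrix.mul_assoc]
        _ = _ := by simp only [Matrix.mul_assoc]
    have h2 := eq_diagonal_of_commute hinjw h1
    calc simpleFractions ρ t w * P w
        = P w * ((P w)⁻¹ * simpleFractions ρ t w * P w) := by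
          rw [Matrix.mul_assoc, Matrix.mul_nonsing_inv_cancel_left _ _ hu]
      _ = _ := by rw [h2]
  refine ⟨P, β, K, hPc, hPdet, hK, hβc, hBP, hlim, ?_⟩
  set D : ℂ → Matrix (Fin N) (Fin N) ℂ := fun w => Matrix.diagonal (fun m =>
    upPow (w - a) (-(logF j b m / (2 * Real.pi * I)))) with hD
  have hDdet : ∀ w, (D w).det ≠ 0 := fun w => by
    rw [hD, Matrix.det_diagonal]
    exact Finset.prod_ne_zero_iff.2 fun m _ => upPow_ne_zero _ _
  have hβlim : Tendsto (fun w => Matrix.diagonal (β w)) (𝓝[cutPlane k b] a)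
      (𝓝 (Matrix.diagonal (β a))) :=
    (((continuous_id.matrix_diagonal).tendsto (β a)).comp hβc.self_of_nhds).mono_left
      nhdsWithin_le_nhds
  refine ((hlim.mul hβlim).mul (tendsto_matrix_inv hlim hK)).congr' ?_
  filter_upwards [self_mem_nhdsWithin, mem_nhdsWithin_of_mem_nhds hBP,
    mem_nhdsWithin_of_mem_nhds hPdetn] with w hwC hw hdet
  have hUdet := hU.det_ne_zero b hb w hwC
  have hWdet : (U b w * P w * D w).det ≠ 0 := by
    rw [Matrix.det_mul, Matrix.det_mul]
    exact mul_ne_zero (mul_ne_zero hUdet hdet) (hDdet w)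
  have hcomm : D w * Matrix.diagonal (β w) = Matrix.diagonal (β w) * D w := by
    simp only [hD, Matrix.diagonal_mul_diagonal, mul_comm]
  change U b w * P w * D w * Matrix.diagonal (β w) * (U b w * P w * D w)⁻¹ = _
  have h1 : U b w * P w * D w * Matrix.diagonal (β w) =
      U b w * simpleFractions ρ t w * (U b w)⁻¹ * (U b w * P w * D w) := by
    rw [Matrix.mul_assoc _ (D w), hcomm]
    simp only [Matrix.mul_assoc]
    rw [Matrix.nonsing_inv_mul_cancel_left _ _ hUdet.isUnit, ← Matrix.mul_assoc (P w),
      ← Matrix.mul_assoc (simpleFractions ρ t w), hw]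
  rw [h1, Matrix.mul_nonsing_inv_cancel_right _ _ hWdet.isUnit]

/-- The formula for the conjugated matrix at those `b` for which all the ends of the cuts are
covered by the prescribed endpoint behaviour. -/
theorem IsRHFamily.conj_eq_of_distinct (hU : IsRHFamily k H logF U)
    (hH : IsCoefficientFamily ε k H) (hB : IsCommutingRational ε k H ρ t)
    (hF : IsLogEigenvalues k H logF) {b : ℂ} (hb : b ∈ halfLine)
    (hdist : ∀ j, HasDistinctEigenvalues (H j (k j + b))) {w : ℂ} (hw : w ∈ cutPlane k b)
    (hwρ : ∀ l, w ≠ ρ l) :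
    U b w * simpleFractions ρ t w * (U b w)⁻¹ =
      simpleFractions ρ (fun l => conjResidue U ρ t l b) w := by
  classical
  set r := fun l => conjResidue U ρ t l b with hr
  set A : Set ℂ := cutPlane k b \ range ρ with hA
  set F : Finset ℂ := Finset.univ.image (fun j => k j + b) ∪ Finset.univ.image ρ with hFdef
  set X : Set ℝ := (range fun j => (k j).re) ∪ re '' range ρ with hX
  have hAC : A ⊆ cutPlane k b := sdiff_subset
  have hAo : IsOpen A := (isOpen_cutPlane k b).sdiff (finite_range ρ).isClosed
  have hXf : X.Finite := (finite_range _).union ((finite_range ρ).image _)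
  have hXA : {w : ℂ | w.re ∉ X} ⊆ A := by
    intro z hz
    refine ⟨mem_cutPlane_of_re hb fun h => hz (Or.inl h), fun h => hz (Or.inr ⟨z, h, rfl⟩)⟩
  have hFA : ∀ c ∈ F, c ∉ A := by
    intro c hc hcA
    rcases Finset.mem_union.1 hc with h | h
    · obtain ⟨j, -, rfl⟩ := Finset.mem_image.1 h
      exact hcA.1 j ⟨by simp, by simp⟩
    · obtain ⟨l, -, rfl⟩ := Finset.mem_image.1 h
      exact hcA.2 ⟨l, rfl⟩
  have hAρ : ∀ z ∈ A, ∀ l, z ≠ ρ l := fun z hz l h => hz.2 ⟨l, h.symm⟩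
  set G : ℂ → Matrix (Fin N) (Fin N) ℂ :=
    fun z => U b z * simpleFractions ρ t z * (U b z)⁻¹ - simpleFractions ρ r z with hG
  suffices h : ∀ m n, ∀ z ∈ A, G z m n = 0 by
    have h1 : G w = 0 := by
      ext m n
      exact h m n w ⟨hw, fun ⟨l, hl⟩ => hwρ l hl.symm⟩
    exact sub_eq_zero.1 h1
  intro m n
  refine eq_zero_of_boundary_values hAo hXf hXA hFA ?_ ?_ ?_ ?_
  · intro z hz
    have hUd := fun m n => (hU.differentiableAt hb hz.1 m n).differentiableWithinAt (s := univ)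
    have hBd := fun m n => differentiableAt_simpleFractions (ρ := ρ) t (hAρ z hz) m n
    have hinv := differentiableWithinAt_matrix_inv hUd (hU.det_ne_zero b hb z hz.1)
    simp only [differentiableWithinAt_univ] at hUd hinv
    have hR := differentiableAt_simpleFractions (ρ := ρ) r (hAρ z hz) m n
    simp only [hG, Matrix.sub_apply, Matrix.mul_apply]
    refine DifferentiableAt.sub (DifferentiableAt.fun_sum fun i _ => DifferentiableAt.mul
      (DifferentiableAt.fun_sum fun i' _ => (hUd _ _).mul (hBd _ _)) (hinv _ _)) hR
  · intro z hzA hzF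
    have hzρ : z ∉ range ρ := fun ⟨l, hl⟩ => hzF (Finset.mem_union_right _
      (Finset.mem_image.2 ⟨l, Finset.mem_univ l, hl⟩))
    have hzC : z ∉ cutPlane k b := fun h => hzA ⟨h, hzρ⟩
    simp only [cutPlane, mem_ofPred_eq, not_forall, not_not] at hzC
    obtain ⟨j, hj⟩ := hzC
    have hne : z ≠ k j + b := fun h => hzF (Finset.mem_union_left _
      (Finset.mem_image.2 ⟨j, Finset.mem_univ j, h.symm⟩))
    have hopen : z ∈ openCut (k j + b) := by
      refine ⟨hj.1, lt_of_le_of_ne hj.2 fun h => hne ?_⟩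
      exact sub_eq_zero.1 (Complex.ext hj.1 h.symm)
    obtain ⟨Y, hY⟩ := hU.tendsto_conj_openCut hH hB hb hopen
    have hS := (continuousAt_simpleFractions r fun l h => hzρ ⟨l, h.symm⟩).tendsto.mono_left
      (nhdsWithin_le_nhds (s := A))
    exact ⟨_, tendsto_matrix_iff.1 ((hY.mono_left (nhdsWithin_mono _ hAC)).sub hS) m n⟩
  · intro c hc
    suffices h : Tendsto (fun z => (z - c) • G z) (𝓝[A] c) (𝓝 0) from tendsto_matrix_iff.1 h m n
    by_cases hcρ : ∃ l, ρ l = c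
    · obtain ⟨l, rfl⟩ := hcρ
      have hle : 𝓝[A] (ρ l) ≤ 𝓝[≠] (ρ l) := nhdsWithin_mono _ fun z hz => hAρ z hz l
      have hUc := (hU.continuousAt hb (hB.pole_mem_cutPlane hb l)).tendsto.mono_left
        (nhdsWithin_le_nhds (s := A))
      have h1 := (hUc.mul ((tendsto_sub_smul_simpleFractions hB.poles_injective t l).mono_left
        hle)).mul (tendsto_matrix_inv hUc (hU.det_ne_zero b hb _ (hB.pole_mem_cutPlane hb l)))
      have h2 := (tendsto_sub_smul_simpleFractions hB.poles_injective r l).mono_left hle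
      have h3 := h1.sub h2
      have e : U b (ρ l) * t l * (U b (ρ l))⁻¹ - r l = 0 := sub_self _
      rw [e] at h3
      refine h3.congr fun z => ?_
      rw [hG, smul_sub, Matrix.mul_smul, Matrix.smul_mul]
    · rcases Finset.mem_union.1 hc with h | h
      · obtain ⟨j, -, rfl⟩ := Finset.mem_image.1 h
        obtain ⟨P, β, K, -, -, -, -, -, -, hlim⟩ := hU.exists_endpoint_frame hH hB hF hb (hdist j)
        have hS := (continuousAt_simpleFractions r fun l h => hcρ ⟨l, h.symm⟩).tendsto.mono_left
          (nhdsWithin_le_nhds (s := A))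
        have h1 := (hlim.mono_left (nhdsWithin_mono _ hAC)).sub hS
        have h2 : Tendsto (fun z => z - (k j + b)) (𝓝[A] (k j + b)) (𝓝 0) := by
          have := ((continuous_sub_right (k j + b)).tendsto (k j + b)).mono_left
            (nhdsWithin_le_nhds (s := A))
          rwa [sub_self] at this
        have h3 := h2.smul h1
        rwa [zero_smul] at h3
      · obtain ⟨l, -, rfl⟩ := Finset.mem_image.1 h
        exact absurd ⟨l, rfl⟩ hcρ
  · have hU1 := (hU.tendsto_one b hb).mono_left
      (inf_le_inf_left (Bornology.cobounded ℂ) (principal_mono.2 hAC))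
    have hle : Bornology.cobounded ℂ ⊓ 𝓟 A ≤ Bornology.cobounded ℂ := inf_le_left
    have h1 := ((hU1.mul ((tendsto_simpleFractions_cobounded ρ t).mono_left hle)).mul
      (tendsto_matrix_inv hU1 (by simp))).sub
      ((tendsto_simpleFractions_cobounded ρ r).mono_left hle)
    have h2 := tendsto_matrix_iff.1 h1 m n
    simp only [mul_one, inv_one, sub_self] at h2
    exact h2

end Family

section Family

variable {p N d : ℕ} {ε : ℝ} {k : Fin p → ℂ} {H : Fin p → ℂ → Matrix (Fin N) (Fin N) ℂ}
  {logF : Fin p → ℂ → Fin N → ℂ} {U : ℂ → ℂ → Matrix (Fin N) (Fin N) ℂ}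
  {s : Fin p → ℂ → Matrix (Fin N) (Fin N) ℂ}
  {ρ : Fin d → ℂ} {t : Fin d → Matrix (Fin N) (Fin N) ℂ}

/-! ### Passing to all values of the parameter -/

theorem halfLine_nhdsWithin_neBot {b : ℂ} (hb : b ∈ halfLine) : (𝓝[halfLine \ {b}] b).NeBot := by
  rw [← mem_closure_iff_nhdsWithin_neBot]
  have h1 : Tendsto (fun x : ℝ => b + x * I) (𝓝[>] 0) (𝓝 b) := by
    have : Continuous fun x : ℝ => b + x * I := by fun_prop
    have h := this.tendsto 0
    simp only [ofReal_zero, zero_mul, add_zero] at h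
    exact h.mono_left nhdsWithin_le_nhds
  refine mem_closure_of_tendsto h1 ?_
  filter_upwards [self_mem_nhdsWithin] with x hx
  have hx' : 0 < x := hx
  refine ⟨⟨by simpa using hb.1, ?_⟩, ?_⟩
  · have := hb.2
    simp only [add_im, mul_im, ofReal_re, I_im, mul_one, ofReal_im, I_re, mul_zero, add_zero]
    linarith
  · simp only [mem_singleton_iff, add_eq_left, mul_eq_zero, ofReal_eq_zero, I_ne_zero, or_false]
    exact hx'.ne'

theorem uniqueDiffWithinAt_halfLine {b : ℂ} (hb : b ∈ halfLine) :
    UniqueDiffWithinAt ℂ halfLine b := by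
  rw [uniqueDiffWithinAt_iff_accPt, accPt_principal_iff_nhdsWithin]
  exact halfLine_nhdsWithin_neBot hb

/-- The parameters at which some `H_j(k_j + b)` has a multiple eigenvalue are isolated. -/
theorem IsCoefficientFamily.eventually_distinct (hH : IsCoefficientFamily ε k H) {b : ℂ}
    (hb : b ∈ halfLine) : ∀ᶠ x in 𝓝[halfLine \ {b}] b,
      ∀ j, HasDistinctEigenvalues (H j (k j + x)) := by
  refine eventually_all.2 fun j => ?_
  set a := k j + b with ha
  have haS := openCut_subset_halfStrip hH.eps_pos _ (add_mem_openCut (a := k j) hb)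
  have hSn : halfStrip ε (k j) ∈ 𝓝 a := (isOpen_halfStrip _ _).mem_nhds haS
  have han : AnalyticAt ℂ (fun w => matDisc (H j w)) a :=
    AnalyticAt.matDisc fun m n => (hH.analytic j m n).analyticAt hSn
  rcases han.eventually_eq_zero_or_eventually_ne_zero with h | h
  · exfalso
    obtain ⟨r, hr, hball⟩ := Metric.eventually_nhds_iff_ball.1 (h.and hSn)
    have hz : MeasureTheory.volume (Metric.ball a r) = 0 := by
      refine MeasureTheory.measure_mono_null ?_ (hH.distinct j)
      intro w hw hcon
      obtain ⟨h1, h2⟩ := hball w hw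
      exact (hasDistinctEigenvalues_iff_matDisc_ne_zero _).1 (hcon h2) h1
    exact (Metric.measure_ball_pos _ a hr).ne' hz
  · have htend : Tendsto (fun x => k j + x) (𝓝[halfLine \ {b}] b) (𝓝[≠] a) := by
      refine tendsto_nhdsWithin_of_tendsto_nhds_of_eventually_within _ ?_ ?_
      · exact ((continuous_const_add (k j)).tendsto b).mono_left nhdsWithin_le_nhds
      · filter_upwards [self_mem_nhdsWithin] with x hx h
        exact hx.2 (add_left_cancel h)
    filter_upwards [htend.eventually h] with x hx
    exact (hasDistinctEigenvalues_iff_matDisc_ne_zero _).2 hx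

theorem ODE1.continuousWithinAt (h1 : ODE1 k s U) {b w : ℂ} (hb : b ∈ halfLine)
    (hw : w ∈ cutPlane k b) : ContinuousWithinAt (fun x => U x w) halfLine b :=
  tendsto_matrix_iff.2 fun m n => (h1 b hb w hw m n).continuousWithinAt

theorem ODE1.continuousWithinAt_conjResidue (h1 : ODE1 k s U) (hU : IsRHFamily k H logF U)
    (hB : IsCommutingRational ε k H ρ t) {b : ℂ} (hb : b ∈ halfLine) (l : Fin d) :
    ContinuousWithinAt (conjResidue U ρ t l) halfLine b := by
  have hc := h1.continuousWithinAt hb (hB.pole_mem_cutPlane hb l)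
  exact (hc.mul continuousWithinAt_const).mul
    (tendsto_matrix_inv hc (hU.det_ne_zero b hb _ (hB.pole_mem_cutPlane hb l)))

/-- The formula `U B U⁻¹ = I + ∑ r_l / (w - ρ_l)`: for the exceptional `b` it follows by
continuity in `b` from `IsRHFamily.conj_eq_of_distinct`. -/
theorem IsRHFamily.conj_eq (hU : IsRHFamily k H logF U)
    (hH : IsCoefficientFamily ε k H) (hB : IsCommutingRational ε k H ρ t)
    (hF : IsLogEigenvalues k H logF) (h1 : ODE1 k s U) {b : ℂ} (hb : b ∈ halfLine) {w : ℂ}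
    (hw : w ∈ cutPlane k b) (hwρ : ∀ l, w ≠ ρ l) :
    U b w * simpleFractions ρ t w * (U b w)⁻¹ =
      simpleFractions ρ (fun l => conjResidue U ρ t l b) w := by
  -- off the vertical lines through the `k_j`
  have key : ∀ z : ℂ, z.re ∉ (range fun j => (k j).re) → (∀ l, z ≠ ρ l) →
      U b z * simpleFractions ρ t z * (U b z)⁻¹ =
        simpleFractions ρ (fun l => conjResidue U ρ t l b) z := by
    intro z hz hzρ
    have := halfLine_nhdsWithin_neBot hb
    have hle : 𝓝[halfLine \ {b}] b ≤ 𝓝[halfLine] b := nhdsWithin_mono _ sdiff_subset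
    have hzC : z ∈ cutPlane k b := mem_cutPlane_of_re hb hz
    have hc := (h1.continuousWithinAt hb hzC).tendsto.mono_left hle
    have hl1 : Tendsto (fun x => U x z * simpleFractions ρ t z * (U x z)⁻¹) (𝓝[halfLine \ {b}] b)
        (𝓝 (U b z * simpleFractions ρ t z * (U b z)⁻¹)) :=
      (hc.mul_const _).mul (tendsto_matrix_inv hc (hU.det_ne_zero b hb z hzC))
    have hl2 : Tendsto (fun x => simpleFractions ρ (fun l => conjResidue U ρ t l x) z)
        (𝓝[halfLine \ {b}] b)
        (𝓝 (simpleFractions ρ (fun l => conjResidue U ρ t l b) z)) :=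
      tendsto_const_nhds.add (tendsto_finsetSum _ fun l _ =>
        ((h1.continuousWithinAt_conjResidue hU hB hb l).tendsto.mono_left hle).const_smul _)
    refine tendsto_nhds_unique (hl1.congr' ?_) hl2
    filter_upwards [hH.eventually_distinct hb, self_mem_nhdsWithin] with x hx hxb
    exact hU.conj_eq_of_distinct hH hB hF hxb.1 hx (mem_cutPlane_of_re hxb.1 hz) hzρ
  set V : Set ℂ := {z : ℂ | z.re ∉ (range fun j => (k j).re) ∪ re '' range ρ} with hV
  have hVd : Dense V := dense_re_notMem ((finite_range _).union ((finite_range ρ).image _))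
  have hne : (𝓝[V] w).NeBot := mem_closure_iff_nhdsWithin_neBot.1 (hVd w)
  have hc := hU.continuousAt hb hw
  have hl1 : Tendsto (fun z => U b z * simpleFractions ρ t z * (U b z)⁻¹) (𝓝[V] w)
      (𝓝 (U b w * simpleFractions ρ t w * (U b w)⁻¹)) :=
    ((hc.tendsto.mul (continuousAt_simpleFractions t hwρ)).mul
      (tendsto_matrix_inv hc (hU.det_ne_zero b hb w hw))).mono_left nhdsWithin_le_nhds
  have hl2 : Tendsto (fun z => simpleFractions ρ (fun l => conjResidue U ρ t l b) z) (𝓝[V] w)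
      (𝓝 (simpleFractions ρ (fun l => conjResidue U ρ t l b) w)) :=
    (continuousAt_simpleFractions _ hwρ).tendsto.mono_left nhdsWithin_le_nhds
  refine tendsto_nhds_unique (hl1.congr' ?_) hl2
  filter_upwards [self_mem_nhdsWithin] with z hz
  exact key z (fun h => hz (Or.inl h)) fun l h => hz (Or.inr ⟨z, ⟨l, h.symm⟩, rfl⟩)

/-! ### The differential equation for the residues -/

theorem ODE1.hasDerivWithinAt_conj (h1 : ODE1 k s U) (hU : IsRHFamily k H logF U)
    {b w : ℂ} (hb : b ∈ halfLine) (hw : ∀ x ∈ halfLine, w ∈ cutPlane k x)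
    (M : Matrix (Fin N) (Fin N) ℂ) (m n : Fin N) :
    HasDerivWithinAt (fun x => (U x w * M * (U x w)⁻¹) m n)
      ((∑ j, (w - (k j + b))⁻¹ • (s j b * (U b w * M * (U b w)⁻¹) -
        (U b w * M * (U b w)⁻¹) * s j b)) m n) halfLine b := by
  have := hasDerivWithinAt_matrix_conj (uniqueDiffWithinAt_halfLine hb) hb
    (h1 b hb w (hw b hb)) (fun x hx => hU.det_ne_zero x hx w (hw x hx)) M m n
  have e : (∑ j, (w - (k j + b))⁻¹ • (s j b * (U b w * M * (U b w)⁻¹) -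
        (U b w * M * (U b w)⁻¹) * s j b)) =
      (∑ j, (w - (k j + b))⁻¹ • s j b) * (U b w * M * (U b w)⁻¹) -
        (U b w * M * (U b w)⁻¹) * ∑ j, (w - (k j + b))⁻¹ • s j b := by
    rw [Finset.sum_mul, Finset.mul_sum, ← Finset.sum_sub_distrib]
    refine Finset.sum_congr rfl fun j _ => ?_
    rw [smul_sub, Matrix.smul_mul, Matrix.mul_smul]
  rw [e]
  exact this

theorem ODE1.ode2Differential (h1 : ODE1 k s U) (hU : IsRHFamily k H logF U)
    (hB : IsCommutingRational ε k H ρ t) : ODE2Differential k ρ s (conjResidue U ρ t) :=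
  fun l _ hb m n => h1.hasDerivWithinAt_conj hU hb
    (fun _ hx => hB.pole_mem_cutPlane hx l) (t l) m n

/-- As `U B U⁻¹` has no pole at `k_j + b`, the residue `s_j` there commutes with its value. -/
theorem ODE1.commute_residue (h1 : ODE1 k s U) (hU : IsRHFamily k H logF U)
    (hH : IsCoefficientFamily ε k H) (hB : IsCommutingRational ε k H ρ t)
    (hF : IsLogEigenvalues k H logF) {b : ℂ} (hb : b ∈ halfLine) (j : Fin p) :
    Commute (s j b) (simpleFractions ρ (fun l => conjResidue U ρ t l b) (k j + b)) := by
  set r' : Fin d → Matrix (Fin N) (Fin N) ℂ := fun l =>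
    ∑ j, (ρ l - (k j + b))⁻¹ • (s j b * conjResidue U ρ t l b - conjResidue U ρ t l b * s j b)
    with hr'
  set R : ℂ → Matrix (Fin N) (Fin N) ℂ := simpleFractions ρ (fun l => conjResidue U ρ t l b)
    with hR
  set V : Set ℂ := {z : ℂ | z.re ∉ (range fun j => (k j).re) ∪ re '' range ρ} with hV
  have hVd : Dense V := dense_re_notMem ((finite_range _).union ((finite_range ρ).image _))
  set a := k j + b with ha
  have haρ := hB.ne_pole (add_mem_openCut (a := k j) hb)
  have key : ∀ z ∈ V, ∑ j, (z - (k j + b))⁻¹ • (s j b * R z - R z * s j b) =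
      simpleFractions ρ r' z - 1 := by
    intro z hz
    have hzre : z.re ∉ (range fun j => (k j).re) := fun h => hz (Or.inl h)
    have hzρ : ∀ l, z ≠ ρ l := fun l h => hz (Or.inr ⟨z, ⟨l, h.symm⟩, rfl⟩)
    have hzC : ∀ x ∈ halfLine, z ∈ cutPlane k x := fun x hx => mem_cutPlane_of_re hx hzre
    have e : ∀ x ∈ halfLine, U x z * simpleFractions ρ t z * (U x z)⁻¹ =
        simpleFractions ρ (fun l => conjResidue U ρ t l x) z :=
      fun x hx => hU.conj_eq hH hB hF h1 hx (hzC x hx) hzρ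
    ext m n
    have hd1 := h1.hasDerivWithinAt_conj hU hb hzC (simpleFractions ρ t z) m n
    rw [e b hb] at hd1
    have hd2 : HasDerivWithinAt
        (fun x => simpleFractions ρ (fun l => conjResidue U ρ t l x) z m n)
        ((simpleFractions ρ r' z - 1) m n) halfLine b := by
      simp only [simpleFractions, add_sub_cancel_left, Matrix.add_apply, Matrix.sum_apply,
        Matrix.smul_apply, smul_eq_mul]
      exact (HasDerivWithinAt.fun_sum fun l _ =>
        (h1.ode2Differential hU hB l b hb m n).const_mul _).const_add _
    exact (uniqueDiffWithinAt_halfLine hb).eq_deriv _ hd1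
      (hd2.congr (fun x hx => by rw [e x hx]) (by rw [e b hb]))
  have hle : 𝓝[V] a ≤ 𝓝[≠] a := by
    refine nhdsWithin_mono _ fun z hz h => hz (Or.inl ⟨j, ?_⟩)
    rw [mem_singleton_iff.1 h, ha, add_re, hb.1, add_zero]
  have hne : (𝓝[V] a).NeBot := mem_closure_iff_nhdsWithin_neBot.1 (hVd a)
  have hainj : Function.Injective fun j => k j + b := fun i j h =>
    hH.re_injective (by simpa using congrArg re h)
  have hRa : Tendsto R (𝓝[V] a) (𝓝 (R a)) :=
    (continuousAt_simpleFractions _ haρ).tendsto.mono_left nhdsWithin_le_nhds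
  have hz0 : Tendsto (fun z => z - a) (𝓝[V] a) (𝓝 0) := by
    have := ((continuous_sub_right a).tendsto a).mono_left (nhdsWithin_le_nhds (s := V))
    rwa [sub_self] at this
  have hlA : Tendsto (fun z => (z - a) • ∑ j, (z - (k j + b))⁻¹ • s j b) (𝓝[V] a)
      (𝓝 (s j b)) := by
    have h2 := ((tendsto_sub_smul_simpleFractions hainj (fun j => s j b) j).mono_left hle).sub
      (hz0.smul_const (1 : Matrix (Fin N) (Fin N) ℂ))
    rw [zero_smul, sub_zero] at h2
    refine h2.congr fun z => ?_
    rw [← smul_sub, simpleFractions, add_sub_cancel_left]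
  have hl1 := (hlA.mul hRa).sub (hRa.mul hlA)
  have hl2 : Tendsto (fun z => (z - a) • (simpleFractions ρ r' z - 1)) (𝓝[V] a)
      (𝓝 ((0 : ℂ) • (simpleFractions ρ r' a - 1))) :=
    hz0.smul (((continuousAt_simpleFractions r' haρ).tendsto.mono_left
      nhdsWithin_le_nhds).sub_const _)
  rw [zero_smul] at hl2
  have := tendsto_nhds_unique (hl1.congr' ?_) hl2
  · exact sub_eq_zero.1 this
  · filter_upwards [self_mem_nhdsWithin] with z hz
    rw [← key z hz, Matrix.smul_mul, Matrix.mul_smul, ← smul_sub, Finset.sum_mul, Finset.mul_sum,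
      ← Finset.sum_sub_distrib]
    refine congrArg _ (Finset.sum_congr rfl fun i _ => ?_)
    rw [smul_sub, Matrix.smul_mul, Matrix.mul_smul]

/-! ### The values of the conjugated matrix at the ends of the cuts -/

theorem charpoly_conj {M P : Matrix (Fin N) (Fin N) ℂ} (hP : P.det ≠ 0) :
    (P * M * P⁻¹).charpoly = M.charpoly := by
  have hu : IsUnit P := (Matrix.isUnit_iff_isUnit_det P).2 hP.isUnit
  have := Matrix.charpoly_units_conj hu.unit M
  rw [← this]
  simp

theorem IsRHFamily.hasDistinctEigenvalues_iff (hU : IsRHFamily k H logF U)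
    (hH : IsCoefficientFamily ε k H) (hB : IsCommutingRational ε k H ρ t)
    (hF : IsLogEigenvalues k H logF) (h1 : ODE1 k s U) {b : ℂ} (hb : b ∈ halfLine) (j : Fin p) :
    HasDistinctEigenvalues (simpleFractions ρ (fun l => conjResidue U ρ t l b) (k j + b)) ↔
      HasDistinctEigenvalues (simpleFractions ρ t (k j + b)) := by
  set a := k j + b with ha
  have haρ := hB.ne_pole (add_mem_openCut (a := k j) hb)
  set V : Set ℂ := {z : ℂ | z.re ∉ (range fun j => (k j).re) ∪ re '' range ρ} with hV
  have hVd : Dense V := dense_re_notMem ((finite_range _).union ((finite_range ρ).image _))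
  have hne : (𝓝[V] a).NeBot := mem_closure_iff_nhdsWithin_neBot.1 (hVd a)
  have hl : ∀ r : Fin d → Matrix (Fin N) (Fin N) ℂ, Tendsto
      (fun z => matDisc (simpleFractions ρ r z)) (𝓝[V] a) (𝓝 (matDisc (simpleFractions ρ r a))) :=
    fun r => ((continuous_matDisc.tendsto _).comp
      (continuousAt_simpleFractions r haρ).tendsto).mono_left nhdsWithin_le_nhds
  have : matDisc (simpleFractions ρ t a) =
      matDisc (simpleFractions ρ (fun l => conjResidue U ρ t l b) a) := by
    refine tendsto_nhds_unique ((hl t).congr' ?_) (hl _)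
    filter_upwards [self_mem_nhdsWithin] with z hz
    have hzC : z ∈ cutPlane k b := mem_cutPlane_of_re hb fun h => hz (Or.inl h)
    rw [← hU.conj_eq hH hB hF h1 hb hzC fun l h => hz (Or.inr ⟨z, ⟨l, h.symm⟩, rfl⟩), matDisc,
      matDisc, charpoly_conj (hU.det_ne_zero b hb z hzC)]
  rw [hasDistinctEigenvalues_iff_matDisc_ne_zero, hasDistinctEigenvalues_iff_matDisc_ne_zero, this]

/-- `B` has multiple eigenvalues at finitely many points only. -/
theorem IsCommutingRational.finite_not_distinct (hB : IsCommutingRational ε k H ρ t) :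
    {w | (∀ l, w ≠ ρ l) ∧ ¬ HasDistinctEigenvalues (simpleFractions ρ t w)}.Finite := by
  classical
  -- clear the denominators
  set A : Matrix (Fin N) (Fin N) (Polynomial ℂ) :=
    (∏ l, (Polynomial.X - Polynomial.C (ρ l))) • (1 : Matrix (Fin N) (Fin N) (Polynomial ℂ)) +
      ∑ l, (∏ l' ∈ Finset.univ.erase l, (Polynomial.X - Polynomial.C (ρ l'))) •
        (t l).map Polynomial.C with hA
  have hAB : ∀ w, (∀ l, w ≠ ρ l) → (∏ l, (w - ρ l)) ≠ 0 ∧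
      A.map (Polynomial.evalRingHom w) = (∏ l, (w - ρ l)) • simpleFractions ρ t w := by
    intro w hw
    refine ⟨Finset.prod_ne_zero_iff.2 fun l _ => sub_ne_zero.2 (hw l), ?_⟩
    ext m n
    simp only [hA, simpleFractions, Matrix.map_apply, Matrix.add_apply, Matrix.smul_apply,
      Matrix.sum_apply, smul_eq_mul, Polynomial.coe_evalRingHom, Polynomial.eval_add,
      Polynomial.eval_mul, Polynomial.eval_finsetSum, Polynomial.eval_prod, Polynomial.eval_sub,
      Polynomial.eval_X, Polynomial.eval_C, mul_add]
    congr 1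
    · congr 1
      by_cases h : m = n <;> simp [h, Matrix.one_apply]
    · rw [Finset.mul_sum]
      refine Finset.sum_congr rfl fun l _ => ?_
      rw [← Finset.mul_prod_erase Finset.univ _ (Finset.mem_univ l)]
      field_simp [sub_ne_zero.2 (hw l)]
  have hiff : ∀ w, (∀ l, w ≠ ρ l) →
      (HasDistinctEigenvalues (simpleFractions ρ t w) ↔ (matDisc A).eval w ≠ 0) := by
    intro w hw
    obtain ⟨h0, h⟩ := hAB w hw
    have e : (matDisc A).eval w = matDisc ((∏ l, (w - ρ l)) • simpleFractions ρ t w) := by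
      rw [← h, matDisc_map]; rfl
    rw [e, ← hasDistinctEigenvalues_iff_matDisc_ne_zero]
    constructor
    · intro hd
      simpa using hd.one_add_smul h0 0
    · intro hd
      have := hd.one_add_smul (inv_ne_zero h0) 0
      rwa [zero_smul, zero_add, smul_smul, inv_mul_cancel₀ h0, one_smul] at this
  have hne : matDisc A ≠ 0 := by
    intro h
    obtain ⟨w, hw, hwρ⟩ := (hB.distinct.and (finite_ae_notMem (finite_range ρ))).exists
    exact (hiff w fun l hl => hwρ ⟨l, hl.symm⟩).1 hw (by rw [h, Polynomial.eval_zero])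
  refine (polynomial_finite_zeros hne).subset ?_
  rintro w ⟨hwρ, hw⟩
  rw [hiff w hwρ, not_not] at hw
  exact hw

theorem IsCommutingRational.finite_halfLine (hB : IsCommutingRational ε k H ρ t) (j : Fin p) :
    {b ∈ halfLine | ¬ HasDistinctEigenvalues (simpleFractions ρ t (k j + b))}.Finite := by
  refine Finite.of_finite_image (f := fun b => k j + b) (hB.finite_not_distinct.subset ?_)
    (add_right_injective _).injOn
  rintro _ ⟨b, ⟨hb, h⟩, rfl⟩
  exact ⟨hB.ne_pole (add_mem_openCut hb), h⟩

end Family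

/-! ### A scalar equation with a simple pole -/

/-- A continuous logarithm of a function with a non-zero limit is bounded. -/
theorem exists_bound_of_tendsto_exp {J : ℝ → ℂ} {δ : ℝ} (hδ : 0 < δ)
    (hJ : ContinuousOn J (Ioo 0 δ)) {c : ℂ} (hc : c ≠ 0)
    (h : Tendsto (fun x => exp (J x)) (𝓝[>] 0) (𝓝 c)) : ∃ C, ∀ᶠ x in 𝓝[>] 0, ‖J x‖ ≤ C := by
  set L := log c with hL
  have h1 : Tendsto (fun x => exp (J x - L)) (𝓝[>] 0) (𝓝 1) := by
    have := h.div_const c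
    rw [div_self hc] at this
    refine this.congr fun x => ?_
    rw [exp_sub, exp_log hc]
  have h2 : ∀ᶠ x in 𝓝[>] (0 : ℝ), exp (J x - L) ∈ slitPlane ∧ ‖log (exp (J x - L))‖ < 1 := by
    have hs : ∀ᶠ z in 𝓝 (1 : ℂ), z ∈ slitPlane := isOpen_slitPlane.mem_nhds one_mem_slitPlane
    have hl : ∀ᶠ z in 𝓝 (1 : ℂ), ‖log z‖ < 1 := by
      have := (continuousAt_clog one_mem_slitPlane).norm
      exact this.eventually_lt continuousAt_const (by simp)
    exact h1.eventually (hs.and hl)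
  obtain ⟨η, hη, hηs⟩ := mem_nhdsGT_iff_exists_Ioo_subset.1 (h2.and (Ioo_mem_nhdsGT hδ))
  have hη0 : (0 : ℝ) < η := hη
  set g : ℝ → ℂ := fun x => J x - L - log (exp (J x - L)) with hg
  have hgc : ContinuousOn g (Ioo 0 η) := by
    have hJ' : ContinuousOn J (Ioo 0 η) := hJ.mono fun x hx => (hηs hx).2
    refine (hJ'.sub continuousOn_const).sub (ContinuousOn.clog ?_ fun x hx => (hηs hx).1.1)
    exact (hJ'.sub continuousOn_const).cexp
  have hgexp : ∀ x, ∃ n : ℤ, g x = n * (2 * Real.pi * I) := fun x => by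
    rw [← exp_eq_one_iff, hg]
    simp only
    rw [exp_sub (J x - L), exp_log (exp_ne_zero _), div_self (exp_ne_zero _)]
  -- the continuous function `g` takes discrete values
  have hconst : ∀ x ∈ Ioo 0 η, g x = g (η / 2) := by
    intro x hx
    have hm : η / 2 ∈ Ioo 0 η := ⟨half_pos hη0, half_lt_self hη0⟩
    obtain ⟨n, hn⟩ := hgexp x
    obtain ⟨n', hn'⟩ := hgexp (η / 2)
    have him : ContinuousOn (fun x => (g x).im) (Ioo 0 η) := continuous_im.comp_continuousOn hgc
    have gim : ∀ (y : ℝ) (k : ℤ), g y = k * (2 * Real.pi * I) → (g y).im = k * (2 * Real.pi) := by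
      intro y k hy
      rw [hy]; simp
    have key : ∀ y ∈ Ioo 0 η, ∀ z ∈ Ioo 0 η, ∀ k l : ℤ, g y = k * (2 * Real.pi * I) →
        g z = l * (2 * Real.pi * I) → ¬ k < l := by
      intro y hy z hz k l hk hl hkl
      have hkl' : (k : ℝ) + 1 ≤ l := by exact_mod_cast hkl
      have hpi := Real.pi_pos
      have := isPreconnected_Ioo.intermediate_value hy hz him
        (show ((k : ℝ) + 1 / 2) * (2 * Real.pi) ∈ Icc (g y).im (g z).im by
          rw [gim y k hk, gim z l hl]
          constructor <;> nlinarith)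
      obtain ⟨v, -, hv⟩ := this
      obtain ⟨n, hn⟩ := hgexp v
      simp only at hv
      rw [gim v n hn] at hv
      have h3 : (n : ℝ) = k + 1 / 2 := mul_right_cancel₀ (by positivity) hv
      have h4 : ((2 * n : ℤ) : ℝ) = ((2 * k + 1 : ℤ) : ℝ) := by push_cast; linarith
      have h5 : (2 * n : ℤ) = 2 * k + 1 := by exact_mod_cast h4
      omega
    have : n = n' := le_antisymm (not_lt.1 (key _ hm _ hx n' n hn' hn))
      (not_lt.1 (key _ hx _ hm n n' hn hn'))
    rw [hn, hn', this]
  refine ⟨‖g (η / 2)‖ + 1 + ‖L‖, ?_⟩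
  filter_upwards [Ioo_mem_nhdsGT hη0] with x hx
  have e : J x = g (η / 2) + log (exp (J x - L)) + L := by
    rw [← hconst x hx, hg]; ring
  calc ‖J x‖ = ‖g (η / 2) + log (exp (J x - L)) + L‖ := by rw [← e]
    _ ≤ ‖g (η / 2)‖ + ‖log (exp (J x - L))‖ + ‖L‖ := norm_add₃_le
    _ ≤ _ := by gcongr; exact (hηs hx).1.2.le

theorem eq_mul_exp_integral {y α : ℝ → ℂ} {δ : ℝ} (hδ : 0 < δ)
    (hy : ∀ τ ∈ Icc 0 δ, HasDerivAt y (α τ * y τ) τ) (hα : ContinuousOn α (Icc 0 δ)) :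
    y δ = y 0 * exp (∫ τ in (0 : ℝ)..δ, α τ) := by
  set α' : ℝ → ℂ := IccExtend hδ.le ((Icc 0 δ).domRestrict α) with hα'
  have hc : Continuous α' := (continuousOn_iff_continuous_domRestrict.1 hα).Icc_extend'
  have he : ∀ τ ∈ Icc 0 δ, α' τ = α τ := fun τ hτ => by
    rw [hα', IccExtend_of_mem _ _ hτ]; rfl
  have hint : ∫ τ in (0 : ℝ)..δ, α τ = ∫ τ in (0 : ℝ)..δ, α' τ :=
    intervalIntegral.integral_congr fun τ hτ => by
      rw [uIcc_of_le hδ.le] at hτ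
      exact (he τ hτ).symm
  have hd : ∀ τ ∈ Icc 0 δ, HasDerivAt (fun τ => y τ * exp (-∫ σ in (0 : ℝ)..τ, α' σ)) 0 τ := by
    intro τ hτ
    have h1 : HasDerivAt (fun τ => ∫ σ in (0 : ℝ)..τ, α' σ) (α' τ) τ :=
      intervalIntegral.integral_hasDerivAt_right (hc.intervalIntegrable _ _)
        (hc.stronglyMeasurableAtFilter _ _) hc.continuousAt
    have h2 := (hy τ hτ).mul h1.neg.cexp
    rw [he τ hτ] at h2
    convert! h2 using 1
    ring
  have hconst := constant_of_has_deriv_right_zero (f := fun τ => y τ * exp (-∫ σ in (0 : ℝ)..τ, α' σ))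
    (a := 0) (b := δ) (fun τ hτ => (hd τ hτ).continuousAt.continuousWithinAt)
    (fun τ hτ => (hd τ ⟨hτ.1, hτ.2.le⟩).hasDerivWithinAt) δ ⟨hδ.le, le_rfl⟩
  simp only [intervalIntegral.integral_same, neg_zero, exp_zero, mul_one] at hconst
  rw [hint, ← hconst, mul_assoc, ← exp_add, neg_add_cancel, exp_zero, mul_one]

theorem continuousOn_parametric_integral {α : ℝ → ℝ → ℂ} {δ : ℝ} (hδ : 0 < δ) {s : Set ℝ}
    (hs : IsOpen s) (hα : ContinuousOn (Function.uncurry α) (Icc 0 δ ×ˢ s)) :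
    ContinuousOn (fun x => ∫ τ in (0 : ℝ)..δ, α τ x) s := by
  rw [continuousOn_iff_continuous_domRestrict]
  have hloc : LocallyCompactSpace s := hs.locallyCompactSpace
  set f : s → ℝ → ℂ := fun x τ => α (projIcc 0 δ hδ.le τ) x with hf
  have hfc : Continuous (Function.uncurry f) := by
    have : Continuous fun z : s × ℝ => (((projIcc 0 δ hδ.le z.2 : Icc 0 δ) : ℝ), (z.1 : ℝ)) :=
      (continuous_subtype_val.comp (continuous_projIcc.comp continuous_snd)).prodMk
        (continuous_subtype_val.comp continuous_fst)
    exact hα.comp_continuous this fun z => ⟨Subtype.coe_prop _, z.1.2⟩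
  have := intervalIntegral.continuous_parametric_intervalIntegral_of_continuous'
    (μ := MeasureTheory.volume) hfc 0 δ
  refine this.congr fun x => ?_
  refine intervalIntegral.integral_congr fun τ hτ => ?_
  rw [uIcc_of_le hδ.le] at hτ
  simp only [hf, projIcc_of_mem hδ.le hτ]

theorem integral_I_div (x δ : ℝ) (hx : 0 < x) :
    ∫ τ in (0 : ℝ)..δ, I / ((x : ℂ) - τ * I) = log x - log (x - δ * I) := by
  have hs : ∀ τ : ℝ, (x : ℂ) - τ * I ∈ slitPlane := fun τ => Or.inl (by simpa using hx)
  have h1 : ∀ τ ∈ uIcc 0 δ, HasDerivAt (fun τ : ℝ => -log ((x : ℂ) - τ * I))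
      (I / ((x : ℂ) - τ * I)) τ := by
    intro τ _
    have h2 : HasDerivAt (fun τ : ℝ => (x : ℂ) - τ * I) (-I) τ := by
      have := ((hasDerivAt_id τ).ofReal_comp.mul_const I).const_sub (x : ℂ)
      simpa using this
    have := (h2.clog_real (hs τ)).neg
    convert! this using 1
    rw [neg_div, neg_neg]
  have hc : Continuous fun τ : ℝ => I / ((x : ℂ) - τ * I) := by
    refine continuous_const.div (by fun_prop) fun τ => slitPlane_ne_zero (hs τ)
  rw [intervalIntegral.integral_eq_sub_of_hasDerivAt h1 (hc.intervalIntegrable _ _)]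
  simp only [ofReal_zero, zero_mul, sub_zero]
  ring

theorem integral_inv_add (x δ : ℝ) (hx : 0 < x) (hδ : 0 < δ) :
    ∫ τ in (0 : ℝ)..δ, (x + τ)⁻¹ = Real.log (x + δ) - Real.log x := by
  have h1 : ∀ τ ∈ uIcc 0 δ, HasDerivAt (fun τ : ℝ => Real.log (x + τ)) (x + τ)⁻¹ τ := by
    intro τ hτ
    rw [uIcc_of_le hδ.le] at hτ
    have := ((hasDerivAt_id τ).const_add x).log (by simp only [id]; linarith [hτ.1])
    simpa using this
  have hc : ContinuousOn (fun τ : ℝ => (x + τ)⁻¹) (uIcc 0 δ) := by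
    refine ContinuousOn.inv₀ (by fun_prop) fun τ hτ => ?_
    rw [uIcc_of_le hδ.le] at hτ
    linarith [hτ.1]
  rw [intervalIntegral.integral_eq_sub_of_hasDerivAt h1 hc.intervalIntegrable]
  simp

/-- The integral along the half-line of a function with a simple pole at `τ = -i x` of residue
close to `n₀` diverges as `n₀ log x`. -/
theorem tendsto_integral_div_log {α : ℝ → ℝ → ℂ} {δ : ℝ} (hδ : 0 < δ) {n₀ : ℂ}
    (hc : ∀ x ∈ Ioo 0 δ, ContinuousOn (fun τ => α τ x) (Icc 0 δ))
    (hα : ∀ ε > 0, ∃ η > 0, ∃ C, ∀ x ∈ Ioo 0 η, ∀ τ ∈ Icc 0 δ,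
      ‖α τ x - n₀ / ((x : ℂ) - τ * I)‖ ≤ ε * (x + τ)⁻¹ + C) :
    Tendsto (fun x => (∫ τ in (0 : ℝ)..δ, I * α τ x) / Real.log x) (𝓝[>] 0) (𝓝 n₀) := by
  have hlog : Tendsto (fun x : ℝ => ‖(Real.log x : ℂ)‖) (𝓝[>] 0) atTop := by
    simp only [norm_real, Real.norm_eq_abs]
    exact tendsto_abs_atBot_atTop.comp Real.tendsto_log_nhdsGT_zero
  have hlog' : ∀ c : ℝ, ∀ᶠ x : ℝ in 𝓝[>] 0, c ≤ ‖(Real.log x : ℂ)‖ := fun c =>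
    hlog.eventually_ge_atTop c
  rw [Metric.tendsto_nhds]
  intro ε hε
  obtain ⟨η, hη, C, hC⟩ := hα (ε / 4) (by positivity)
  set D : ℝ := (ε / 4) * |Real.log (δ + δ)| + |C| * δ + ‖n₀‖ * (|Real.log (δ + δ)| +
    |Real.log δ| + Real.pi) with hD
  have hm : Ioo 0 (min (min η δ) 1) ∈ 𝓝[>] (0 : ℝ) :=
    Ioo_mem_nhdsGT (lt_min (lt_min hη hδ) one_pos)
  filter_upwards [hlog' (4 * (D + 1) / ε), hlog' 1, hm] with x hxD hx1 hx
  have hx0 : 0 < x := hx.1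
  have hxη : x < η := hx.2.trans_le ((min_le_left _ _).trans (min_le_left _ _))
  have hxδ : x < δ := hx.2.trans_le ((min_le_left _ _).trans (min_le_right _ _))
  have hxone : x < 1 := hx.2.trans_le (min_le_right _ _)
  set Λ := ‖(Real.log x : ℂ)‖ with hΛ
  have hΛlog : Λ = -Real.log x := by
    rw [hΛ, norm_real, Real.norm_eq_abs, abs_of_neg (Real.log_neg hx0 hxone)]
  have hΛpos : 0 < Λ := by linarith
  have hlx : (Real.log x : ℂ) ≠ 0 := norm_pos_iff.1 hΛpos
  have hs : ∀ τ : ℝ, (x : ℂ) - τ * I ≠ 0 := fun τ h => hx0.ne' (by simpa using congrArg re h)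
  have hcα := hc x ⟨hx0, hxδ⟩
  have i1 : IntervalIntegrable (fun τ => I * α τ x) MeasureTheory.volume 0 δ := by
    refine ContinuousOn.intervalIntegrable ?_
    rw [uIcc_of_le hδ.le]
    exact continuousOn_const.mul hcα
  have i2 : IntervalIntegrable (fun τ : ℝ => n₀ * (I / ((x : ℂ) - τ * I)))
      MeasureTheory.volume 0 δ :=
    Continuous.intervalIntegrable (continuous_const.mul (continuous_const.div (by fun_prop) hs)) _ _
  have hi3 : ContinuousOn (fun τ : ℝ => (x + τ)⁻¹) (uIcc 0 δ) := by
    refine ContinuousOn.inv₀ (by fun_prop) fun τ hτ => ?_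
    rw [uIcc_of_le hδ.le] at hτ
    linarith [hτ.1]
  have i3 : IntervalIntegrable (fun τ : ℝ => (ε / 4) * (x + τ)⁻¹ + C) MeasureTheory.volume 0 δ :=
    ((continuousOn_const.mul hi3).add continuousOn_const).intervalIntegrable
  have hdiff : ‖(∫ τ in (0 : ℝ)..δ, I * α τ x) - n₀ * (log x - log (x - δ * I))‖ ≤
      (ε / 4) * (Real.log (x + δ) - Real.log x) + C * δ := by
    rw [← integral_I_div x δ hx0, ← intervalIntegral.integral_const_mul,
      ← intervalIntegral.integral_sub i1 i2]
    refine (intervalIntegral.norm_integral_le_of_norm_le hδ.le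
      (MeasureTheory.ae_of_all _ fun τ hτ => ?_) i3).trans (le_of_eq ?_)
    · have : I * α τ x - n₀ * (I / ((x : ℂ) - τ * I)) = I * (α τ x - n₀ / ((x : ℂ) - τ * I)) := by
        ring
      rw [this, norm_mul, norm_I, one_mul]
      exact hC x ⟨hx0, hxη⟩ τ ⟨hτ.1.le, hτ.2⟩
    · rw [intervalIntegral.integral_add, intervalIntegral.integral_const_mul,
        integral_inv_add x δ hx0 hδ, intervalIntegral.integral_const]
      · simp [mul_comm]
      · exact (continuousOn_const.mul hi3).intervalIntegrable
      · exact intervalIntegrable_const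
  -- the logarithms that stay bounded
  have hb1 : Real.log (x + δ) ≤ |Real.log (δ + δ)| :=
    (Real.log_le_log (by linarith) (by linarith)).trans (le_abs_self _)
  have hb2 : ‖log ((x : ℂ) - δ * I)‖ ≤ |Real.log (δ + δ)| + |Real.log δ| + Real.pi := by
    have hn1 : δ ≤ ‖(x : ℂ) - δ * I‖ := by
      have := abs_im_le_norm ((x : ℂ) - δ * I)
      simpa [abs_of_pos hδ] using this
    have hn2 : ‖(x : ℂ) - δ * I‖ ≤ δ + δ := by
      refine (norm_sub_le _ _).trans ?_
      rw [norm_real, norm_mul, norm_I, norm_real, mul_one, Real.norm_eq_abs, Real.norm_eq_abs,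
        abs_of_pos hδ, abs_of_pos hx0]
      linarith
    have hre : |(log ((x : ℂ) - δ * I)).re| ≤ |Real.log (δ + δ)| + |Real.log δ| := by
      rw [log_re, abs_le]
      constructor
      · have := Real.log_le_log hδ hn1
        linarith [neg_abs_le (Real.log δ), abs_nonneg (Real.log (δ + δ))]
      · have := Real.log_le_log (hδ.trans_le hn1) hn2
        linarith [le_abs_self (Real.log (δ + δ)), abs_nonneg (Real.log δ)]
    have him : |(log ((x : ℂ) - δ * I)).im| ≤ Real.pi := by
      rw [log_im]; exact abs_arg_le_pi _
    exact (norm_le_abs_re_add_abs_im _).trans (add_le_add hre him)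
  have hx' : log (x : ℂ) = (Real.log x : ℂ) := (ofReal_log hx0.le).symm
  have htot : ‖(∫ τ in (0 : ℝ)..δ, I * α τ x) - n₀ * (Real.log x : ℂ)‖ ≤ (ε / 4) * Λ + D := by
    have e : (∫ τ in (0 : ℝ)..δ, I * α τ x) - n₀ * (Real.log x : ℂ) =
        ((∫ τ in (0 : ℝ)..δ, I * α τ x) - n₀ * (log x - log (x - δ * I))) -
          n₀ * log (x - δ * I) := by rw [hx']; ring
    rw [e]
    refine (norm_sub_le _ _).trans ?_
    rw [norm_mul n₀]
    have h3 := mul_le_mul_of_nonneg_left hb2 (norm_nonneg n₀)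
    have h4 : C * δ ≤ |C| * δ := mul_le_mul_of_nonneg_right (le_abs_self C) hδ.le
    have h5 := mul_le_mul_of_nonneg_left hb1 (by positivity : 0 ≤ ε / 4)
    rw [hD, hΛlog]
    nlinarith
  have hDΛ : D + 1 ≤ ε / 4 * Λ := by
    rw [div_le_iff₀ hε] at hxD
    linarith
  rw [dist_eq_norm]
  have e2 : (∫ τ in (0 : ℝ)..δ, I * α τ x) / (Real.log x : ℂ) - n₀ =
      ((∫ τ in (0 : ℝ)..δ, I * α τ x) - n₀ * (Real.log x : ℂ)) / (Real.log x : ℂ) := by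
    rw [sub_div, mul_div_cancel_right₀ _ hlx]
  rw [e2, norm_div, div_lt_iff₀ hΛpos]
  nlinarith

/-- If a solution of `∂y/∂τ = i α y`, where `α` has a simple pole with residue `n₀` at `x = iτ`,
behaves as `x ^ (-e)` for `τ = 0` and has a non-zero limit for some `τ > 0`, then `n₀ = e`. -/
theorem residue_eq_exponent {y α : ℝ → ℝ → ℂ} {δ : ℝ} (hδ : 0 < δ) {n₀ e c₀ c₁ : ℂ}
    (hy : ∀ x ∈ Ioo 0 δ, ∀ τ ∈ Icc 0 δ, HasDerivAt (fun τ => y τ x) (I * α τ x * y τ x) τ)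
    (hc : ContinuousOn (Function.uncurry α) (Icc 0 δ ×ˢ Ioo 0 δ))
    (hα : ∀ ε > 0, ∃ η > 0, ∃ C, ∀ x ∈ Ioo 0 η, ∀ τ ∈ Icc 0 δ,
      ‖α τ x - n₀ / ((x : ℂ) - τ * I)‖ ≤ ε * (x + τ)⁻¹ + C)
    (h₀ : Tendsto (fun x : ℝ => y 0 x * exp (e * Real.log x)) (𝓝[>] 0) (𝓝 c₀)) (hc₀ : c₀ ≠ 0)
    (h₁ : Tendsto (fun x : ℝ => y δ x) (𝓝[>] 0) (𝓝 c₁)) (hc₁ : c₁ ≠ 0) : n₀ = e := by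
  have hcx : ∀ x ∈ Ioo 0 δ, ContinuousOn (fun τ => α τ x) (Icc 0 δ) := fun x hx =>
    hc.comp (f := fun τ => (τ, x)) (by fun_prop) fun τ hτ => ⟨hτ, hx⟩
  set J : ℝ → ℂ := fun x => ∫ τ in (0 : ℝ)..δ, I * α τ x with hJ
  have hJc : ContinuousOn (fun x => J x - e * Real.log x) (Ioo 0 δ) := by
    refine ContinuousOn.sub ?_ (continuousOn_const.mul ?_)
    · exact continuousOn_parametric_integral (α := fun τ x => I * α τ x) hδ isOpen_Ioo
        (continuousOn_const.mul hc)
    · exact continuous_ofReal.comp_continuousOn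
        (Real.continuousOn_log.mono fun x hx => hx.1.ne')
  have hsol : ∀ x ∈ Ioo 0 δ, y δ x = y 0 x * exp (J x) := fun x hx =>
    eq_mul_exp_integral hδ (hy x hx) (continuousOn_const.mul (hcx x hx))
  have hexp : Tendsto (fun x => exp (J x - e * Real.log x)) (𝓝[>] 0) (𝓝 (c₁ / c₀)) := by
    refine (h₁.div h₀ hc₀).congr' ?_
    filter_upwards [Ioo_mem_nhdsGT hδ, h₀.eventually_ne hc₀] with x hx hne
    have hy0 : y 0 x ≠ 0 := left_ne_zero_of_mul hne
    rw [Pi.div_apply, hsol x hx, exp_sub]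
    field_simp
  obtain ⟨C, hC⟩ := exists_bound_of_tendsto_exp hδ hJc (div_ne_zero hc₁ hc₀) hexp
  have hlog : Tendsto (fun x : ℝ => ‖(Real.log x : ℂ)‖) (𝓝[>] 0) atTop := by
    simp only [norm_real, Real.norm_eq_abs]
    exact tendsto_abs_atBot_atTop.comp Real.tendsto_log_nhdsGT_zero
  have hz : Tendsto (fun x => (J x - e * Real.log x) / (Real.log x : ℂ)) (𝓝[>] 0) (𝓝 0) := by
    refine squeeze_zero_norm' (a := fun x : ℝ => C / ‖(Real.log x : ℂ)‖) ?_
      (hlog.const_div_atTop C)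
    filter_upwards [hC] with x hx
    rw [norm_div]
    gcongr
  have hn : Tendsto (fun x => (J x - e * Real.log x) / (Real.log x : ℂ)) (𝓝[>] 0)
      (𝓝 (n₀ - e)) := by
    refine ((tendsto_integral_div_log hδ hcx hα).sub_const e).congr' ?_
    filter_upwards [hlog.eventually_gt_atTop 0] with x hx
    rw [sub_div, mul_div_cancel_right₀ _ (norm_pos_iff.1 hx)]
  exact sub_eq_zero.1 (tendsto_nhds_unique hn hz)

/-! ### The eigenvalues of the residues -/

/-- The adjugate of `M - d_i` is, up to a factor, the projection onto the `i`-th eigenvector. -/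
theorem adjugate_conj_diagonal_sub {N : ℕ} {W : Matrix (Fin N) (Fin N) ℂ} (hW : W.det ≠ 0)
    (d : Fin N → ℂ) (i : Fin N) :
    (W * Matrix.diagonal d * W⁻¹ - d i • (1 : Matrix (Fin N) (Fin N) ℂ)).adjugate =
      W * Matrix.diagonal (Pi.single i (∏ m ∈ Finset.univ.erase i, (d m - d i))) * W⁻¹ := by
  have h1 : W * Matrix.diagonal d * W⁻¹ - d i • (1 : Matrix (Fin N) (Fin N) ℂ) =
      W * Matrix.diagonal (fun m => d m - d i) * W⁻¹ := by
    have : Matrix.diagonal (fun m => d m - d i) =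
        Matrix.diagonal d - d i • (1 : Matrix (Fin N) (Fin N) ℂ) := by
      ext m n
      by_cases h : m = n <;> simp [h]
    rw [this, Matrix.mul_sub, Matrix.sub_mul, Matrix.mul_smul, Matrix.mul_one, Matrix.smul_mul,
      Matrix.mul_nonsing_inv _ hW.isUnit]
  have h2 : W.adjugate = W.det • W⁻¹ := by
    rw [Matrix.inv_def, smul_smul, Ring.inverse_eq_inv', mul_inv_cancel₀ hW, one_smul]
  have h3 : W⁻¹.adjugate = (W.det)⁻¹ • W := by
    have hW' : W⁻¹.det ≠ 0 := by
      rw [Matrix.det_nonsing_inv, Ring.inverse_eq_inv']; exact inv_ne_zero hW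
    have : W⁻¹.adjugate = W⁻¹.det • W⁻¹⁻¹ := by
      rw [Matrix.inv_def W⁻¹, smul_smul, Ring.inverse_eq_inv', mul_inv_cancel₀ hW', one_smul]
    rw [this, Matrix.nonsing_inv_nonsing_inv _ hW.isUnit, Matrix.det_nonsing_inv,
      Ring.inverse_eq_inv']
  rw [h1, Matrix.adjugate_mul_distrib, Matrix.adjugate_mul_distrib, h2, h3,
    Matrix.adjugate_diagonal, Matrix.smul_mul, Matrix.mul_smul, Matrix.mul_smul, smul_smul,
    inv_mul_cancel₀ hW, one_smul, ← Matrix.mul_assoc]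
  congr 3
  ext m
  by_cases h : m = i
  · rw [h, Pi.single_eq_same]
  · rw [Pi.single_eq_of_ne h]
    exact Finset.prod_eq_zero (Finset.mem_erase.2 ⟨Ne.symm h, Finset.mem_univ i⟩) (sub_self _)

/-- The `i`-th column of `W diag(0, …, c, …, 0) W⁻¹ K` is proportional to that of `W`. -/
theorem mul_conj_single_mul_apply {N : ℕ} (L W K : Matrix (Fin N) (Fin N) ℂ) (i : Fin N) (c : ℂ) :
    (L * (W * Matrix.diagonal (Pi.single i c) * W⁻¹ * K)) i i =
      c * (W⁻¹ * K) i i * (L * W) i i := by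
  rw [Matrix.mul_assoc (W * _), Matrix.mul_assoc W, ← Matrix.mul_assoc L, Matrix.mul_apply,
    Finset.sum_eq_single i]
  · rw [Matrix.diagonal_mul, Pi.single_eq_same]; ring
  · intro m _ hm
    rw [Matrix.diagonal_mul, Pi.single_eq_of_ne hm]; ring
  · simp

/-- If the coefficient `g` of a simple pole at `x = iτ` is continuous up to the corner `(0, 0)`, it
may be replaced by its value there, at the cost of a small multiple of `1 / (x + τ)` and a bounded
term. -/
theorem pole_estimate {g m : ℝ × ℝ → ℂ} {δ : ℝ} (hδ : 0 < δ)
    (hg : ContinuousOn g (Icc 0 δ ×ˢ Icc 0 δ)) (hm : ContinuousOn m (Icc 0 δ ×ˢ Icc 0 δ))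
    {ε : ℝ} (hε : 0 < ε) : ∃ η > 0, ∃ C, ∀ x ∈ Ioo 0 η, ∀ τ ∈ Icc 0 δ,
      ‖g (τ, x) / ((x : ℂ) - τ * I) + m (τ, x) - g (0, 0) / ((x : ℂ) - τ * I)‖ ≤
        ε * (x + τ)⁻¹ + C := by
  have hcomp : IsCompact (Icc 0 δ ×ˢ Icc 0 δ : Set (ℝ × ℝ)) := isCompact_Icc.prod isCompact_Icc
  obtain ⟨G, hG⟩ := hcomp.exists_bound_of_continuousOn (hg.sub (continuousOn_const (c := g (0, 0))))
  obtain ⟨C₁, hC₁⟩ := hcomp.exists_bound_of_continuousOn hm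
  have h00 : ((0 : ℝ), (0 : ℝ)) ∈ (Icc 0 δ ×ˢ Icc 0 δ : Set (ℝ × ℝ)) :=
    ⟨⟨le_rfl, hδ.le⟩, ⟨le_rfl, hδ.le⟩⟩
  obtain ⟨r, hr, hrg⟩ := Metric.continuousWithinAt_iff.1 (hg _ h00) (ε / 2) (half_pos hε)
  have hG0 : 0 ≤ G := (norm_nonneg _).trans (hG _ h00)
  refine ⟨min δ r, lt_min hδ hr, G / r + C₁, fun x hx τ hτ => ?_⟩
  have hx0 : 0 < x := hx.1
  have hxδ : x < δ := hx.2.trans_le (min_le_left _ _)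
  have hxr : x < r := hx.2.trans_le (min_le_right _ _)
  have hq : (τ, x) ∈ (Icc 0 δ ×ˢ Icc 0 δ : Set (ℝ × ℝ)) := ⟨hτ, hx0.le, hxδ.le⟩
  have hre : x ≤ ‖(x : ℂ) - τ * I‖ := by
    have := abs_re_le_norm ((x : ℂ) - τ * I)
    simpa [abs_of_pos hx0] using this
  have him : τ ≤ ‖(x : ℂ) - τ * I‖ := by
    have := abs_im_le_norm ((x : ℂ) - τ * I)
    simpa [abs_of_nonneg hτ.1] using this
  have hpos : 0 < ‖(x : ℂ) - τ * I‖ := hx0.trans_le hre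
  have hsum : 0 < x + τ := by linarith [hτ.1]
  have e : g (τ, x) / ((x : ℂ) - τ * I) + m (τ, x) - g (0, 0) / ((x : ℂ) - τ * I) =
      (g (τ, x) - g (0, 0)) / ((x : ℂ) - τ * I) + m (τ, x) := by ring
  rw [e]
  refine (norm_add_le _ _).trans ?_
  have key : ‖(g (τ, x) - g (0, 0)) / ((x : ℂ) - τ * I)‖ ≤ ε * (x + τ)⁻¹ + G / r := by
    rw [norm_div]
    rcases lt_or_ge τ r with h | h
    · have h1 : ‖g (τ, x) - g (0, 0)‖ ≤ ε / 2 := by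
        rw [← dist_eq_norm]
        refine (hrg hq ?_).le
        rw [Prod.dist_eq, Real.dist_eq, Real.dist_eq, sub_zero, sub_zero, abs_of_nonneg hτ.1,
          abs_of_pos hx0]
        exact max_lt h hxr
      have h2 : ‖g (τ, x) - g (0, 0)‖ / ‖(x : ℂ) - τ * I‖ ≤ ε * (x + τ)⁻¹ := by
        rw [div_le_iff₀ hpos, mul_assoc, inv_mul_eq_div, ← mul_div_assoc, le_div_iff₀ hsum]
        nlinarith [norm_nonneg (g (τ, x) - g (0, 0))]
      have h3 : 0 ≤ G / r := by positivity
      linarith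
    · have h1 : ‖g (τ, x) - g (0, 0)‖ / ‖(x : ℂ) - τ * I‖ ≤ G / r :=
        div_le_div₀ hG0 (hG _ hq) hr (h.trans him)
      have h2 : 0 ≤ ε * (x + τ)⁻¹ := by positivity
      linarith
  linarith [hC₁ _ hq]

theorem upLog_ofReal {x : ℝ} (hx : 0 < x) : upLog x = Real.log x := by
  rw [upLog, mul_comm, log_ofReal_mul hx I_ne_zero, add_sub_cancel_right]

section Family

variable {p N d : ℕ} {ε : ℝ} {k : Fin p → ℂ} {H : Fin p → ℂ → Matrix (Fin N) (Fin N) ℂ}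
  {logF : Fin p → ℂ → Fin N → ℂ} {U : ℂ → ℂ → Matrix (Fin N) (Fin N) ℂ}
  {s : Fin p → ℂ → Matrix (Fin N) (Fin N) ℂ}
  {ρ : Fin d → ℂ} {t : Fin d → Matrix (Fin N) (Fin N) ℂ}

theorem add_mul_I_mem_halfLine {b : ℂ} {τ : ℝ} (hb : b ∈ halfLine) (hτ : -b.im < τ) :
    b + τ * I ∈ halfLine := by
  refine ⟨by simpa using hb.1, ?_⟩
  simp only [add_im, mul_im, ofReal_re, I_im, mul_one, ofReal_im, I_re, mul_zero, add_zero]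
  linarith

/-- ODE1 along the parametrization `τ ↦ b + iτ` of the half-line. -/
theorem ODE1.hasDerivAt_ray (h1 : ODE1 k s U) {b w : ℂ} {τ : ℝ} (hb : b ∈ halfLine)
    (hτ : -b.im < τ) (hw : w ∈ cutPlane k (b + τ * I)) (L P : Matrix (Fin N) (Fin N) ℂ)
    (m n : Fin N) :
    HasDerivAt (fun τ : ℝ => (L * (U (b + τ * I) w * P)) m n)
      (I * (L * ((∑ j, (w - (k j + (b + τ * I)))⁻¹ • s j (b + τ * I)) *
        (U (b + τ * I) w * P))) m n) τ := by
  set b' := b + τ * I with hb'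
  have hb'h : b' ∈ halfLine := add_mul_I_mem_halfLine hb hτ
  set A := ∑ j, (w - (k j + b'))⁻¹ • s j b' with hA
  have hγ : HasDerivAt (fun τ : ℝ => b + τ * I) I τ := by
    have := ((hasDerivAt_id τ).ofReal_comp.mul_const I).const_add b
    simpa using this
  have hU : ∀ m n, HasDerivAt (fun τ : ℝ => U (b + τ * I) w m n) (I * (A * U b' w) m n) τ := by
    intro m n
    have h := HasDerivWithinAt.scomp (𝕜 := ℝ) (h := fun τ : ℝ => b + τ * I) (s := Ioi (-b.im)) τ
      (h1 b' hb'h w hw m n) hγ.hasDerivWithinAt (fun σ hσ => add_mul_I_mem_halfLine hb hσ)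
    exact h.hasDerivAt (Ioi_mem_nhds hτ)
  have hexp : ∀ M : Matrix (Fin N) (Fin N) ℂ, (L * (M * P)) m n =
      ∑ x, L m x * ∑ y, M x y * P y n := fun M => by
    simp only [Matrix.mul_apply]
  rw [← Matrix.mul_assoc A]
  simp only [hexp]
  rw [Finset.mul_sum]
  refine HasDerivAt.fun_sum fun x _ => ?_
  have h2 := (HasDerivAt.fun_sum (u := Finset.univ)
    fun y _ => (hU x y).mul_const (P y n)).const_mul (L m x)
  convert! h2 using 1
  simp only [mul_assoc]
  rw [← Finset.mul_sum]
  ring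

/-- At a generic `b` the eigenvectors of `s_j` are those of `U B U⁻¹` at `k_j + b`, and its
eigenvalues are read off from the singularity of `U` there: along the `i`-th eigenvector ODE1 is
a scalar equation `∂y/∂τ = i α y` in `b = b₀ + iτ`, where `α` has a simple pole whose residue at
the corner is the `i`-th eigenvalue of `s_j(b₀)`, while `y` behaves as a power for `τ = 0` and is
regular for `τ > 0`. -/
theorem ODE1.residue_eq_conj_diagonal (h1 : ODE1 k s U) (hs : ∀ j, ContinuousOn (s j) halfLine)
    (hU : IsRHFamily k H logF U)
    (hH : IsCoefficientFamily ε k H) (hB : IsCommutingRational ε k H ρ t)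
    (hF : IsLogEigenvalues k H logF) {b : ℂ} (hb : b ∈ halfLine) {j : Fin p}
    (hHd : HasDistinctEigenvalues (H j (k j + b)))
    (hBd : HasDistinctEigenvalues (simpleFractions ρ t (k j + b))) :
    ∃ K : Matrix (Fin N) (Fin N) ℂ, K.det ≠ 0 ∧
      s j b = K * Matrix.diagonal (fun m => -(logF j b m / (2 * Real.pi * I))) * K⁻¹ := by
  obtain ⟨P, β, K, hPc, hPdet, hK, hβc, hBP, hlim, hconj⟩ :=
    hU.exists_endpoint_frame hH hB hF hb hHd
  refine ⟨K, hK, ?_⟩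
  set a := k j + b with ha
  have haC : a ∈ openCut (k j) := add_mem_openCut hb
  have haρ := hB.ne_pole haC
  have hare : a.re = (k j).re := by rw [ha, add_re, hb.1, add_zero]
  set R : ℂ → ℂ → Matrix (Fin N) (Fin N) ℂ :=
    fun b' w => simpleFractions ρ (fun l => conjResidue U ρ t l b') w with hR
  -- a neighbourhood of `a`
  have hgood : ∀ᶠ w in 𝓝 a, ContinuousAt P w ∧ ContinuousAt β w ∧
      simpleFractions ρ t w * P w = P w * Matrix.diagonal (β w) ∧ (P w).det ≠ 0 ∧
      (∀ l, w ≠ ρ l) ∧ ∀ j', j' ≠ j → w.re ≠ (k j').re := by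
    have h2 : ∀ᶠ w in 𝓝 a, (P w).det ≠ 0 :=
      (((continuous_id.matrix_det).continuousAt (x := P a)).comp
        hPc.self_of_nhds).eventually_ne hPdet
    have h3 : ∀ᶠ w in 𝓝 a, ∀ l, w ≠ ρ l :=
      eventually_all.2 fun l => isOpen_ne.mem_nhds (haρ l)
    have h4 : ∀ᶠ w in 𝓝 a, ∀ j', j' ≠ j → w.re ≠ (k j').re := by
      refine eventually_all.2 fun j' => ?_
      by_cases h : j' = j
      · simp [h]
      · have := continuous_re.continuousAt.eventually_ne (x := a) (y := (k j').re)
          (by rw [hare]; exact fun e => h (hH.re_injective e).symm)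
        filter_upwards [this] with w hw _ using hw
    filter_upwards [hPc, hβc, hBP, h2, h3, h4] with w h5 h6 h7 h8 h9 h10
      using ⟨h5, h6, h7, h8, h9, h10⟩
  obtain ⟨δ₀, hδ₀, hgood⟩ : ∃ δ₀ > 0, ∀ x ∈ Icc 0 δ₀, ContinuousAt P (a + (x : ℝ)) ∧
      ContinuousAt β (a + (x : ℝ)) ∧
      simpleFractions ρ t (a + (x : ℝ)) * P (a + (x : ℝ)) =
        P (a + (x : ℝ)) * Matrix.diagonal (β (a + (x : ℝ))) ∧ (P (a + (x : ℝ))).det ≠ 0 ∧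
      (∀ l, a + (x : ℝ) ≠ ρ l) ∧ ∀ j', j' ≠ j → (a + (x : ℝ)).re ≠ (k j').re := by
    obtain ⟨r, hr, hball⟩ := Metric.eventually_nhds_iff_ball.1 hgood
    refine ⟨r / 2, half_pos hr, fun x hx => hball _ ?_⟩
    rw [Metric.mem_ball, dist_eq_norm, add_sub_cancel_left, norm_real, Real.norm_eq_abs,
      abs_of_nonneg hx.1]
    linarith [hx.2]
  have hγ : ∀ τ : ℝ, 0 ≤ τ → b + τ * I ∈ halfLine := fun τ hτ =>
    add_mul_I_mem_halfLine hb (by linarith [hb.2])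
  have hcut : ∀ τ : ℝ, 0 ≤ τ → ∀ x ∈ Icc 0 δ₀, 0 < τ ∨ 0 < x →
      a + (x : ℝ) ∈ cutPlane k (b + τ * I) := by
    intro τ hτ x hx h j' hcon
    by_cases hj : j' = j
    · rw [hj] at hcon
      have e : a + (x : ℂ) - (k j + (b + τ * I)) = x - τ * I := by rw [ha]; ring
      obtain ⟨h2, h3⟩ := hcon
      rw [e] at h2 h3
      simp at h2 h3
      rcases h with h | h <;> linarith
    · refine (hgood x hx).2.2.2.2.2 j' hj ?_
      have := hcon.1
      rw [sub_re, add_re (k j'), (hγ τ hτ).1] at this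
      linarith
  -- the value of the conjugated matrix at the corner
  have hpath : Tendsto (fun x : ℝ => a + (x : ℂ)) (𝓝[>] 0) (𝓝[cutPlane k b] a) := by
    refine tendsto_nhdsWithin_of_tendsto_nhds_of_eventually_within _ ?_ ?_
    · have : Continuous fun x : ℝ => a + (x : ℂ) := by fun_prop
      have h := this.tendsto 0
      simp only [ofReal_zero, add_zero] at h
      exact h.mono_left nhdsWithin_le_nhds
    · filter_upwards [Ioo_mem_nhdsGT hδ₀] with x hx
      have := hcut 0 le_rfl x ⟨hx.1.le, hx.2.le⟩ (Or.inr hx.1)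
      simpa using this
  have hRa : R b a = K * Matrix.diagonal (β a) * K⁻¹ := by
    have h2 : Tendsto (fun x : ℝ => R b (a + (x : ℂ))) (𝓝[>] 0) (𝓝 (R b a)) :=
      ((continuousAt_simpleFractions _ haρ).tendsto.mono_left nhdsWithin_le_nhds).comp hpath
    refine tendsto_nhds_unique h2 ((hconj.comp hpath).congr' ?_)
    filter_upwards [Ioo_mem_nhdsGT hδ₀, hpath.eventually self_mem_nhdsWithin] with x hx hxC
    exact hU.conj_eq hH hB hF h1 hb hxC (hgood x ⟨hx.1.le, hx.2.le⟩).2.2.2.2.1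
  have hβinj : Function.Injective (β a) := by
    rw [← hasDistinctEigenvalues_conj_diagonal hPdet]
    rwa [← hBP.self_of_nhds, Matrix.mul_nonsing_inv_cancel_right _ _ hPdet.isUnit]
  -- the conjugated matrix is diagonalized by `U P`
  have hRW : ∀ τ : ℝ, 0 ≤ τ → ∀ x ∈ Icc 0 δ₀, 0 < τ ∨ 0 < x →
      (U (b + τ * I) (a + x) * P (a + x)).det ≠ 0 ∧
      R (b + τ * I) (a + x) = (U (b + τ * I) (a + x) * P (a + x)) *
        Matrix.diagonal (β (a + x)) * (U (b + τ * I) (a + x) * P (a + x))⁻¹ := by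
    intro τ hτ x hx h
    obtain ⟨-, -, hBPx, hPx, hρx, -⟩ := hgood x hx
    have hwC := hcut τ hτ x hx h
    refine ⟨?_, ?_⟩
    · rw [Matrix.det_mul]
      exact mul_ne_zero (hU.det_ne_zero _ (hγ τ hτ) _ hwC) hPx
    · rw [hR]
      simp only
      rw [← hU.conj_eq hH hB hF h1 (hγ τ hτ) hwC hρx, Matrix.mul_inv_rev,
        Matrix.mul_assoc (U (b + τ * I) (a + x)) (P (a + x)), ← hBPx]
      simp only [Matrix.mul_assoc]
      rw [Matrix.mul_nonsing_inv_cancel_left _ _ hPx.isUnit]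
  -- the residue in the basis `K`
  set σ : Fin N → ℂ := fun i => (K⁻¹ * (s j b * K)) i i with hσ
  have hsσ : K⁻¹ * (s j b * K) = Matrix.diagonal σ := by
    refine eq_diagonal_of_commute hβinj ?_
    have hc : s j b * R b a = R b a * s j b := (h1.commute_residue hU hH hB hF hb j).eq
    rw [hRa] at hc
    have h2 := congrArg (fun M => K⁻¹ * (M * K)) hc
    simp only [Matrix.mul_assoc] at h2
    rw [Matrix.nonsing_inv_mul _ hK.isUnit, Matrix.mul_one,
      Matrix.nonsing_inv_mul_cancel_left _ _ hK.isUnit] at h2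
    simp only [Matrix.mul_assoc]
    exact h2
  have hsK : s j b = K * Matrix.diagonal σ * K⁻¹ := by
    rw [← hsσ, Matrix.mul_nonsing_inv_cancel_left _ _ hK.isUnit,
      Matrix.mul_nonsing_inv_cancel_right _ _ hK.isUnit]
  suffices hσe : ∀ i, σ i = -(logF j b i / (2 * Real.pi * I)) by
    rw [hsK]
    congr 3
    exact funext hσe
  intro i
  -- the scalar equation along the `i`-th eigenvector
  set Q : ℝ × ℝ → Matrix (Fin N) (Fin N) ℂ := fun q =>
    (R (b + q.1 * I) (a + q.2) - β (a + q.2) i • (1 : Matrix (Fin N) (Fin N) ℂ)).adjugate * K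
    with hQ
  set y : ℝ → ℝ → ℂ := fun τ x => (K⁻¹ * (U (b + τ * I) (a + x) * P (a + x))) i i with hy
  have hQW : ∀ τ : ℝ, 0 ≤ τ → ∀ x ∈ Icc 0 δ₀, 0 < τ ∨ 0 < x → ∃ c : ℂ,
      ∀ L : Matrix (Fin N) (Fin N) ℂ, (L * Q (τ, x)) i i =
        c * (L * (U (b + τ * I) (a + x) * P (a + x))) i i := by
    intro τ hτ x hx h
    obtain ⟨hdet, e⟩ := hRW τ hτ x hx h
    refine ⟨(∏ m ∈ Finset.univ.erase i, (β (a + x) m - β (a + x) i)) *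
      ((U (b + τ * I) (a + x) * P (a + x))⁻¹ * K) i i, fun L => ?_⟩
    simp only [hQ]
    rw [e, adjugate_conj_diagonal_sub hdet, mul_conj_single_mul_apply]
  have hQ0 : ∃ c : ℂ, c ≠ 0 ∧ ∀ L : Matrix (Fin N) (Fin N) ℂ,
      (L * Q (0, 0)) i i = c * (L * K) i i := by
    refine ⟨∏ m ∈ Finset.univ.erase i, (β a m - β a i), ?_, fun L => ?_⟩
    · exact Finset.prod_ne_zero_iff.2 fun m hm =>
        sub_ne_zero.2 fun e => (Finset.mem_erase.1 hm).1 (hβinj e)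
    · simp only [hQ, ofReal_zero, zero_mul, add_zero]
      rw [hRa, adjugate_conj_diagonal_sub hK, mul_conj_single_mul_apply,
        Matrix.nonsing_inv_mul _ hK.isUnit, Matrix.one_apply_eq, mul_one]
  -- continuity up to the corner
  have hγc : Continuous fun q : ℝ × ℝ => b + (q.1 : ℂ) * I := by fun_prop
  have hwc : Continuous fun q : ℝ × ℝ => a + (q.2 : ℂ) := by fun_prop
  set S₀ : Set (ℝ × ℝ) := Icc 0 δ₀ ×ˢ Icc 0 δ₀ with hS₀
  have hγmaps : MapsTo (fun q : ℝ × ℝ => b + (q.1 : ℂ) * I) S₀ halfLine := fun q hq =>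
    hγ _ hq.1.1
  have hQc : ContinuousOn Q S₀ := by
    have h2 : ContinuousOn (fun q : ℝ × ℝ => R (b + q.1 * I) (a + q.2)) S₀ := by
      simp only [hR, simpleFractions]
      refine continuousOn_const.add (continuousOn_finsetSum _ fun l _ => ContinuousOn.fun_smul ?_ ?_)
      · exact (hwc.sub continuous_const).continuousOn.inv₀ fun q hq =>
          sub_ne_zero.2 ((hgood q.2 hq.2).2.2.2.2.1 l)
      · have : ContinuousOn (conjResidue U ρ t l) halfLine := fun x hx =>
          h1.continuousWithinAt_conjResidue hU hB hx l
        exact this.comp hγc.continuousOn hγmaps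
    have h3 : ContinuousOn (fun q : ℝ × ℝ => β (a + q.2) i) S₀ := fun q hq =>
      ((continuous_apply i).continuousAt.comp (f := fun q : ℝ × ℝ => β (a + q.2))
        (ContinuousAt.comp (f := fun q : ℝ × ℝ => a + (q.2 : ℂ)) (hgood q.2 hq.2).2.1
          hwc.continuousAt)).continuousWithinAt
    exact ((continuous_id.matrix_adjugate).comp_continuousOn
      (h2.sub (h3.smul continuousOn_const))).mul continuousOn_const
  have hsc : ∀ j, ContinuousOn (fun q : ℝ × ℝ => s j (b + q.1 * I)) S₀ := fun j =>
    (hs j).comp hγc.continuousOn hγmaps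
  set den : ℝ × ℝ → ℂ := fun q => (K⁻¹ * Q q) i i with hden
  have hdenc : ContinuousOn den S₀ :=
    (continuous_id.matrix_elem i i).comp_continuousOn (continuousOn_const.mul hQc)
  have hden0 : den (0, 0) ≠ 0 := by
    obtain ⟨c, hc, h⟩ := hQ0
    rw [hden]
    simp only
    rw [h, Matrix.nonsing_inv_mul _ hK.isUnit, Matrix.one_apply_eq, mul_one]
    exact hc
  have h00 : ((0 : ℝ), (0 : ℝ)) ∈ S₀ := ⟨⟨le_rfl, hδ₀.le⟩, ⟨le_rfl, hδ₀.le⟩⟩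
  obtain ⟨δ, hδ, hδδ₀, hdenne⟩ : ∃ δ > 0, δ ≤ δ₀ ∧ ∀ q ∈ (Icc 0 δ ×ˢ Icc 0 δ : Set (ℝ × ℝ)),
      den q ≠ 0 := by
    have h2 := (hdenc _ h00).eventually_ne hden0
    obtain ⟨r, hr, hball⟩ := Metric.mem_nhdsWithin_iff.1 h2
    refine ⟨min δ₀ (r / 2), lt_min hδ₀ (half_pos hr), min_le_left _ _, fun q hq => hball ⟨?_, ?_⟩⟩
    · have e1 := hq.1.2.trans (min_le_right _ _)
      have e2 := hq.2.2.trans (min_le_right _ _)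
      rw [Metric.mem_ball, Prod.dist_eq, Real.dist_eq, Real.dist_eq, sub_zero, sub_zero,
        abs_of_nonneg hq.1.1, abs_of_nonneg hq.2.1]
      exact max_lt (by linarith) (by linarith)
    · exact ⟨⟨hq.1.1, hq.1.2.trans (min_le_left _ _)⟩, ⟨hq.2.1, hq.2.2.trans (min_le_left _ _)⟩⟩
  set S : Set (ℝ × ℝ) := Icc 0 δ ×ˢ Icc 0 δ with hS
  have hSS : S ⊆ S₀ := prod_mono (Icc_subset_Icc_right hδδ₀) (Icc_subset_Icc_right hδδ₀)
  set g : Fin p → ℝ × ℝ → ℂ := fun j' q => (K⁻¹ * s j' (b + q.1 * I) * Q q) i i / den q with hg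
  have hgc : ∀ j', ContinuousOn (g j') S := fun j' =>
    (((continuous_id.matrix_elem i i).comp_continuousOn
      ((continuousOn_const.mul (hsc j')).mul hQc)).mono hSS).div (hdenc.mono hSS) hdenne
  set m : ℝ × ℝ → ℂ := fun q => ∑ j' ∈ Finset.univ.erase j,
    (a + q.2 - (k j' + (b + q.1 * I)))⁻¹ * g j' q with hm
  have hmc : ContinuousOn m S := by
    refine continuousOn_finsetSum _ fun j' hj' => ContinuousOn.mul ?_ (hgc j')
    refine ContinuousOn.inv₀ (by fun_prop) fun q hq h => ?_
    refine (hgood q.2 (hSS hq).2).2.2.2.2.2 j' (Finset.mem_erase.1 hj').1 ?_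
    have := congrArg re h
    rw [sub_re, add_re (k j'), (hγ q.1 hq.1.1).1, zero_re] at this
    linarith
  set α : ℝ → ℝ → ℂ := fun τ x => g j (τ, x) / ((x : ℂ) - τ * I) + m (τ, x) with hα
  have hα' : ∀ τ x : ℝ, α τ x = (K⁻¹ * ((∑ j', (a + x - (k j' + (b + τ * I)))⁻¹ •
      s j' (b + τ * I)) * Q (τ, x))) i i / den (τ, x) := by
    intro τ x
    have e1 : (K⁻¹ * ((∑ j', (a + x - (k j' + (b + τ * I)))⁻¹ • s j' (b + τ * I)) *
        Q (τ, x))) i i = ∑ j', (a + x - (k j' + (b + τ * I)))⁻¹ *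
          (K⁻¹ * s j' (b + τ * I) * Q (τ, x)) i i := by
      rw [Finset.sum_mul, Finset.mul_sum, Matrix.sum_apply]
      refine Finset.sum_congr rfl fun j' _ => ?_
      rw [Matrix.smul_mul, Matrix.mul_smul, Matrix.smul_apply, smul_eq_mul, Matrix.mul_assoc]
    have e2 : a + (x : ℂ) - (k j + (b + τ * I)) = x - τ * I := by rw [ha]; ring
    rw [e1, ← Finset.add_sum_erase Finset.univ _ (Finset.mem_univ j), e2, add_div,
      Finset.sum_div]
    simp only [hα, hm, hg]
    congr 1
    · ring
    · exact Finset.sum_congr rfl fun j' _ => by ring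
  have hg0 : g j (0, 0) = σ i := by
    obtain ⟨c, hc, h⟩ := hQ0
    simp only [hg, hden]
    rw [h, h, ofReal_zero, zero_mul, add_zero, Matrix.nonsing_inv_mul _ hK.isUnit,
      Matrix.one_apply_eq, mul_one, mul_div_cancel_left₀ _ hc, Matrix.mul_assoc]
  have hmain := residue_eq_exponent (y := y) (α := α) (n₀ := σ i)
    (e := -(logF j b i / (2 * Real.pi * I))) (c₀ := 1) (c₁ := y δ 0) hδ ?_ ?_ ?_ ?_ one_ne_zero
    ?_ ?_
  · exact hmain
  · intro x hx τ hτ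
    have hx' : x ∈ Icc 0 δ₀ := ⟨hx.1.le, hx.2.le.trans hδδ₀⟩
    obtain ⟨c, hc⟩ := hQW τ hτ.1 x hx' (Or.inr hx.1)
    have hd := hdenne (τ, x) ⟨hτ, hx.1.le, hx.2.le⟩
    have hd' : den (τ, x) = c * y τ x := hc K⁻¹
    have h2 := h1.hasDerivAt_ray hb (by linarith [hτ.1, hb.2])
      (hcut τ hτ.1 x hx' (Or.inr hx.1)) K⁻¹ (P (a + x)) i i
    convert! h2 using 1
    rw [mul_assoc]
    congr 1
    rw [hα', ← Matrix.mul_assoc K⁻¹, hc, hd', Matrix.mul_assoc K⁻¹]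
    rw [hd'] at hd
    have hc0 := left_ne_zero_of_mul hd
    have hy0 := right_ne_zero_of_mul hd
    field_simp
  · have hsub : Icc 0 δ ×ˢ Ioo 0 δ ⊆ S := prod_mono le_rfl Ioo_subset_Icc_self
    refine (((hgc j).mono hsub).div (by fun_prop) fun q hq h => ?_).add (hmc.mono hsub)
    have := congrArg re h
    simp at this
    exact hq.2.1.ne' this
  · intro ε' hε'
    rw [← hg0]
    exact pole_estimate hδ (hgc j) hmc hε'
  · have h2 := tendsto_matrix_iff.1 ((hlim.comp hpath).const_mul K⁻¹) i i
    rw [Matrix.nonsing_inv_mul _ hK.isUnit, Matrix.one_apply_eq] at h2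
    refine h2.congr' ?_
    filter_upwards [self_mem_nhdsWithin] with x hx
    simp only [Function.comp_apply, hy, ofReal_zero, zero_mul, add_zero]
    rw [← Matrix.mul_assoc K⁻¹, Matrix.mul_diagonal, add_sub_cancel_left, upPow, upLog_ofReal hx]
  · have haδ : a ∈ cutPlane k (b + δ * I) := by
      have := hcut δ hδ.le 0 ⟨le_rfl, hδ₀.le⟩ (Or.inl hδ)
      simpa using this
    have hUc := (hU.continuousAt (hγ δ hδ.le) haδ).mul hPc.self_of_nhds
    have h2 : Tendsto (fun x : ℝ => U (b + δ * I) (a + x) * P (a + x)) (𝓝[>] 0)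
        (𝓝 (U (b + δ * I) a * P a)) := hUc.tendsto.comp (hpath.mono_right nhdsWithin_le_nhds)
    have h3 := tendsto_matrix_iff.1 (h2.const_mul K⁻¹) i i
    simpa only [hy, ofReal_zero, add_zero] using h3
  · intro h0
    obtain ⟨c, hc⟩ := hQW δ hδ.le 0 ⟨le_rfl, hδ₀.le⟩ (Or.inl hδ)
    refine hdenne (δ, 0) ⟨⟨hδ.le, le_rfl⟩, ⟨le_rfl, hδ.le⟩⟩ ?_
    rw [hden]
    simp only
    rw [hc]
    exact mul_eq_zero_of_right _ h0

end Family

/-! ### Eigenvalues and eigenvectors of commuting matrices -/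

theorem HasDistinctEigenvalues.mulVec_eq_of_commute {N : ℕ} {Y Z : Matrix (Fin N) (Fin N) ℂ}
    (hY : HasDistinctEigenvalues Y) (h : Commute Z Y) {v : Fin N → ℂ} {y : ℂ}
    (hv : Y.mulVec v = y • v) : ∃ x : ℂ, Z.mulVec v = x • v := by
  obtain ⟨P, d, hP, hd, rfl⟩ := hY.exists_diagonalization
  have hPu := hP.isUnit
  set σ : Fin N → ℂ := fun i => (P⁻¹ * Z * P) i i with hσ
  have hZ : P⁻¹ * Z * P = Matrix.diagonal σ := by
    refine eq_diagonal_of_commute hd ?_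
    have h2 := congrArg (fun M => P⁻¹ * M * P) h.eq
    simp only [Matrix.mul_assoc] at h2
    rw [Matrix.nonsing_inv_mul _ hPu, Matrix.mul_one,
      Matrix.nonsing_inv_mul_cancel_left _ _ hPu] at h2
    simp only [Matrix.mul_assoc]
    exact h2
  set u := P⁻¹.mulVec v with hu
  have hvu : v = P.mulVec u := by
    rw [hu, Matrix.mulVec_mulVec, Matrix.mul_nonsing_inv _ hPu, Matrix.one_mulVec]
  have hdu : ∀ i, d i * u i = y * u i := by
    intro i
    have h2 := congrFun (congrArg P⁻¹.mulVec hv) i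
    rw [Matrix.mulVec_mulVec, Matrix.mulVec_smul, ← hu, Matrix.mul_assoc P,
      Matrix.nonsing_inv_mul_cancel_left _ _ hPu, ← Matrix.mulVec_mulVec, ← hu,
      Matrix.mulVec_diagonal] at h2
    simpa using h2
  have hZv : ∀ x : ℂ, (∀ i, σ i * u i = x * u i) → Z.mulVec v = x • v := by
    intro x hx
    have hZ' : Z = P * Matrix.diagonal σ * P⁻¹ := by
      rw [← hZ, Matrix.mul_assoc P⁻¹, Matrix.mul_nonsing_inv_cancel_left _ _ hPu,
        Matrix.mul_nonsing_inv_cancel_right _ _ hPu]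
    have h2 : (Matrix.diagonal σ).mulVec u = x • u := by
      ext i
      rw [Matrix.mulVec_diagonal, hx i]; rfl
    rw [hZ', ← Matrix.mulVec_mulVec, ← hu, ← Matrix.mulVec_mulVec, h2, Matrix.mulVec_smul, ← hvu]
  by_cases h0 : ∃ i, u i ≠ 0
  · obtain ⟨i, hi⟩ := h0
    refine ⟨σ i, hZv _ fun m => ?_⟩
    by_cases hm : u m = 0
    · rw [hm, mul_zero, mul_zero]
    · rw [hd ((mul_right_cancel₀ hm (hdu m)).trans (mul_right_cancel₀ hi (hdu i)).symm)]
  · push Not at h0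
    exact ⟨0, hZv _ fun m => by rw [h0 m, mul_zero, mul_zero]⟩

theorem HasDistinctEigenvalues.exists_eigenData {N : ℕ} (X : Matrix (Fin N) (Fin N) ℂ)
    {Y : Matrix (Fin N) (Fin N) ℂ} (hY : HasDistinctEigenvalues Y) :
    ∃ Z : Matrix (Fin N) (Fin N) ℂ, Z.charpoly = X.charpoly ∧ Commute Z Y := by
  obtain ⟨P, d, hP, -, rfl⟩ := hY.exists_diagonalization
  obtain ⟨x, hx⟩ : ∃ x : Fin N → ℂ, X.charpoly = ∏ i, (Polynomial.X - Polynomial.C (x i)) := by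
    have hsplit := IsAlgClosed.splits X.charpoly
    have hcard : X.charpoly.roots.toList.length = N := by
      rw [Multiset.length_toList, Polynomial.splits_iff_card_roots.1 hsplit,
        Matrix.charpoly_natDegree_eq_dim, Fintype.card_fin]
    refine ⟨fun i => X.charpoly.roots.toList.get (i.cast hcard.symm), ?_⟩
    conv_lhs => rw [hsplit.eq_prod_roots_of_monic (Matrix.charpoly_monic X)]
    rw [← Equiv.prod_comp (finCongr hcard) fun i : Fin N =>
      Polynomial.X - Polynomial.C (X.charpoly.roots.toList.get (i.cast hcard.symm))]
    conv_lhs => rw [← Multiset.coe_toList X.charpoly.roots]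
    rw [Multiset.map_coe, Multiset.prod_coe, ← List.prod_ofFn]
    congr 1
    refine List.ext_get (by simp) fun n h1 h2 => by simp
  refine ⟨P * Matrix.diagonal x * P⁻¹, by rw [charpoly_conj_diagonal hP, hx], ?_⟩
  have hmul : ∀ a b : Fin N → ℂ, P * Matrix.diagonal a * P⁻¹ * (P * Matrix.diagonal b * P⁻¹) =
      P * (Matrix.diagonal a * Matrix.diagonal b) * P⁻¹ := fun a b => by
    simp only [Matrix.mul_assoc]
    rw [Matrix.nonsing_inv_mul_cancel_left _ _ hP.isUnit]
  rw [Commute, SemiconjBy, hmul, hmul, Matrix.diagonal_mul_diagonal, Matrix.diagonal_mul_diagonal]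
  simp only [mul_comm]

/-- The map `𝓕` may be prescribed at one pair `(X, Y)`. -/
theorem exists_isEigenDataMap {N : ℕ} {X Y Z : Matrix (Fin N) (Fin N) ℂ}
    (h : HasDistinctEigenvalues Y → Z.charpoly = X.charpoly ∧ Commute Z Y) :
    ∃ 𝓕 : Matrix (Fin N) (Fin N) ℂ → Matrix (Fin N) (Fin N) ℂ → Matrix (Fin N) (Fin N) ℂ,
      IsEigenDataMap 𝓕 ∧ 𝓕 X Y = Z := by
  classical
  have hex : ∀ X' Y' : Matrix (Fin N) (Fin N) ℂ, ∃ Z' : Matrix (Fin N) (Fin N) ℂ,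
      (HasDistinctEigenvalues Y' → Z'.charpoly = X'.charpoly ∧ Commute Z' Y') ∧
      (X' = X ∧ Y' = Y → Z' = Z) := by
    intro X' Y'
    by_cases e : X' = X ∧ Y' = Y
    · obtain ⟨rfl, rfl⟩ := e
      exact ⟨Z, h, fun _ => rfl⟩
    · by_cases hY : HasDistinctEigenvalues Y'
      · obtain ⟨Z', hZ'⟩ := hY.exists_eigenData X'
        exact ⟨Z', fun _ => hZ', fun e' => absurd e' e⟩
      · exact ⟨0, fun h' => absurd h' hY, fun e' => absurd e' e⟩
  choose 𝓕 h𝓕 using hex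
  refine ⟨𝓕, fun X' Y' hY => ⟨((h𝓕 X' Y').1 hY).1, fun v y hv =>
    hY.mulVec_eq_of_commute ((h𝓕 X' Y').1 hY).2 hv⟩, (h𝓕 X Y).2 ⟨rfl, rfl⟩⟩

section Family

variable {p N d : ℕ} {ε : ℝ} {k : Fin p → ℂ} {H : Fin p → ℂ → Matrix (Fin N) (Fin N) ℂ}
  {logF : Fin p → ℂ → Fin N → ℂ} {U : ℂ → ℂ → Matrix (Fin N) (Fin N) ℂ}
  {s : Fin p → ℂ → Matrix (Fin N) (Fin N) ℂ}
  {ρ : Fin d → ℂ} {t : Fin d → Matrix (Fin N) (Fin N) ℂ}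

/-- The eigenvalues of `s_j(b)` are those of `-log F_j(k_j + b) / (2πi)`: both sides are
continuous in `b`, and the generic `b` are dense. -/
theorem ODE1.charpoly_residue (h1 : ODE1 k s U) (hs : ∀ j, ContinuousOn (s j) halfLine)
    (hU : IsRHFamily k H logF U)
    (hH : IsCoefficientFamily ε k H) (hB : IsCommutingRational ε k H ρ t)
    (hF : IsLogEigenvalues k H logF) {b : ℂ} (hb : b ∈ halfLine) (j : Fin p) :
    (s j b).charpoly = (tildeF (logF j b)).charpoly := by
  have hgen : ∀ᶠ x in 𝓝[halfLine \ {b}] b,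
      (s j x).charpoly = (tildeF (logF j x)).charpoly := by
    have hfin := (hB.finite_halfLine j).subset (sdiff_subset (t := {b}))
    have h2 : ∀ᶠ x in 𝓝[halfLine \ {b}] b, x ∉ {b ∈ halfLine |
        ¬ HasDistinctEigenvalues (simpleFractions ρ t (k j + b))} \ {b} :=
      mem_nhdsWithin_of_mem_nhds (hfin.isClosed.isOpen_compl.mem_nhds fun h => h.2 rfl)
    filter_upwards [h2, hH.eventually_distinct hb, self_mem_nhdsWithin] with x hx hHx hxb
    have hBx : HasDistinctEigenvalues (simpleFractions ρ t (k j + x)) := by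
      by_contra hcon
      exact hx ⟨⟨hxb.1, hcon⟩, hxb.2⟩
    obtain ⟨K, hK, hsK⟩ := h1.residue_eq_conj_diagonal hs hU hH hB hF hxb.1 (hHx j) hBx
    rw [hsK, charpoly_conj_diagonal hK, tildeF, Matrix.charpoly_diagonal]
    refine Finset.prod_congr rfl fun m _ => ?_
    congr 2
    ring
  have := halfLine_nhdsWithin_neBot hb
  have hle : 𝓝[halfLine \ {b}] b ≤ 𝓝[halfLine] b := nhdsWithin_mono _ sdiff_subset
  refine Polynomial.funext fun z => ?_
  rw [Matrix.eval_charpoly, Matrix.eval_charpoly]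
  have hdet : Continuous fun M : Matrix (Fin N) (Fin N) ℂ => (Matrix.scalar (Fin N) z - M).det :=
    (continuous_const.sub continuous_id).matrix_det
  have htil : Continuous fun e : Fin N → ℂ => tildeF e := by
    refine Continuous.matrix_diagonal ?_
    fun_prop
  have hl1 := (hdet.tendsto _).comp (((hs j) b hb).tendsto.mono_left hle)
  have hl2 := ((hdet.comp htil).tendsto _).comp ((hF.continuousOn j b hb).tendsto.mono_left hle)
  refine tendsto_nhds_unique (hl1.congr' ?_) hl2
  filter_upwards [hgen] with x hx
  simp only [Function.comp_apply]
  rw [← Matrix.eval_charpoly, hx, Matrix.eval_charpoly]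

theorem ODE1.exists_ode2Algebraic (h1 : ODE1 k s U) (hs : ∀ j, ContinuousOn (s j) halfLine)
    (hU : IsRHFamily k H logF U)
    (hH : IsCoefficientFamily ε k H) (hB : IsCommutingRational ε k H ρ t)
    (hF : IsLogEigenvalues k H logF) :
    ∃ 𝓕 : Fin p → ℂ → Matrix (Fin N) (Fin N) ℂ → Matrix (Fin N) (Fin N) ℂ →
        Matrix (Fin N) (Fin N) ℂ,
      (∀ j b, IsEigenDataMap (𝓕 j b)) ∧ ODE2Algebraic k logF ρ s (conjResidue U ρ t) 𝓕 := by
  have hex : ∀ (j : Fin p) (b : ℂ), ∃ 𝓕 : Matrix (Fin N) (Fin N) ℂ →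
      Matrix (Fin N) (Fin N) ℂ → Matrix (Fin N) (Fin N) ℂ, IsEigenDataMap 𝓕 ∧
      (b ∈ halfLine → 𝓕 (tildeF (logF j b))
        (simpleFractions ρ (fun l => conjResidue U ρ t l b) (k j + b)) = s j b) := by
    intro j b
    by_cases hb : b ∈ halfLine
    · obtain ⟨𝓕, h𝓕, e⟩ := exists_isEigenDataMap (X := tildeF (logF j b))
        (Y := simpleFractions ρ (fun l => conjResidue U ρ t l b) (k j + b)) (Z := s j b)
        fun _ => ⟨h1.charpoly_residue hs hU hH hB hF hb j,
          h1.commute_residue hU hH hB hF hb j⟩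
      exact ⟨𝓕, h𝓕, fun _ => e⟩
    · obtain ⟨𝓕, h𝓕, -⟩ := exists_isEigenDataMap (N := N) (X := 0) (Y := 0) (Z := 0)
        fun _ => ⟨rfl, Commute.refl _⟩
      exact ⟨𝓕, h𝓕, fun h => absurd h hb⟩
  choose 𝓕 h𝓕 hs𝓕 using hex
  refine ⟨𝓕, h𝓕, fun j => ⟨?_, fun b hb _ => (hs𝓕 j b hb).symm⟩⟩
  refine (hB.finite_halfLine j).subset ?_
  rintro b ⟨hb, h⟩
  exact ⟨hb, fun h' => h ((hU.hasDistinctEigenvalues_iff hH hB hF h1 hb j).2 h')⟩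

end Family

theorem theorem2 {p N : ℕ} (ε : ℝ) (k : Fin p → ℂ)
    (H : Fin p → ℂ → Matrix (Fin N) (Fin N) ℂ) (logF : Fin p → ℂ → Fin N → ℂ)
    (U : ℂ → ℂ → Matrix (Fin N) (Fin N) ℂ) (s : Fin p → ℂ → Matrix (Fin N) (Fin N) ℂ)
    (hH : IsCoefficientFamily ε k H) (hF : IsLogEigenvalues k H logF)
    (hU : IsRHFamily k H logF U)
    (hs : ∀ j, ContinuousOn (s j) halfLine) (hODE1 : ODE1 k s U) :
    (∃ (d : ℕ) (ρ : Fin d → ℂ) (t : Fin d → Matrix (Fin N) (Fin N) ℂ),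
      IsCommutingRational ε k H ρ t) ∧
    ∀ (d : ℕ) (ρ : Fin d → ℂ) (t : Fin d → Matrix (Fin N) (Fin N) ℂ),
      IsCommutingRational ε k H ρ t →
      ∃ (r : Fin d → ℂ → Matrix (Fin N) (Fin N) ℂ)
        (𝓕 : Fin p → ℂ → Matrix (Fin N) (Fin N) ℂ → Matrix (Fin N) (Fin N) ℂ →
          Matrix (Fin N) (Fin N) ℂ),
        (∀ b ∈ halfLine, ∀ w ∈ cutPlane k b, (∀ l, w ≠ ρ l) →
          U b w * simpleFractions ρ t w * (U b w)⁻¹ =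
            simpleFractions ρ (fun l => r l b) w) ∧
        (∀ j b, IsEigenDataMap (𝓕 j b)) ∧
        ODE2Differential k ρ s r ∧
        ODE2Algebraic k logF ρ s r 𝓕 := by
  refine ⟨hH.exists_commutingRational, fun d ρ t hB => ?_⟩
  obtain ⟨𝓕, h𝓕, halg⟩ := hODE1.exists_ode2Algebraic hs hU hH hB hF
  exact ⟨conjResidue U ρ t, 𝓕, fun b hb w hw hwρ => hU.conj_eq hH hB hF hODE1 hb hw hwρ, h𝓕,
    hODE1.ode2Differential hU hB, halg⟩
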